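/- **Conventions.** A contact form on a smooth (Hausdorff, second countable) manifold $M$ of dimension $2n-1$ is a smooth $1$-form $\alpha$ with $\alpha\wedge(d\alpha)^{n-1}\neq 0$ everywhere; $\xi=\ker\alpha$ is a symplectic vector bundle with the form $d\alpha$, and $c_1(\xi)$ is its first Chern class. The Reeb field $R_\alpha$ is given by $\alpha(R_\alpha)=1$, $\iota_{R_\alpha}d\alpha=0$. For a path $\Psi:[0,1]\to \mathrm{Sp}(2n-2)$ with $\Psi(0)=\mathrm{id}$ let $\mu_{LCZ}(\Psi)$ be the lower semicontinuous extension of the Conley–Zehnder index, that is, the lower limit of $\mu_{CZ}(\Phi)$ over paths $\Phi\to\Psi$ in $C^0$ with $\Phi(0)=\mathrm{id}$ and $\det(\Phi(1)-\mathrm{id})\neq0$. Suppose $c_1(\xi)$ vanishes in $H^2(M;\mathbb Q)$. For a contractible closed Reeb orbit $\gamma$ (of any period $T>0$, not necessarily minimal), $\mu_{LCZ}^{\mathbb Q}(\gamma)$ is the index $\mu_{LCZ}$ of the linearized Reeb flow $d\phi_t|_\xi$, $0\le t\le T$, along $\gamma$, written in a symplectic trivialization of $\gamma^*\xi$ that extends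 over a disc bounded by $\gamma$; it does not depend on the disc and the trivialization. The contact form $\alpha$ is *dynamically convex* if $c_1(\xi)=0$ in $H^2(M;\mathbb Q)$ and $\mu_{LCZ}^{\mathbb Q}(\gamma)\ge n+1$ for every contractible closed Reeb orbit $\gamma$. **Proposition.** (1) Let $\alpha$ be a dynamically convex contact form on a manifold $M$ of dimension $2n-1$, and suppose that $c_1(\ker\alpha)=0$ in $H^2(M;\mathbb Z)$. Let a discrete group $G$ act smoothly, freely and properly on $M$ so that $\alpha$ is $G$-invariant. Then there is exactly one $1$-form $\hat\alpha$ on the quotient manifold $M/G$ whose pullback under the projection $M\to M/G$ is $\alpha$, this $\hat\alpha$ is a contact form, and if $c_1(\ker\hat\alpha)=0$ in $H^2(M/G;\mathbb Q)$, then $\hat\alpha$ is dynamically convex. (2) Let $p\ge1$ and $q\ge 0$ be coprime integers, and let $L(p,q)$ be the lens space, the quotient of $S^3\subset\mathbb C^2$ by the action $\zeta\cdot(z_0,z_1)=(\zeta z_0,\zeta^q z_1)$ of the group of $p$-th roots of unity. Then the standard contact form $\tfrac12\sum_j(x_j\,dy_j-y_j\,dx_j)$ on $S^3$ descends to a contact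 form on $L(p,q)$, and this contact form is dynamically convex. -/

import Mathlib

open Set Filter
open scoped Manifold ContDiff Topology

noncomputable section

namespace ContactGeometry

/-! ### The Conley-Zehnder index and its lower semicontinuous extension -/

section Index

variable {m : ℕ}

/-- Real `2m × 2m` matrices, acting on `ℝ^{2m}` with coordinates `(x, y)`, `x = Sum.inl`,
`y = Sum.inr`; the complex structure is `z = x + i y`. -/
abbrev Mat (m : ℕ) : Type := Matrix (Fin m ⊕ Fin m) (Fin m ⊕ Fin m) ℝ

/-- Continuous paths `[0,1] → Sp(2m)`, with the topology of uniform convergence. -/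
abbrev SpPath (m : ℕ) : Type := C(unitInterval, Matrix.symplecticGroup (Fin m) ℝ)

/-- The complex determinant of the complex linear part of a real matrix. On `U(m) ⊆ Sp(2m)`, the
matrices `fromBlocks X (-Y) Y X`, it is `det (X + i Y)`. It has no zero on `Sp(2m)`, and its
argument `Sp(2m) → S¹` is the circle map (unique up to homotopy) that extends
`det : U(m) → S¹`. -/
def complexDet (A : Mat m) : ℂ :=
  Matrix.det (Matrix.of fun i j : Fin m ↦
    (((A (.inl i) (.inl j) + A (.inr i) (.inr j)) / 2 : ℝ) : ℂ) +
      (((A (.inr i) (.inl j) - A (.inl i) (.inr j)) / 2 : ℝ) : ℂ) * Complex.I)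

/-- `θ` is a continuous argument of `complexDet` along the path `Ψ`. -/
def IsArgument (Ψ : SpPath m) (θ : C(unitInterval, ℝ)) : Prop :=
  ∀ t, complexDet (Ψ t : Mat m)
    = (‖complexDet (Ψ t : Mat m)‖ : ℂ) * Complex.exp ((θ t : ℂ) * Complex.I)

/-- `A` does not have `1` as an eigenvalue. -/
def Nondegenerate (A : Mat m) : Prop := (A - 1).det ≠ 0

/-- The base point `-1` of one of the two components of the nondegenerate part of `Sp(2m)`. -/
def basePlus (m : ℕ) : Mat m := -1

/-- The base point `diag(2, -1, …, -1, 1/2, -1, …, -1)` of the other component. -/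
def baseMinus (m : ℕ) : Mat m :=
  Matrix.diagonal (Sum.elim (fun i ↦ if i.val = 0 then 2 else -1)
    (fun i ↦ if i.val = 0 then 1 / 2 else -1))

/-- `k` is the Conley-Zehnder index of the path `Ψ` from `1` to a nondegenerate matrix: extend `Ψ`
inside the nondegenerate matrices to one of the two base points; then `k` is the degree of the
square of the circle map along the extended path, that is, the total variation of the argument
divided by `π`. -/
def IsConleyZehnderIndex (Ψ : SpPath m) (k : ℤ) : Prop :=
  Ψ 0 = 1 ∧ ∃ Φ : SpPath m, Φ 0 = Ψ 1 ∧ (∀ t, Nondegenerate (Φ t : Mat m)) ∧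
    ((Φ 1 : Mat m) = basePlus m ∨ (Φ 1 : Mat m) = baseMinus m) ∧
    ∃ θ η : C(unitInterval, ℝ), IsArgument Ψ θ ∧ IsArgument Φ η ∧ η 0 = θ 1 ∧
      η 1 - θ 0 = k * Real.pi

/-- The Conley-Zehnder index of a path from `1` to a nondegenerate matrix, as an extended real
(the infimum runs over a single integer). -/
def conleyZehnder (Ψ : SpPath m) : EReal :=
  ⨅ k ∈ {k : ℤ | IsConleyZehnderIndex Ψ k}, ((k : ℝ) : EReal)

/-- The lower semicontinuous extension `μ_LCZ` of the Conley-Zehnder index to all paths in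
`Sp(2m)` that start at `1`: the lower limit of the indices of the paths near `Ψ` that start at `1`
and end at a nondegenerate matrix. -/
def lowerConleyZehnder (Ψ : SpPath m) : EReal :=
  liminf conleyZehnder
    (𝓝[{Φ : SpPath m | Φ 0 = 1 ∧ Nondegenerate (Φ 1 : Mat m)}] Ψ)

end Index

/-! ### Contact forms -/

section Forms

variable {E : Type*} [NormedAddCommGroup E] [NormedSpace ℝ E]
  {M : Type*} [TopologicalSpace M] [ChartedSpace E M]

variable (E M) in
/-- A (not necessarily smooth) `1`-form on a manifold `M` modelled on `E`. -/
abbrev OneForm := (p : M) → TangentSpace 𝓘(ℝ, E) p →L[ℝ] ℝ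

/-- Smoothness of a `1`-form, as a section of the cotangent bundle. -/
def OneForm.IsSmooth [IsManifold 𝓘(ℝ, E) ∞ M] (α : OneForm E M) : Prop :=
  ContMDiff 𝓘(ℝ, E) (𝓘(ℝ, E).prod 𝓘(ℝ, E →L[ℝ] ℝ)) ∞
    (fun p ↦ Bundle.TotalSpace.mk' (E →L[ℝ] ℝ)
      (E := fun p : M ↦ TangentSpace 𝓘(ℝ, E) p →L[ℝ] ℝ) p (α p))

/-- The pullback of a `1`-form. -/
def OneForm.pullback {N : Type*} [TopologicalSpace N] [ChartedSpace E N] (f : N → M)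
    (α : OneForm E M) : OneForm E N :=
  fun p ↦ (α (f p)).comp (mfderiv 𝓘(ℝ, E) 𝓘(ℝ, E) f p)

/-- The `1`-form `α` in the preferred chart at `p`. -/
def OneForm.inChart (α : OneForm E M) (p : M) (y : E) : E →L[ℝ] ℝ :=
  (α ((extChartAt 𝓘(ℝ, E) p).symm y)).comp
    (mfderiv 𝓘(ℝ, E) 𝓘(ℝ, E) (extChartAt 𝓘(ℝ, E) p).symm y)

/-- The exterior derivative `dα` at `p`, computed in the preferred chart at `p`:
`dα(v, w) = (D_v α)(w) - (D_w α)(v)`. -/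
def OneForm.d (α : OneForm E M) (p : M) (v w : TangentSpace 𝓘(ℝ, E) p) : ℝ :=
  let x : E := extChartAt 𝓘(ℝ, E) p p
  let v' : E := mfderiv 𝓘(ℝ, E) 𝓘(ℝ, E) (extChartAt 𝓘(ℝ, E) p) p v
  let w' : E := mfderiv 𝓘(ℝ, E) 𝓘(ℝ, E) (extChartAt 𝓘(ℝ, E) p) p w
  fderiv ℝ (α.inChart p) x v' w' - fderiv ℝ (α.inChart p) x w' v'

/-- A contact form: a smooth nowhere vanishing `1`-form `α` such that `dα` is nondegenerate on
`ξ = ker α`. (On a manifold of dimension `2n - 1` this says that `α ∧ (dα)^{n-1}` has no zero.) -/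
structure IsContactForm [IsManifold 𝓘(ℝ, E) ∞ M] (α : OneForm E M) : Prop where
  smooth : α.IsSmooth
  ne_zero : ∀ p, α p ≠ 0
  nondegenerate : ∀ (p : M) (v : TangentSpace 𝓘(ℝ, E) p), α p v = 0 →
    (∀ w : TangentSpace 𝓘(ℝ, E) p, α p w = 0 → α.d p v w = 0) → v = 0

/-- `v` is the value at `p` of the Reeb vector field of `α`. -/
def IsReebVector (α : OneForm E M) (p : M) (v : TangentSpace 𝓘(ℝ, E) p) : Prop :=
  α p v = 1 ∧ ∀ w : TangentSpace 𝓘(ℝ, E) p, α.d p v w = 0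

/-- The curve `c` has at time `t` the Reeb vector as its velocity. -/
def HasReebVelocity (α : OneForm E M) (c : ℝ → M) (t : ℝ) : Prop :=
  ∃ v : TangentSpace 𝓘(ℝ, E) (c t), IsReebVector α (c t) v ∧
    HasMFDerivAt 𝓘(ℝ, ℝ) 𝓘(ℝ, E) c t ((1 : ℝ →L[ℝ] ℝ).smulRight v)

/-- `γ` is a closed Reeb orbit with (not necessarily minimal) period `T > 0`. -/
structure IsClosedReebOrbit (α : OneForm E M) (γ : ℝ → M) (T : ℝ) : Prop where
  pos : 0 < T
  periodic : Function.Periodic γ T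
  velocity : ∀ t, HasReebVelocity α γ t

/-- A symplectic basis `(e₁, …, e_m, f₁, …, f_m)` of `(ker α_p, dα_p)`, where `dim ker α_p = 2m`,
`e = b ∘ inl` and `f = b ∘ inr`. -/
structure IsSymplecticBasis {m : ℕ} (α : OneForm E M) (p : M)
    (b : Fin m ⊕ Fin m → TangentSpace 𝓘(ℝ, E) p) : Prop where
  mem_ker : ∀ a, α p (b a) = 0
  inl_inl : ∀ i j, α.d p (b (.inl i)) (b (.inl j)) = 0
  inr_inr : ∀ i j, α.d p (b (.inr i)) (b (.inr j)) = 0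
  inl_inr : ∀ i j, α.d p (b (.inl i)) (b (.inr j)) = if i = j then 1 else 0

/-- The matrix whose columns are the coordinates of the vectors `w` of `ker α_p` in the symplectic
basis `b`: the coefficient of `e_i` in a vector `v` is `dα(v, f_i)`, that of `f_i` is
`dα(e_i, v)`. -/
def coordMatrix {m : ℕ} (α : OneForm E M) (p : M)
    (b w : Fin m ⊕ Fin m → TangentSpace 𝓘(ℝ, E) p) : Mat m :=
  Matrix.of fun r c ↦ Sum.elim (fun i ↦ α.d p (w c) (b (.inr i)))
    (fun i ↦ α.d p (b (.inl i)) (w c)) r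

/-! ### The first Chern class of the contact structure -/

/-- An open cover of `M` (indexed by the points of `M`, which is no restriction) with continuous
symplectic frames of `(ker α, dα)` over its members whose transition matrices are unitary; this is
a reduction of the structure group `Sp(2m)` to `U(m)`, that is, a compatible complex structure on
the symplectic vector bundle `ker α`, with a unitary trivialization over each member. -/
structure UnitaryFrameCover [IsManifold 𝓘(ℝ, E) ∞ M] (m : ℕ) (α : OneForm E M) where
  U : M → Set M
  isOpen : ∀ i, IsOpen (U i)
  mem : ∀ i, i ∈ U i
  frame : M → (p : M) → Fin m ⊕ Fin m → TangentSpace 𝓘(ℝ, E) p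
  continuousOn : ∀ i a,
    ContinuousOn (fun p ↦ (⟨p, frame i p a⟩ : TangentBundle 𝓘(ℝ, E) M)) (U i)
  symplectic : ∀ i, ∀ p ∈ U i, IsSymplecticBasis α p (frame i p)
  unitary : ∀ i j, ∀ p ∈ U i ∩ U j,
    (coordMatrix α p (frame i p) (frame j p)).transpose *
      coordMatrix α p (frame i p) (frame j p) = 1

/-- The transition functions of the complex determinant line bundle of `ker α`. -/
def UnitaryFrameCover.transition [IsManifold 𝓘(ℝ, E) ∞ M] {m : ℕ} {α : OneForm E M}
    (c : UnitaryFrameCover m α) (i j p : M) : ℂ :=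
  complexDet (coordMatrix α p (c.frame i p) (c.frame j p))

/-- The first Chern class `c₁(ker α)` (the class of the determinant line bundle) maps to zero in
the Čech cohomology group `Ȟ²(M; A)`, where `ℤ ⊆ A ⊆ ℝ`: for some open cover with unitary frames
and some continuous logarithms `φ` of the transition functions `exp (2π i φ)` of the determinant
line bundle, the integral cocycle `c_{ijk} = φ_{jk} - φ_{ik} + φ_{ij}`, which represents `c₁`, is
the coboundary of a cochain `b` of locally constant functions with values in `A`. -/
def FirstChernClassVanishes [IsManifold 𝓘(ℝ, E) ∞ M] (A : AddSubgroup ℝ) (m : ℕ)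
    (α : OneForm E M) : Prop :=
  ∃ (c : UnitaryFrameCover m α) (φ b : M → M → M → ℝ),
    (∀ i j, ContinuousOn (φ i j) (c.U i ∩ c.U j)) ∧
    (∀ i j, ∀ p ∈ c.U i ∩ c.U j,
      Complex.exp (2 * Real.pi * Complex.I * (φ i j p : ℂ)) = c.transition i j p) ∧
    (∀ i j, ∀ p ∈ c.U i ∩ c.U j, b i j p ∈ A ∧ ∀ᶠ q in 𝓝 p, b i j q = b i j p) ∧
    (∀ i j k, ∀ p ∈ c.U i ∩ c.U j ∩ c.U k,
      φ j k p - φ i k p + φ i j p = b j k p - b i k p + b i j p)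

/-- `c₁(ker α) = 0` in `H²(M; ℤ)`, where `dim M = 2n - 1`. -/
def IntegralChernClassVanishes [IsManifold 𝓘(ℝ, E) ∞ M] (n : ℕ) (α : OneForm E M) : Prop :=
  FirstChernClassVanishes (Int.castAddHom ℝ).range (n - 1) α

/-- `c₁(ker α) = 0` in `H²(M; ℚ)`, where `dim M = 2n - 1`. -/
def RationalChernClassVanishes [IsManifold 𝓘(ℝ, E) ∞ M] (n : ℕ) (α : OneForm E M) : Prop :=
  FirstChernClassVanishes (Rat.castHom ℝ).toAddMonoidHom.range (n - 1) α

/-! ### Indices of contractible Reeb orbits and dynamical convexity -/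

/-- The loop `γ` of period `T` bounds the (continuous) disc `u`, defined on the closed unit disc
of `ℂ`. -/
def IsCappingDisc (γ : ℝ → M) (T : ℝ) (u : ℂ → M) : Prop :=
  ContinuousOn u (Metric.closedBall 0 1) ∧
    ∀ t : ℝ, u (Complex.exp (2 * Real.pi * Complex.I * (t : ℂ))) = γ (T * t)

/-- The loop `γ` of period `T` is contractible. -/
def IsContractibleLoop (γ : ℝ → M) (T : ℝ) : Prop := ∃ u, IsCappingDisc γ T u

/-- `φ` is the Reeb flow on a neighbourhood of `γ 0`, up to time `T`. -/
def IsReebFlowNear (α : OneForm E M) (γ : ℝ → M) (T : ℝ) (φ : ℝ → M → M) : Prop :=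
  ∃ ε > 0, ∃ V : Set M, IsOpen V ∧ γ 0 ∈ V ∧
    ContMDiffOn (𝓘(ℝ, ℝ).prod 𝓘(ℝ, E)) 𝓘(ℝ, E) ∞ (Function.uncurry φ)
      (Ioo (-ε) (T + ε) ×ˢ V) ∧
    ∀ p ∈ V, φ 0 p = p ∧ ∀ t ∈ Ioo (-ε) (T + ε), HasReebVelocity α (fun s ↦ φ s p) t

/-- A continuous symplectic trivialization of `u^*(ker α)` over the closed unit disc. -/
structure IsTrivialization [IsManifold 𝓘(ℝ, E) ∞ M] {m : ℕ} (α : OneForm E M) (u : ℂ → M)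
    (F : (z : ℂ) → Fin m ⊕ Fin m → TangentSpace 𝓘(ℝ, E) (u z)) : Prop where
  continuousOn : ∀ a, ContinuousOn (fun z ↦ (⟨u z, F z a⟩ : TangentBundle 𝓘(ℝ, E) M))
    (Metric.closedBall 0 1)
  symplectic : ∀ z ∈ Metric.closedBall (0 : ℂ) 1, IsSymplecticBasis α (u z) (F z)

/-- `Ψ` is the linearized Reeb flow `dφ_{Tt} : ker α_{γ(0)} → ker α_{γ(Tt)}`, `0 ≤ t ≤ 1`, along
the contractible closed orbit `γ` of period `T`, written as a path of symplectic matrices in a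
trivialization of `γ^*(ker α)` that extends over a capping disc of `γ`. -/
def IsLinearizedFlow [IsManifold 𝓘(ℝ, E) ∞ M] {m : ℕ} (α : OneForm E M) (γ : ℝ → M) (T : ℝ)
    (Ψ : SpPath m) : Prop :=
  ∃ (φ : ℝ → M → M) (u : ℂ → M)
    (F : (z : ℂ) → Fin m ⊕ Fin m → TangentSpace 𝓘(ℝ, E) (u z)),
    IsReebFlowNear α γ T φ ∧ IsCappingDisc γ T u ∧ IsTrivialization α u F ∧
    ∀ t : unitInterval, (Ψ t : Mat m) =
      coordMatrix α (γ (T * t)) (F (Complex.exp (2 * Real.pi * Complex.I * ((t : ℝ) : ℂ))))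
        (fun a ↦ mfderiv 𝓘(ℝ, E) 𝓘(ℝ, E) (φ (T * t)) (γ 0) (F 1 a))

/-- The index `μ_LCZ(γ)` of a contractible closed Reeb orbit `γ` of period `T` on a contact
manifold of dimension `2n - 1` with `c₁(ker α) = 0` in `H²(M; ℚ)`. Under this assumption it does
not depend on the capping disc and on the trivialization, so that the infimum is the common
value. -/
def orbitIndex [IsManifold 𝓘(ℝ, E) ∞ M] (n : ℕ) (α : OneForm E M) (γ : ℝ → M) (T : ℝ) : EReal :=
  ⨅ Ψ ∈ {Ψ : SpPath (n - 1) | IsLinearizedFlow α γ T Ψ}, lowerConleyZehnder Ψ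

/-- The contact form `α` on a manifold of dimension `2n - 1` is dynamically convex. -/
structure IsDynamicallyConvex [IsManifold 𝓘(ℝ, E) ∞ M] (n : ℕ) (α : OneForm E M) : Prop where
  chern : RationalChernClassVanishes n α
  index : ∀ (γ : ℝ → M) (T : ℝ), IsClosedReebOrbit α γ T → IsContractibleLoop γ T →
    ((n + 1 : ℕ) : EReal) ≤ orbitIndex n α γ T

end Forms

/-! ### Quotients -/

section Quotient
variable {E : Type*} [NormedAddCommGroup E] [NormedSpace ℝ E]
  {M : Type*} [TopologicalSpace M] [ChartedSpace E M]
  {G : Type*} [Group G] [MulAction G M]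

variable (E G M) in
/-- Every element of `G` acts on `M` by a smooth map. -/
class IsSmoothAction : Prop where
  contMDiff_smul : ∀ g : G, ContMDiff 𝓘(ℝ, E) 𝓘(ℝ, E) ∞ (fun p : M ↦ g • p)

/-- The quotient of a smooth manifold by a free, properly discontinuous smooth action is a smooth
manifold, for the charts of Mathlib (charts of `M` composed with local inverses of `M → M/G`). -/
instance instIsManifoldQuotient [IsManifold 𝓘(ℝ, E) ∞ M] [ProperlyDiscontinuousSMul G M]
    [ContinuousConstSMul G M] [IsCancelSMul G M] [T2Space M] [LocallyCompactSpace M]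
    [IsSmoothAction E M G] : IsManifold 𝓘(ℝ, E) ∞ (MulAction.orbitRel.Quotient G M) := by
  refine isManifold_of_contDiffOn _ _ _ ?_
  have hf : IsLocalHomeomorph (Quotient.mk (MulAction.orbitRel G M)) :=
    (isQuotientCoveringMap_quotientMk_of_properlyDiscontinuousSMul
      (G := G) (E := M)).isCoveringMap.isLocalHomeomorph
  suffices key : ∀ x x' : M,
      ContDiffOn ℝ ∞ (((hf.localInverseAt x).trans (chartAt E x)).symm.trans
          ((hf.localInverseAt x').trans (chartAt E x')))
        (((hf.localInverseAt x).trans (chartAt E x)).symm.trans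
          ((hf.localInverseAt x').trans (chartAt E x'))).source by
    rintro _ _ ⟨q, rfl⟩ ⟨q', rfl⟩
    simpa using key _ _
  intro x x' y hy
  simp only [OpenPartialHomeomorph.trans_source, OpenPartialHomeomorph.symm_source,
    OpenPartialHomeomorph.trans_symm_eq_symm_trans_symm,
    mem_inter_iff, mem_preimage, OpenPartialHomeomorph.coe_trans, Function.comp_apply,
    IsLocalHomeomorph.localInverseAt_symm] at hy
  obtain ⟨⟨hy1, hy2⟩, hy3, hy4⟩ := hy
  set z : M := (chartAt E x).symm y with hz
  set z' : M := hf.localInverseAt x' (Quotient.mk _ z) with hz'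
  have hzz' : Quotient.mk (MulAction.orbitRel G M) z' = Quotient.mk _ z :=
    hf.apply_localInverseAt_of_mem hy3
  obtain ⟨g, hg⟩ : ∃ g : G, g • z = z' := by
    have := Quotient.exact hzz'
    exact this
  have hz'mem : z' ∈ (hf.localInverseAt x').target := (hf.localInverseAt x').map_source hy3
  apply ContDiffAt.contDiffWithinAt
  have h1 : ContMDiffAt 𝓘(ℝ, E) 𝓘(ℝ, E) ∞
      (fun w ↦ chartAt E x' (g • (chartAt E x).symm w)) y := by
    have a1 : ContMDiffAt 𝓘(ℝ, E) 𝓘(ℝ, E) ∞ (chartAt E x).symm y :=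
      (contMDiffOn_chart_symm (n := ∞)).contMDiffAt ((chartAt E x).open_target.mem_nhds hy1)
    have a2 : ContMDiffAt 𝓘(ℝ, E) 𝓘(ℝ, E) ∞ (fun p : M ↦ g • p) ((chartAt E x).symm y) :=
      (IsSmoothAction.contMDiff_smul g).contMDiffAt
    have a3 : ContMDiffAt 𝓘(ℝ, E) 𝓘(ℝ, E) ∞ (chartAt E x') (g • (chartAt E x).symm y) := by
      apply (contMDiffOn_chart (n := ∞)).contMDiffAt ((chartAt E x').open_source.mem_nhds ?_)
      rw [← hz, hg]; exact hy4
    exact a3.comp y (a2.comp y a1)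
  refine (contMDiffAt_iff_contDiffAt.mp h1).congr_of_eventuallyEq ?_
  have hcont : ContinuousAt (fun w ↦ g • (chartAt E x).symm w) y :=
    ((continuous_const_smul g).continuousAt).comp
      ((chartAt E x).continuousAt_symm hy1)
  have hmem : (hf.localInverseAt x').target ∈ 𝓝 (g • (chartAt E x).symm y) := by
    rw [← hz, hg]; exact (hf.localInverseAt x').open_target.mem_nhds hz'mem
  filter_upwards [hcont hmem] with w hw
  simp only [OpenPartialHomeomorph.coe_trans, OpenPartialHomeomorph.trans_symm_eq_symm_trans_symm,
    Function.comp_apply, IsLocalHomeomorph.localInverseAt_symm]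
  congr 1
  have e1 : Quotient.mk (MulAction.orbitRel G M) ((chartAt E x).symm w)
      = (hf.localInverseAt x').symm (g • (chartAt E x).symm w) := by
    rw [hf.localInverseAt_symm]
    exact Quotient.sound ⟨g⁻¹, by simp⟩
  rw [e1]
  exact (hf.localInverseAt x').right_inv hw
end Quotient

/-! ### Lens spaces -/

/-- `ℂ²` with its Hermitian norm. -/
abbrev C2 : Type := EuclideanSpace ℂ (Fin 2)
/-- The unit sphere `S³` in `ℂ²`. -/
abbrev S3 : Type := Metric.sphere (0 : C2) 1

instance : Fact (Module.finrank ℝ C2 = 3 + 1) := ⟨by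
  rw [← Module.finrank_mul_finrank ℝ ℂ C2]; simp⟩

/-- The standard contact form on `S³`: the restriction of `½ Im ⟪z, dz⟫ = ½ ∑ (x_j dy_j - y_j dx_j)`.
-/
def stdForm (z : S3) : TangentSpace 𝓘(ℝ, EuclideanSpace ℝ (Fin 3)) z →L[ℝ] ℝ :=
  (1 / 2 : ℝ) • ((Complex.imCLM.comp ((innerSL ℂ (z : C2)).restrictScalars ℝ)).comp
   (mfderiv 𝓘(ℝ, EuclideanSpace ℝ (Fin 3)) 𝓘(ℝ, C2) ((↑) : S3 → C2) z))

/-- The group of `p`-th roots of unity, acting on `S³` with weights `(1, q)`. -/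
def LensGroup (p _q : ℕ) : Type := rootsOfUnity p ℂ

instance (p q : ℕ) : CommGroup (LensGroup p q) := inferInstanceAs (CommGroup (rootsOfUnity p ℂ))

instance (p q : ℕ) [NeZero p] : Finite (LensGroup p q) :=
  inferInstanceAs (Finite (rootsOfUnity p ℂ))

/-- The complex number underlying an element of `LensGroup p q`. -/
def LensGroup.val {p q : ℕ} (ζ : LensGroup p q) : ℂ := ((ζ.1 : ℂˣ) : ℂ)

theorem LensGroup.val_one {p q : ℕ} : (1 : LensGroup p q).val = 1 := rfl

theorem LensGroup.val_mul {p q : ℕ} (ζ η : LensGroup p q) : (ζ * η).val = ζ.val * η.val := rfl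

theorem LensGroup.val_pow {p q : ℕ} (ζ : LensGroup p q) : ζ.val ^ p = 1 := by
  have h := (mem_rootsOfUnity p ζ.1).mp ζ.2
  simpa [LensGroup.val] using congrArg (fun u : ℂˣ ↦ (u : ℂ)) h

theorem LensGroup.norm_val {p q : ℕ} [NeZero p] (ζ : LensGroup p q) : ‖ζ.val‖ = 1 :=
  Complex.norm_eq_one_of_pow_eq_one ζ.val_pow (NeZero.ne p)

theorem LensGroup.val_injective {p q : ℕ} : Function.Injective (LensGroup.val (p := p) (q := q)) :=
  fun _ _ h ↦ Subtype.ext (Units.ext h)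

/-- The map `(z₀, z₁) ↦ (ζ z₀, ζ^q z₁)` of `ℂ²`. -/
def LensGroup.rotate {p q : ℕ} (ζ : LensGroup p q) (z : C2) : C2 :=
  !₂[ζ.val * z 0, ζ.val ^ q * z 1]

theorem LensGroup.norm_rotate {p q : ℕ} [NeZero p] (ζ : LensGroup p q) (z : C2) :
    ‖ζ.rotate z‖ = ‖z‖ := by
  simp [LensGroup.rotate, EuclideanSpace.norm_eq, Fin.sum_univ_two, ζ.norm_val]

instance (p q : ℕ) [NeZero p] : MulAction (LensGroup p q) S3 where
  smul ζ z := ⟨ζ.rotate z, by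
    rw [mem_sphere_zero_iff_norm, ζ.norm_rotate]; exact mem_sphere_zero_iff_norm.mp z.2⟩
  one_smul z := by
    apply Subtype.ext
    ext i
    fin_cases i
    · exact by simp [HSMul.hSMul, LensGroup.rotate, LensGroup.val_one]
    · exact by simp [HSMul.hSMul, LensGroup.rotate, LensGroup.val_one]
  mul_smul ζ η z := by
    apply Subtype.ext
    ext i
    fin_cases i
    · exact by simp [HSMul.hSMul, LensGroup.rotate, LensGroup.val_mul, mul_assoc]
    · exact by simp [HSMul.hSMul, LensGroup.rotate, LensGroup.val_mul, mul_pow, mul_assoc]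

/-- The action of `ζ` on `S³` is `(z₀, z₁) ↦ (ζ z₀, ζ^q z₁)`. -/
theorem LensGroup.coe_smul {p q : ℕ} [NeZero p] (ζ : LensGroup p q) (z : S3) :
    ((ζ • z : S3) : C2) = !₂[ζ.val * (z : C2) 0, ζ.val ^ q * (z : C2) 1] := rfl

theorem LensGroup.contDiff_rotate {p q : ℕ} (ζ : LensGroup p q) :
    ContDiff ℝ ∞ (ζ.rotate : C2 → C2) := by
  refine (contDiff_piLp 2).mpr ?_
  have h (j : Fin 2) : ContDiff ℝ ∞ (fun z : C2 ↦ z j) := by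
    fun_prop
  intro i
  fin_cases i
  · simpa [LensGroup.rotate] using contDiff_const.mul (h 0)
  · simpa [LensGroup.rotate] using contDiff_const.mul (h 1)

instance (p q : ℕ) [NeZero p] : IsSmoothAction (EuclideanSpace ℝ (Fin 3)) S3 (LensGroup p q) where
  contMDiff_smul ζ := by
    have h : ContMDiff 𝓘(ℝ, EuclideanSpace ℝ (Fin 3)) 𝓘(ℝ, C2) ∞
        (fun z : S3 ↦ ζ.rotate (z : C2)) :=
      ζ.contDiff_rotate.contMDiff.comp contMDiff_coe_sphere
    exact h.codRestrict_sphere _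

instance (p q : ℕ) [NeZero p] : ContinuousConstSMul (LensGroup p q) S3 where
  continuous_const_smul ζ :=
    (IsSmoothAction.contMDiff_smul (E := EuclideanSpace ℝ (Fin 3)) (M := S3) ζ).continuous

instance (p q : ℕ) [NeZero p] [h : Fact (Nat.Coprime p q)] : IsCancelSMul (LensGroup p q) S3 := by
  rw [isCancelSMul_iff_eq_one_of_smul_eq]
  intro ζ z hz
  apply LensGroup.val_injective
  rw [LensGroup.val_one]
  have h2 : !₂[ζ.val * (z : C2) 0, ζ.val ^ q * (z : C2) 1] = (z : C2) := by
    rw [← LensGroup.coe_smul, hz]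
  have e0 : ζ.val * (z : C2) 0 = (z : C2) 0 := by
    simpa using congrArg (fun w : C2 ↦ w 0) h2
  have e1 : ζ.val ^ q * (z : C2) 1 = (z : C2) 1 := by
    simpa using congrArg (fun w : C2 ↦ w 1) h2
  by_cases h0 : (z : C2) 0 = 0
  · have h1 : (z : C2) 1 ≠ 0 := by
      intro h1
      have : (z : C2) = 0 := by
        ext i; fin_cases i
        · exact h0
        · exact h1
      have hn := mem_sphere_zero_iff_norm.mp z.2
      rw [this] at hn; simp at hn
    have hq : ζ.val ^ q = 1 := mul_right_cancel₀ h1 (by rw [e1, one_mul])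
    have := pow_gcd_eq_one.mpr ⟨ζ.val_pow, hq⟩
    rwa [Nat.Coprime.gcd_eq_one h.out, pow_one] at this
  · exact mul_right_cancel₀ h0 (by rw [e0, one_mul])

/-- The lens space `L(p, q) = S³ / μ_p`, for coprime `p ≥ 1` and `q`. -/
abbrev LensSpace (p q : ℕ) [NeZero p] : Type := MulAction.orbitRel.Quotient (LensGroup p q) S3

end ContactGeometry

end

open ContactGeometry

/-! Both statements rest on lifting index data through the covering `π : M → M/G`. This map is a
covering and a local diffeomorphism, so an invariant form descends in exactly one way, and
smoothness, the contact condition and the Reeb equation can be checked upstairs.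

A capping disc of a Reeb orbit of the quotient lifts to `M`; the boundary of the lifted disc is a
closed Reeb orbit of the same period. The Reeb flow near the initial point lifts as well, and the
trivialization is pulled back by `dπ`. Since `dπ` preserves `α` and `dα`, the path of symplectic
matrices does not change at all. Hence every path in the infimum `orbitIndex` downstairs also occurs
in one upstairs, and the lower bound `n + 1` passes to the quotient (`IsLinearizedFlow.exists_lift`,
`IsDynamicallyConvex.of_covering`).

For lens spaces this leaves the bound on `S³` and the Chern class. The Reeb flow on `S³` is `z ↦
e^{2it} z`, so the periods are `kπ` with `k ≥ 1`. The contact planes have the global complex frame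
`hopfFrame`, which is conjugate linear in `z`; in it the linearized flow is multiplication by
`e^{4it}` and turns by `4πk` in all. A trivialization over a disc gives the same growth of the
argument, by homotopy (`three_le_of_rotation`). A nearby path loses less than `π` of this, and an
extension through nondegenerate matrices cannot cross the next lower multiple of `2π`
(`lt_argument_of_nondegenerate`). So the index exceeds `4k - 2 ≥ 2` and is at least `3`
(`three_le_of_isConleyZehnderIndex`).

On the lens space the local sections of `S³ → L(p, q)` carry the Hopf frame to unitary frames whose
transition functions are locally constant `p`-th roots of unity. Their logarithms are locally
constant and rational, so `c₁` vanishes rationally (`rationalChernClassVanishes_lens`). -/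

noncomputable section

namespace ContactGeometry

/-! ### Pullback of 1-forms and naturality of the exterior derivative -/

section Pull

variable {E : Type*} [NormedAddCommGroup E] [NormedSpace ℝ E]
  {M : Type*} [TopologicalSpace M] [ChartedSpace E M]
  {E' : Type*} [NormedAddCommGroup E'] [NormedSpace ℝ E']
  {M' : Type*} [TopologicalSpace M'] [ChartedSpace E' M']
  {E'' : Type*} [NormedAddCommGroup E''] [NormedSpace ℝ E'']
  {M'' : Type*} [TopologicalSpace M''] [ChartedSpace E'' M'']

variable (E) in
/-- The pullback of a `1`-form by a map between manifolds with different model spaces. -/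
def OneForm.pull (f : M → M') (α : OneForm E' M') : OneForm E M :=
  fun p ↦ (α (f p)).comp (mfderiv 𝓘(ℝ, E) 𝓘(ℝ, E') f p)

theorem OneForm.pull_congr {f g : M → M'} {p : M} (h : f =ᶠ[𝓝 p] g) (α : OneForm E' M') :
    α.pull E f p = α.pull E g p := by
  have h1 : f p = g p := h.self_of_nhds
  have h2 := h.mfderiv_eq (I := 𝓘(ℝ, E)) (I' := 𝓘(ℝ, E'))
  simp only [OneForm.pull]
  rw [h2]
  -- All cotangent spaces are `E' →L[ℝ] ℝ` by definition; over this common type the base point can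
  -- be rewritten.
  have : ∀ (A : M' → (E' →L[ℝ] ℝ)) (L : E →L[ℝ] E'), (A (f p)).comp L = (A (g p)).comp L := by
    rw [h1]; exact fun _ _ ↦ rfl
  exact this α _

theorem OneForm.pull_comp {g : M' → M''} {f : M → M'} {p : M}
    (hg : MDifferentiableAt 𝓘(ℝ, E') 𝓘(ℝ, E'') g (f p))
    (hf : MDifferentiableAt 𝓘(ℝ, E) 𝓘(ℝ, E') f p) (α : OneForm E'' M'') :
    α.pull E (g ∘ f) p = (α.pull E' g (f p)).comp (mfderiv 𝓘(ℝ, E) 𝓘(ℝ, E') f p) := by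
  simp only [OneForm.pull]
  rw [mfderiv_comp p hg hf]
  rfl

/-- In the trivialization of the tangent bundle centred at `p`, the form reads as `inChart p`
composed with the chart. Smoothness is asked at the centre of each preferred chart, which is where
`OneForm.d` is evaluated. -/
theorem OneForm.isSmooth_iff [IsManifold 𝓘(ℝ, E) ∞ M] (α : OneForm E M) :
    α.IsSmooth ↔ ∀ p, ContDiffAt ℝ ∞ (α.inChart p) (extChartAt 𝓘(ℝ, E) p p) := by
  refine forall_congr' fun p ↦ ?_
  rw [contMDiffAt_hom_bundle]
  have e : (fun x ↦ ContinuousLinearMap.inCoordinates E (TangentSpace 𝓘(ℝ, E)) ℝ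
      (Bundle.Trivial M ℝ) p x p x (α x)) =ᶠ[𝓝 p] α.inChart p ∘ extChartAt 𝓘(ℝ, E) p := by
    filter_upwards [(chartAt E p).open_source.mem_nhds (mem_chart_source E p)] with x hx
    have hx' : x ∈ (extChartAt 𝓘(ℝ, E) p).source := by simpa using hx
    have hy := (extChartAt 𝓘(ℝ, E) p).left_inv hx'
    simp only [ContinuousLinearMap.inCoordinates, Function.comp_apply, OneForm.inChart]
    have : IsManifold 𝓘(ℝ, E) 1 M := .of_le (n := ∞) (by norm_cast)
    rw [TangentBundle.symmL_trivializationAt hx]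
    simp only [modelWithCornersSelf_coe, range_id, mfderivWithin_univ]
    let L : E →L[ℝ] E :=
      mfderiv 𝓘(ℝ, E) 𝓘(ℝ, E) (extChartAt 𝓘(ℝ, E) p).symm (extChartAt 𝓘(ℝ, E) p x)
    have : ∀ (A : M → (E →L[ℝ] ℝ)) (x' : M), x' = x →
      ((Bundle.Trivial.trivialization M ℝ).continuousLinearMapAt ℝ x).comp ((A x).comp L) =
        (A x').comp L := by
      rintro A _ rfl
      ext v
      simp
    exact this α _ hy
  rw [e.contMDiffAt_iff]
  have hchart : ContMDiffAt 𝓘(ℝ, E) 𝓘(ℝ, E) ∞ (extChartAt 𝓘(ℝ, E) p) p := contMDiffAt_extChartAt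
  have hsymm : ContMDiffAt 𝓘(ℝ, E) 𝓘(ℝ, E) ∞ (extChartAt 𝓘(ℝ, E) p).symm
      (extChartAt 𝓘(ℝ, E) p p) :=
    (contMDiffOn_extChartAt_symm p).contMDiffAt (extChartAt_target_mem_nhds p)
  constructor
  · rintro ⟨-, h⟩
    rw [← contMDiffAt_iff_contDiffAt]
    have h' : ContMDiffAt 𝓘(ℝ, E) 𝓘(ℝ, E →L[ℝ] ℝ) ∞ (α.inChart p ∘ extChartAt 𝓘(ℝ, E) p)
      ((extChartAt 𝓘(ℝ, E) p).symm (extChartAt 𝓘(ℝ, E) p p)) := by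
      rwa [extChartAt_to_inv]
    refine (h'.comp _ hsymm).congr_of_eventuallyEq ?_
    filter_upwards [extChartAt_target_mem_nhds (I := 𝓘(ℝ, E)) p] with y hy
    simp only [Function.comp_apply]
    rw [(extChartAt 𝓘(ℝ, E) p).right_inv hy]
  · intro h
    exact ⟨contMDiffAt_id, h.contMDiffAt.comp p hchart⟩

variable [IsManifold 𝓘(ℝ, E) ∞ M] [IsManifold 𝓘(ℝ, E') ∞ M']

/-- Reduces pullbacks to calculus in the model spaces. The relation between `β` and `α` is only
required near `p`, so that `f` may be a chart or a local inverse of a covering. -/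
theorem OneForm.inChart_pull {α : OneForm E' M'} {β : OneForm E M} {f : M → M'} {p : M}
    (hf : ContMDiffAt 𝓘(ℝ, E) 𝓘(ℝ, E') ∞ f p) (h : ∀ᶠ q in 𝓝 p, β q = α.pull E f q) :
    β.inChart p =ᶠ[𝓝 (extChartAt 𝓘(ℝ, E) p p)] fun y ↦
      (α.inChart (f p) (writtenInExtChartAt 𝓘(ℝ, E) 𝓘(ℝ, E') p f y)).comp
        (fderiv ℝ (writtenInExtChartAt 𝓘(ℝ, E) 𝓘(ℝ, E') p f) y) := by
  set ψ := extChartAt 𝓘(ℝ, E) p with hψ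
  set χ := extChartAt 𝓘(ℝ, E') (f p) with hχ
  have : IsManifold 𝓘(ℝ, E) 1 M := .of_le (n := ∞) (by norm_cast)
  have : IsManifold 𝓘(ℝ, E') 1 M' := .of_le (n := ∞) (by norm_cast)
  have hc : ContinuousAt ψ.symm (ψ p) := continuousAt_extChartAt_symm p
  have hp : ψ.symm (ψ p) = p := extChartAt_to_inv p
  have h1 : ∀ᶠ q in 𝓝 p, MDifferentiableAt 𝓘(ℝ, E) 𝓘(ℝ, E') f q := by
    have h1 : ContMDiffAt 𝓘(ℝ, E) 𝓘(ℝ, E') 1 f p := hf.of_le (by norm_cast)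
    filter_upwards [(contMDiffAt_iff_contMDiffAt_nhds (by simp)).mp h1] with q hq using hq.mdifferentiableAt (by simp)
  have h2 : ∀ᶠ q in 𝓝 p, f q ∈ χ.source :=
    hf.continuousAt.eventually (extChartAt_source_mem_nhds (I := 𝓘(ℝ, E')) (f p))
  have h3 := (h.and (h1.and h2)).eventually_nhds
  rw [← hp] at h3
  filter_upwards [hc.eventually h3, (isOpen_extChartAt_target (I := 𝓘(ℝ, E)) p).mem_nhds
    (mem_extChartAt_target p)] with y hy hyt
  have hsd : MDifferentiableAt 𝓘(ℝ, E) 𝓘(ℝ, E) ψ.symm y :=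
    (contMDiffOn_extChartAt_symm (n := 1) p).contMDiffAt
      ((isOpen_extChartAt_target p).mem_nhds hyt) |>.mdifferentiableAt (by simp)
  obtain ⟨ha, hb, hd⟩ := hy.self_of_nhds
  have hχd : MDifferentiableAt 𝓘(ℝ, E') 𝓘(ℝ, E') χ (f (ψ.symm y)) :=
    mdifferentiableAt_extChartAt (by simpa [hχ] using hd)
  have hχs : MDifferentiableAt 𝓘(ℝ, E') 𝓘(ℝ, E') χ.symm (χ (f (ψ.symm y))) :=
    (contMDiffOn_extChartAt_symm (n := 1) (f p)).contMDiffAt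
      ((isOpen_extChartAt_target _).mem_nhds (χ.map_source hd)) |>.mdifferentiableAt (by simp)
  have hFd : MDifferentiableAt 𝓘(ℝ, E) 𝓘(ℝ, E') (χ ∘ f ∘ ψ.symm) y :=
    MDifferentiableAt.comp y (g := χ) hχd (MDifferentiableAt.comp y (g := f) hb hsd)
  have e1 : β.inChart p y = α.pull E (f ∘ ψ.symm) y := by
    rw [OneForm.pull_comp hb hsd]
    change (β (ψ.symm y)).comp _ = _
    rw [ha]
    rfl
  have e2 : χ.symm ∘ (χ ∘ f ∘ ψ.symm) =ᶠ[𝓝 y] f ∘ ψ.symm := by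
    filter_upwards [hsd.continuousAt.eventually hy] with z hz
    exact χ.left_inv hz.2.2
  rw [e1, ← OneForm.pull_congr e2]
  refine (OneForm.pull_comp (f := χ ∘ f ∘ ψ.symm) hχs hFd α).trans ?_
  rw [mfderiv_eq_fderiv]
  rfl

omit [IsManifold 𝓘(ℝ, E) ∞ M] [IsManifold 𝓘(ℝ, E') ∞ M'] in
theorem writtenInExtChartAt_contDiffAt {f : M → M'} {p : M}
    (hf : ContMDiffAt 𝓘(ℝ, E) 𝓘(ℝ, E') ∞ f p) :
    ContDiffAt ℝ ∞ (writtenInExtChartAt 𝓘(ℝ, E) 𝓘(ℝ, E') p f) (extChartAt 𝓘(ℝ, E) p p) := by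
  have := (contMDiffAt_iff.mp hf).2
  simpa [contDiffWithinAt_univ] using this

theorem OneForm.inChart_contDiffAt_of_pull {α : OneForm E' M'} {β : OneForm E M} {f : M → M'}
    {p : M} (hf : ContMDiffAt 𝓘(ℝ, E) 𝓘(ℝ, E') ∞ f p) (h : ∀ᶠ q in 𝓝 p, β q = α.pull E f q)
    (hα : ContDiffAt ℝ ∞ (α.inChart (f p)) (extChartAt 𝓘(ℝ, E') (f p) (f p))) :
    ContDiffAt ℝ ∞ (β.inChart p) (extChartAt 𝓘(ℝ, E) p p) := by
  refine ContDiffAt.congr_of_eventuallyEq ?_ (OneForm.inChart_pull hf h)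
  have hF := writtenInExtChartAt_contDiffAt hf
  refine ContDiffAt.clm_comp ?_ (hF.fderiv_right (m := ∞) (by simp))
  refine ContDiffAt.comp (g := α.inChart (f p)) _ ?_ hF
  simpa [writtenInExtChartAt] using hα

/-- Differentiating `α (F y) ∘ DF y` gives the expected term and `α (D²F (v, w))`; the latter is
symmetric in `v` and `w` and cancels in the antisymmetrization. -/
theorem OneForm.d_of_pull {α : OneForm E' M'} {β : OneForm E M} {f : M → M'}
    {p : M} (hf : ContMDiffAt 𝓘(ℝ, E) 𝓘(ℝ, E') ∞ f p) (h : ∀ᶠ q in 𝓝 p, β q = α.pull E f q)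
    (hα : ContDiffAt ℝ ∞ (α.inChart (f p)) (extChartAt 𝓘(ℝ, E') (f p) (f p)))
    (v w : TangentSpace 𝓘(ℝ, E) p) :
    β.d p v w = α.d (f p) (mfderiv 𝓘(ℝ, E) 𝓘(ℝ, E') f p v)
      (mfderiv 𝓘(ℝ, E) 𝓘(ℝ, E') f p w) := by
  set ψ := extChartAt 𝓘(ℝ, E) p with hψ
  set χ := extChartAt 𝓘(ℝ, E') (f p) with hχ
  set F := writtenInExtChartAt 𝓘(ℝ, E) 𝓘(ℝ, E') p f with hFdef
  have hF : ContDiffAt ℝ ∞ F (ψ p) := writtenInExtChartAt_contDiffAt hf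
  have hFp : F (ψ p) = χ (f p) := by simp [hFdef, writtenInExtChartAt, hψ, hχ]
  have hmf : MDifferentiableAt 𝓘(ℝ, E) 𝓘(ℝ, E') f p := hf.mdifferentiableAt (by simp)
  have : IsManifold 𝓘(ℝ, E) 1 M := .of_le (n := ∞) (by norm_cast)
  have : IsManifold 𝓘(ℝ, E') 1 M' := .of_le (n := ∞) (by norm_cast)
  have hFd := hF.differentiableAt (by simp)
  have key : ∀ u : TangentSpace 𝓘(ℝ, E) p,
      mfderiv 𝓘(ℝ, E') 𝓘(ℝ, E') χ (f p) (mfderiv 𝓘(ℝ, E) 𝓘(ℝ, E') f p u)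
        = fderiv ℝ F (ψ p) (mfderiv 𝓘(ℝ, E) 𝓘(ℝ, E) ψ p u) := by
    intro u
    have e : F ∘ ψ =ᶠ[𝓝 p] χ ∘ f := by
      filter_upwards [extChartAt_source_mem_nhds (I := 𝓘(ℝ, E)) p] with q hq
      simp only [hFdef, writtenInExtChartAt, Function.comp_apply]
      rw [(extChartAt 𝓘(ℝ, E) p).left_inv hq]
    have e1 := e.mfderiv_eq (I := 𝓘(ℝ, E)) (I' := 𝓘(ℝ, E'))
    have hχd : MDifferentiableAt 𝓘(ℝ, E') 𝓘(ℝ, E') χ (f p) :=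
      mdifferentiableAt_extChartAt (by simp)
    have hψd : MDifferentiableAt 𝓘(ℝ, E) 𝓘(ℝ, E) ψ p :=
      mdifferentiableAt_extChartAt (by simp)
    rw [mfderiv_comp p hχd hmf, mfderiv_comp p hFd.mdifferentiableAt hψd] at e1
    have := DFunLike.congr_fun e1 u
    rw [mfderiv_eq_fderiv] at this
    exact this.symm
  simp only [OneForm.d]
  rw [key, key, (OneForm.inChart_pull hf h).fderiv_eq]
  set v' : E := mfderiv 𝓘(ℝ, E) 𝓘(ℝ, E) ψ p v
  set w' : E := mfderiv 𝓘(ℝ, E) 𝓘(ℝ, E) ψ p w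
  have hA : DifferentiableAt ℝ (α.inChart (f p)) (F (ψ p)) := by
    rw [hFp]; exact hα.differentiableAt (by simp)
  have hDF : DifferentiableAt ℝ (fderiv ℝ F) (ψ p) :=
    (hF.fderiv_right (m := 1) (by norm_cast)).differentiableAt (by simp)
  have hsym : IsSymmSndFDerivAt ℝ F (ψ p) :=
    hF.isSymmSndFDerivAt (by simp [minSmoothness_of_isRCLikeNormedField]; exact WithTop.coe_le_coe.mpr le_top)
  have hd : fderiv ℝ (fun y ↦ (α.inChart (f p) (F y)).comp (fderiv ℝ F y)) (ψ p) = _ :=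
    ((hA.hasFDerivAt.comp (ψ p) hFd.hasFDerivAt).clm_comp hDF.hasFDerivAt).fderiv
  have hd' : ∀ a b : E, fderiv ℝ (fun y ↦ (α.inChart (f p) (F y)).comp (fderiv ℝ F y)) (ψ p) a b
      = (α.inChart (f p) (F (ψ p))) (fderiv ℝ (fderiv ℝ F) (ψ p) a b)
        + fderiv ℝ (α.inChart (f p)) (F (ψ p)) (fderiv ℝ F (ψ p) a) (fderiv ℝ F (ψ p) b) := by
    intro a b
    rw [hd]
    simp
  have e1 := hd' v' w'
  have e2 := hd' w' v'
  rw [hsym.eq] at e2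
  rw [hFp] at e1 e2
  have := congrArg₂ (· - ·) e1 e2
  simp only [add_sub_add_left_eq_sub] at this
  exact this

end Pull

/-! ### Descent of contact forms along a surjective local diffeomorphism -/

section Descent

variable {E : Type*} [NormedAddCommGroup E] [NormedSpace ℝ E]
  {M : Type*} [TopologicalSpace M] [ChartedSpace E M]
  {N : Type*} [TopologicalSpace N] [ChartedSpace E N]
  {π : N → M}

/-- The differential of a local diffeomorphism. -/
abbrev diffEquiv (hπ : IsLocalDiffeomorph 𝓘(ℝ, E) 𝓘(ℝ, E) ∞ π) (x : N) :
    TangentSpace 𝓘(ℝ, E) x ≃L[ℝ] TangentSpace 𝓘(ℝ, E) (π x) :=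
  hπ.mfderivToContinuousLinearEquiv (by simp) x

theorem mfderiv_diffEquiv_symm (hπ : IsLocalDiffeomorph 𝓘(ℝ, E) 𝓘(ℝ, E) ∞ π) (x : N)
    (v : TangentSpace 𝓘(ℝ, E) (π x)) :
    mfderiv 𝓘(ℝ, E) 𝓘(ℝ, E) π x ((diffEquiv hπ x).symm v) = v :=
  (diffEquiv hπ x).apply_symm_apply v

theorem OneForm.eq_of_pullback_eq (hπ : IsLocalDiffeomorph 𝓘(ℝ, E) 𝓘(ℝ, E) ∞ π)
    (hs : Function.Surjective π) {α β : OneForm E M} (h : α.pullback π = β.pullback π) :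
    α = β := by
  funext q
  obtain ⟨x, rfl⟩ := hs q
  have h1 := congrFun h x
  ext v
  have h2 := DFunLike.congr_fun h1 ((diffEquiv hπ x).symm v)
  have h3 : (α (π x)) (mfderiv 𝓘(ℝ, E) 𝓘(ℝ, E) π x ((diffEquiv hπ x).symm v)) =
    (β (π x)) (mfderiv 𝓘(ℝ, E) 𝓘(ℝ, E) π x ((diffEquiv hπ x).symm v)) := h2
  rwa [mfderiv_diffEquiv_symm] at h3

/-- Choose one preimage of each point and transport `α` from there by the inverse of `dπ`. At
another point of the fibre, the map `g` to the chosen preimage preserves both `π` and `α`, so the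
choice does not matter. -/
theorem OneForm.exists_pullback_eq (hπ : IsLocalDiffeomorph 𝓘(ℝ, E) 𝓘(ℝ, E) ∞ π)
    (hs : Function.Surjective π) {α : OneForm E N}
    (h : ∀ x y, π x = π y → ∃ g : N → N, g y = x ∧ MDifferentiableAt 𝓘(ℝ, E) 𝓘(ℝ, E) g y ∧
      π ∘ g = π ∧ α.pullback g = α) :
    ∃ α' : OneForm E M, α'.pullback π = α := by
  choose s hs using hs
  let A : N → (E →L[ℝ] ℝ) := fun x ↦
    ContinuousLinearMap.comp (α x) ((diffEquiv hπ x).symm : TangentSpace 𝓘(ℝ, E) (π x) →L[ℝ] _)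
  refine ⟨fun q ↦ A (s q), ?_⟩
  funext y
  obtain ⟨g, hg, hgd, hπg, hα⟩ := h (s (π y)) y (hs _)
  have h1 : (A (s (π y))) = A (g y) := by rw [hg]
  have h2 : mfderiv 𝓘(ℝ, E) 𝓘(ℝ, E) (π ∘ g) y = _ :=
    mfderiv_comp y (hπ.mdifferentiable (by simp) (g y)) hgd
  rw [hπg] at h2
  ext v
  change (A (s (π y))) (mfderiv 𝓘(ℝ, E) 𝓘(ℝ, E) π y v) = α y v
  rw [h1, h2]
  change α (g y) ((diffEquiv hπ (g y)).symm (diffEquiv hπ (g y)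
    (mfderiv 𝓘(ℝ, E) 𝓘(ℝ, E) g y v))) = _
  rw [ContinuousLinearEquiv.symm_apply_apply]
  exact DFunLike.congr_fun (congrFun hα y) v

variable [IsManifold 𝓘(ℝ, E) ∞ M] [IsManifold 𝓘(ℝ, E) ∞ N]

/-- Near `π x` the form `α'` is the pullback of `π^*α'` by a local inverse of `π`. -/
theorem OneForm.isSmooth_of_pullback (hπ : IsLocalDiffeomorph 𝓘(ℝ, E) 𝓘(ℝ, E) ∞ π)
    (hs : Function.Surjective π) {α' : OneForm E M} (h : (α'.pullback π).IsSmooth) :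
    α'.IsSmooth := by
  rw [OneForm.isSmooth_iff] at h ⊢
  intro q
  obtain ⟨x, rfl⟩ := hs q
  set σ := (hπ x).localInverse with hσ
  have hσx : σ (π x) = x := (hπ x).localInverse_left_inv (hπ x).localInverse_mem_target
  refine OneForm.inChart_contDiffAt_of_pull (α := α'.pullback π) (f := σ)
    (hπ x).localInverse_contMDiffAt ?_ (by rw [hσx]; exact h x)
  filter_upwards [(hπ x).localInverse_open_source.mem_nhds (hπ x).localInverse_mem_source]
    with q hq
  have e : π ∘ σ =ᶠ[𝓝 q] id := by
    filter_upwards [(hπ x).localInverse_open_source.mem_nhds hq] with q' hq'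
    exact (hπ x).localInverse_right_inv hq'
  have h1 := OneForm.pull_congr (E := E) e α'
  rw [OneForm.pull_comp (hπ.mdifferentiable (by simp) _)
    (((hπ x).localInverse_contMDiffOn.contMDiffAt
      ((hπ x).localInverse_open_source.mem_nhds hq)).mdifferentiableAt (by simp))] at h1
  refine Eq.trans ?_ h1.symm
  simp only [OneForm.pull, mfderiv_id]
  rfl

theorem OneForm.d_pullback (hπ : IsLocalDiffeomorph 𝓘(ℝ, E) 𝓘(ℝ, E) ∞ π) {α' : OneForm E M}
    (hα' : α'.IsSmooth) {α : OneForm E N} (h : α'.pullback π = α) (x : N)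
    (v w : TangentSpace 𝓘(ℝ, E) x) :
    α.d x v w = α'.d (π x) (mfderiv 𝓘(ℝ, E) 𝓘(ℝ, E) π x v)
      (mfderiv 𝓘(ℝ, E) 𝓘(ℝ, E) π x w) :=
  OneForm.d_of_pull (hπ.contMDiff x) (Eventually.of_forall fun q ↦ by rw [← h]; rfl)
    ((OneForm.isSmooth_iff _).mp hα' _) v w

omit [IsManifold 𝓘(ℝ, E) ∞ M] [IsManifold 𝓘(ℝ, E) ∞ N] in
theorem OneForm.pullback_apply {α' : OneForm E M} {α : OneForm E N} (h : α'.pullback π = α)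
    (x : N) (v : TangentSpace 𝓘(ℝ, E) x) :
    α x v = α' (π x) (mfderiv 𝓘(ℝ, E) 𝓘(ℝ, E) π x v) := by
  rw [← h]; rfl

theorem IsContactForm.of_pullback (hπ : IsLocalDiffeomorph 𝓘(ℝ, E) 𝓘(ℝ, E) ∞ π)
    (hs : Function.Surjective π) {α' : OneForm E M} {α : OneForm E N} (h : α'.pullback π = α)
    (hα : IsContactForm α) : IsContactForm α' := by
  have hsm : α'.IsSmooth := OneForm.isSmooth_of_pullback hπ hs (by rw [h]; exact hα.smooth)
  refine ⟨hsm, fun q hq ↦ ?_, fun q v hv hvw ↦ ?_⟩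
  · obtain ⟨x, rfl⟩ := hs q
    apply hα.ne_zero x
    ext v
    rw [OneForm.pullback_apply h, hq]
    rfl
  · obtain ⟨x, rfl⟩ := hs q
    have h1 := hα.nondegenerate x ((diffEquiv hπ x).symm v)
      (by rw [OneForm.pullback_apply h, mfderiv_diffEquiv_symm, hv]) (fun w hw ↦ by
        rw [OneForm.d_pullback hπ hsm h, mfderiv_diffEquiv_symm]
        exact hvw _ (by rw [← OneForm.pullback_apply h, hw]))
    simpa using h1

end Descent

/-! ### The quotient map as a local diffeomorphism -/

section Quotient

variable {E : Type*} [NormedAddCommGroup E] [NormedSpace ℝ E]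
  {M : Type*} [TopologicalSpace M] [ChartedSpace E M] [T2Space M] [LocallyCompactSpace M]
  {G : Type*} [Group G] [MulAction G M] [IsManifold 𝓘(ℝ, E) ∞ M] [ProperlyDiscontinuousSMul G M]
    [ContinuousConstSMul G M] [IsCancelSMul G M]

theorem isCoveringMap_quotientMk :
    IsCoveringMap (Quotient.mk (MulAction.orbitRel G M)) :=
  (isQuotientCoveringMap_quotientMk_of_properlyDiscontinuousSMul (G := G) (E := M)).isCoveringMap

/-- The diffeomorphism of `M` given by an element of `G`. -/
def smulDiffeomorph [IsSmoothAction E M G] (g : G) :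
    Diffeomorph 𝓘(ℝ, E) 𝓘(ℝ, E) M M ∞ where
  toEquiv := MulAction.toPerm g
  contMDiff_toFun := IsSmoothAction.contMDiff_smul g
  contMDiff_invFun := IsSmoothAction.contMDiff_smul g⁻¹

theorem isLocalDiffeomorph_quotientMk [IsSmoothAction E M G] :
    IsLocalDiffeomorph 𝓘(ℝ, E) 𝓘(ℝ, E) ∞ (Quotient.mk (MulAction.orbitRel G M)) := by
  intro y
  have hf := (isCoveringMap_quotientMk (G := G) (M := M)).isLocalHomeomorph
  set π := Quotient.mk (MulAction.orbitRel G M) with hπ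
  obtain ⟨x, hx, hc⟩ : ∃ x, π x = π y ∧
      chartAt E (π y) = (hf.localInverseAt x).trans (chartAt E x) :=
    ⟨_, (Quotient.mk_surjective (s := MulAction.orbitRel G M)).hasRightInverse.choose_spec (π y),
      rfl⟩
  -- The chart at `π y` is built from a chosen representative `x`, and near `x` the projection is
  -- the identity in these charts. The group element taking `y` to `x` then moves the conclusion to
  -- `y`.
  have hloc : IsLocalDiffeomorphAt 𝓘(ℝ, E) 𝓘(ℝ, E) ∞ π x := by
    let e := (chartAt E x).trans (chartAt E (π y)).symm
    refine ⟨⟨e.toPartialEquiv, e.open_source, e.open_target, ?_, ?_⟩, ?_, ?_⟩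
    · exact ((contMDiffOn_chart_symm (x := π y)).comp' (contMDiffOn_chart (x := x)))
    · refine ((contMDiffOn_chart_symm (x := x)).comp' (contMDiffOn_chart (x := π y))).mono ?_
      intro z hz
      simpa [e] using hz
    · simp [e, hc]
    · intro z hz
      have hz' : z ∈ (chartAt E x).source := hz.1
      have hz2 : chartAt E x z ∈ (chartAt E (π y)).target := hz.2
      change π z = (chartAt E (π y)).symm (chartAt E x z)
      rw [hc]
      simp [hz']
  obtain ⟨g, hg⟩ : ∃ g : G, g • y = x := Quotient.exact hx
  have h2 : IsLocalDiffeomorphAt 𝓘(ℝ, E) 𝓘(ℝ, E) ∞ (smulDiffeomorph (E := E) (M := M) g) y :=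
    (smulDiffeomorph (E := E) (M := M) g).isLocalDiffeomorph y
  have h3 : IsLocalDiffeomorphAt 𝓘(ℝ, E) 𝓘(ℝ, E) ∞ (π ∘ smulDiffeomorph (E := E) (M := M) g) y :=
    by
    refine h2.comp 𝓘(ℝ, E) _ ?_
    change IsLocalDiffeomorphAt 𝓘(ℝ, E) 𝓘(ℝ, E) ∞ π (g • y)
    rwa [hg]
  have h4 : π ∘ smulDiffeomorph (E := E) (M := M) g = π := by
    funext z
    exact Quotient.sound ⟨g, rfl⟩
  rwa [h4] at h3

theorem exists_isContactForm_quotient [IsSmoothAction E M G] {α : OneForm E M}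
    (hα : IsContactForm α) (h : ∀ g : G, α.pullback (fun p : M ↦ g • p) = α) :
    ∃ α' : OneForm E (MulAction.orbitRel.Quotient G M), IsContactForm α' ∧
      α'.pullback (Quotient.mk (MulAction.orbitRel G M)) = α := by
  obtain ⟨α', h'⟩ := OneForm.exists_pullback_eq (α := α)
    (isLocalDiffeomorph_quotientMk (E := E) (G := G) (M := M)) Quotient.mk_surjective
    (fun x y hxy ↦ by
      obtain ⟨g, hg⟩ : ∃ g : G, g • y = x := Quotient.exact hxy
      exact ⟨fun p ↦ g • p, hg,
        (IsSmoothAction.contMDiff_smul (E := E) g).mdifferentiable (by simp) y,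
        funext fun z ↦ Quotient.sound ⟨g, rfl⟩, h g⟩)
  exact ⟨α', hα.of_pullback isLocalDiffeomorph_quotientMk Quotient.mk_surjective h', h'⟩

end Quotient

/-! ### Uniqueness of Reeb trajectories -/

section ReebUniqueness

variable {E : Type*} [NormedAddCommGroup E] [NormedSpace ℝ E]

theorem OneForm.inChart_self (a : OneForm E E) (y : E) : a.inChart y = a := by
  funext z
  ext v
  simp only [OneForm.inChart]
  change a z (mfderiv 𝓘(ℝ, E) 𝓘(ℝ, E) id z v) = a z v
  rw [mfderiv_id]
  rfl

theorem OneForm.d_self (a : E → E →L[ℝ] ℝ) (y v w : E) :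
    OneForm.d (E := E) (M := E) a y v w = fderiv ℝ a y v w - fderiv ℝ a y w v := by
  have e : (OneForm.inChart (E := E) (M := E) a y) = a := OneForm.inChart_self a y
  simp only [OneForm.d]
  rw [e]
  change fderiv ℝ a y (mfderiv 𝓘(ℝ, E) 𝓘(ℝ, E) id y v) (mfderiv 𝓘(ℝ, E) 𝓘(ℝ, E) id y w)
    - fderiv ℝ a y (mfderiv 𝓘(ℝ, E) 𝓘(ℝ, E) id y w) (mfderiv 𝓘(ℝ, E) 𝓘(ℝ, E) id y v) = _
  rw [mfderiv_id]
  rfl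

/-- The bilinear form `da + a ⊗ a` at `y`, which determines the Reeb vector. -/
def reebMap (a : E → E →L[ℝ] ℝ) (y : E) : E →L[ℝ] E →L[ℝ] ℝ :=
  fderiv ℝ a y - (fderiv ℝ a y).flip + (a y).smulRight (a y)

theorem reebMap_apply (a : E → E →L[ℝ] ℝ) (y v w : E) :
    reebMap a y v w = OneForm.d (E := E) (M := E) a y v w + a y v * a y w := by
  simp [reebMap, OneForm.d_self]

theorem contDiffAt_reebMap {a : E → E →L[ℝ] ℝ} {y : E} (ha : ContDiffAt ℝ ∞ a y) :
    ContDiffAt ℝ 1 (reebMap a) y := by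
  have h1 : ContDiffAt ℝ 1 (fderiv ℝ a) y := ha.fderiv_right (by norm_cast)
  have h2 : ContDiffAt ℝ 1 a y := ha.of_le (by norm_cast)
  have hF : ContDiff ℝ 1 (fun L : E →L[ℝ] E →L[ℝ] ℝ ↦ L.flip) :=
    (IsLinearMap.with_bound (𝕜 := ℝ) (E := E →L[ℝ] E →L[ℝ] ℝ) (F := E →L[ℝ] E →L[ℝ] ℝ)
      ⟨fun _ _ ↦ rfl, fun _ _ ↦ rfl⟩ 1 (fun L ↦ by simp)).contDiff
  have h3 : ContDiffAt ℝ 1 (fun z ↦ (fderiv ℝ a z).flip) y :=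
    hF.contDiffAt.comp y h1
  exact (h1.sub h3).add (h2.smulRight h2)

/-- A Reeb vector `v` at `z` solves `reebMap a z v = a z`. Injectivity at `y` is invertibility, by
dimension; it persists nearby, and inversion of operators is `C¹`, so the solution is a `C¹`
function of `z`, hence locally Lipschitz. -/
theorem exists_lipschitz_solution [FiniteDimensional ℝ E] {a : E → E →L[ℝ] ℝ} {y : E}
    (ha : ContDiffAt ℝ ∞ a y) (hinj : Function.Injective (reebMap a y)) :
    ∃ (X : E → E) (K : NNReal), ∃ t ∈ 𝓝 y, LipschitzOnWith K X t ∧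
      ∀ z ∈ t, ∀ v, reebMap a z v = a z → v = X z := by
  have hdim : Module.finrank ℝ E = Module.finrank ℝ (E →L[ℝ] ℝ) := by
    rw [← (LinearMap.toContinuousLinearMap (𝕜 := ℝ) (E := E) (F' := ℝ)).finrank_eq]
    exact (Subspace.dual_finrank_eq (K := ℝ) (V := E)).symm
  let e : E ≃L[ℝ] (E →L[ℝ] ℝ) := (LinearMap.linearEquivOfInjective
    (reebMap a y : E →ₗ[ℝ] E →L[ℝ] ℝ) hinj hdim).toContinuousLinearEquiv
  have he : (e : E →L[ℝ] E →L[ℝ] ℝ) = reebMap a y := by ext; rfl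
  have hL := contDiffAt_reebMap ha
  have hinv : ContDiffAt ℝ 1 ContinuousLinearMap.inverse (reebMap a y) := by
    rw [← he]; exact contDiffAt_map_inverse e
  have hX : ContDiffAt ℝ 1 (fun z ↦ (reebMap a z).inverse (a z)) y :=
    (hinv.comp y hL).clm_apply (ha.of_le (by norm_cast))
  obtain ⟨K, t, ht, hlip⟩ := hX.exists_lipschitzOnWith
  have hn := e.nhds
  rw [he] at hn
  refine ⟨_, K, t ∩ {z | reebMap a z ∈ range ContinuousLinearEquiv.toContinuousLinearMap},
    inter_mem ht (hL.continuousAt hn), hlip.mono inter_subset_left, ?_⟩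
  rintro z ⟨-, e', he'⟩ v hv
  rw [← hv, ← he', ContinuousLinearMap.inverse_equiv]
  simp

variable {M : Type*} [TopologicalSpace M] [ChartedSpace E M] [IsManifold 𝓘(ℝ, E) ∞ M]

theorem OneForm.eventually_eq_pull_inChart (α : OneForm E M) (p : M) :
    ∀ᶠ q in 𝓝 p, α q = OneForm.pull E (E' := E) (M' := E) (extChartAt 𝓘(ℝ, E) p)
      (α.inChart p) q := by
  have : IsManifold 𝓘(ℝ, E) 1 M := .of_le (n := ∞) (by norm_cast)
  set ψ := extChartAt 𝓘(ℝ, E) p with hψ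
  filter_upwards [(isOpen_extChartAt_source (I := 𝓘(ℝ, E)) p).mem_nhds
    (mem_extChartAt_source p)] with q hq
  have e : ψ.symm ∘ ψ =ᶠ[𝓝 q] id := by
    filter_upwards [(isOpen_extChartAt_source (I := 𝓘(ℝ, E)) p).mem_nhds hq] with z hz
    exact ψ.left_inv hz
  have h1 := OneForm.pull_congr (E := E) e α
  rw [OneForm.pull_comp (((contMDiffOn_extChartAt_symm (n := 1) p).contMDiffAt
      ((isOpen_extChartAt_target p).mem_nhds (ψ.map_source hq))).mdifferentiableAt (by simp))
    (mdifferentiableAt_extChartAt (by simpa [hψ] using hq))] at h1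
  refine Eq.trans ?_ h1.symm
  simp only [OneForm.pull, mfderiv_id]
  rfl

/-- `OneForm.d` at `q` is defined through the chart at `q`; the Reeb equation along a curve needs
one chart for all `q` near `p`. -/
theorem OneForm.eventually_chart [FiniteDimensional ℝ E] {α : OneForm E M} (hα : α.IsSmooth)
    (p : M) :
    ∀ᶠ q in 𝓝 p, ∀ v w : TangentSpace 𝓘(ℝ, E) q,
      α q v = α.inChart p (extChartAt 𝓘(ℝ, E) p q)
        (mfderiv 𝓘(ℝ, E) 𝓘(ℝ, E) (extChartAt 𝓘(ℝ, E) p) q v) ∧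
      α.d q v w = OneForm.d (E := E) (M := E) (α.inChart p) (extChartAt 𝓘(ℝ, E) p q)
        (mfderiv 𝓘(ℝ, E) 𝓘(ℝ, E) (extChartAt 𝓘(ℝ, E) p) q v)
        (mfderiv 𝓘(ℝ, E) 𝓘(ℝ, E) (extChartAt 𝓘(ℝ, E) p) q w) := by
  have ha := (α.isSmooth_iff.mp hα p)
  have ha' : ∀ᶠ z in 𝓝 (extChartAt 𝓘(ℝ, E) p p), ContDiffAt ℝ ∞ (α.inChart p) z := by
    filter_upwards [(isOpen_extChartAt_target (I := 𝓘(ℝ, E)) p).mem_nhds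
      (mem_extChartAt_target p)] with z hz
    have h1 := OneForm.inChart_contDiffAt_of_pull (M := E) (β := α.inChart p) (α := α)
      ((contMDiffOn_extChartAt_symm p).contMDiffAt ((isOpen_extChartAt_target p).mem_nhds hz))
      (Eventually.of_forall fun _ ↦ rfl) (α.isSmooth_iff.mp hα _)
    exact (OneForm.inChart_self (E := E) (α.inChart p) z) ▸ h1
  filter_upwards [(α.eventually_eq_pull_inChart p).eventually_nhds,
    (continuousAt_extChartAt (I := 𝓘(ℝ, E)) p).eventually ha',
    (isOpen_extChartAt_source (I := 𝓘(ℝ, E)) p).mem_nhds (mem_extChartAt_source p)]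
    with q hq hq2 hq3 v w
  refine ⟨by rw [hq.self_of_nhds]; rfl, ?_⟩
  refine OneForm.d_of_pull (E' := E) (M' := E) (α := α.inChart p)
    (contMDiffAt_extChartAt' (by simpa using hq3)) hq ?_ v w
  exact (OneForm.inChart_self (E := E) (α.inChart p) _).symm ▸ hq2

theorem exists_mfderiv_extChartAt_eq {p q : M} (hq : q ∈ (extChartAt 𝓘(ℝ, E) p).source) :
    ∃ e : TangentSpace 𝓘(ℝ, E) q ≃L[ℝ] E,
      ∀ v, mfderiv 𝓘(ℝ, E) 𝓘(ℝ, E) (extChartAt 𝓘(ℝ, E) p) q v = e v := by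
  have : IsManifold 𝓘(ℝ, E) 1 M := .of_le (n := ∞) (by norm_cast)
  obtain ⟨e, he⟩ := isInvertible_mfderiv_extChartAt (I := 𝓘(ℝ, E)) hq
  exact ⟨e, fun v ↦ by rw [← he]; rfl⟩

section Curve

variable {E' : Type*} [NormedAddCommGroup E'] [NormedSpace ℝ E']
  {M' : Type*} [TopologicalSpace M'] [ChartedSpace E' M']

omit [IsManifold 𝓘(ℝ, E) ∞ M] in
theorem HasMFDerivAt.comp_curve {f : M → M'} {c : ℝ → M} {t : ℝ}
    {v : TangentSpace 𝓘(ℝ, E) (c t)}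
    (hc : HasMFDerivAt 𝓘(ℝ, ℝ) 𝓘(ℝ, E) c t ((1 : ℝ →L[ℝ] ℝ).smulRight v))
    (hf : MDifferentiableAt 𝓘(ℝ, E) 𝓘(ℝ, E') f (c t)) :
    HasMFDerivAt 𝓘(ℝ, ℝ) 𝓘(ℝ, E') (f ∘ c) t
      ((1 : ℝ →L[ℝ] ℝ).smulRight (mfderiv 𝓘(ℝ, E) 𝓘(ℝ, E') f (c t) v)) := by
  have h := HasMFDerivAt.comp t hf.hasMFDerivAt hc
  refine h.congr_mfderiv ?_
  ext
  change mfderiv 𝓘(ℝ, E) 𝓘(ℝ, E') f (c t) ((1 : ℝ) • v) = (1 : ℝ) • _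
  rw [one_smul, one_smul]

theorem HasMFDerivAt.hasDerivAt {c : ℝ → E} {t : ℝ} {v : E}
    (hc : HasMFDerivAt 𝓘(ℝ, ℝ) 𝓘(ℝ, E) c t ((1 : ℝ →L[ℝ] ℝ).smulRight v)) :
    HasDerivAt c v t := by
  have h : HasFDerivAt c ((1 : ℝ →L[ℝ] ℝ).smulRight v) t := hc.hasFDerivAt
  simpa using h.hasDerivAt

omit [IsManifold 𝓘(ℝ, E) ∞ M] in
theorem HasReebVelocity.continuousAt {α : OneForm E M} {c : ℝ → M} {t : ℝ}
    (h : HasReebVelocity α c t) : ContinuousAt c t := by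
  obtain ⟨v, -, hc⟩ := h
  exact hc.continuousAt

end Curve

theorem eventuallyEq_of_hasReebVelocity [FiniteDimensional ℝ E] {α : OneForm E M}
    (hα : IsContactForm α) {c₁ c₂ : ℝ → M} {t : ℝ} (h₁ : ∀ᶠ s in 𝓝 t, HasReebVelocity α c₁ s)
    (h₂ : ∀ᶠ s in 𝓝 t, HasReebVelocity α c₂ s) (h : c₁ t = c₂ t) : c₁ =ᶠ[𝓝 t] c₂ := by
  have : IsManifold 𝓘(ℝ, E) 1 M := .of_le (n := ∞) (by norm_cast)
  set p := c₁ t with hp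
  set ψ := extChartAt 𝓘(ℝ, E) p with hψ
  have hch := OneForm.eventually_chart hα.smooth p
  -- If `dα(u, ·) + α(u) α = 0`, inserting `u` gives `α(u)² = 0`. Then `dα(u, ·) = 0`, and
  -- nondegeneracy on `ker α` gives `u = 0`.
  have hinj : Function.Injective (reebMap (α.inChart p) (ψ p)) := by
    rw [injective_iff_map_eq_zero]
    intro u hu
    obtain ⟨e, hev⟩ := exists_mfderiv_extChartAt_eq (mem_extChartAt_source (I := 𝓘(ℝ, E)) p)
    have key : ∀ w : TangentSpace 𝓘(ℝ, E) p,
        α.d p (e.symm u) w + α p (e.symm u) * α p w = 0 := by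
      intro w
      have h1 : reebMap (α.inChart p) (ψ p) u (e w) = 0 := by rw [hu]; rfl
      rw [reebMap_apply] at h1
      rw [(hch.self_of_nhds _ w).2, (hch.self_of_nhds (e.symm u) w).1,
        (hch.self_of_nhds w w).1]
      rw [hev, hev]
      simpa only [ContinuousLinearEquiv.apply_symm_apply] using h1
    have h0 : α p (e.symm u) = 0 := by
      have := key (e.symm u)
      simpa [OneForm.d] using this
    have h2 := hα.nondegenerate p (e.symm u) h0 (fun w hw ↦ by simpa [hw] using key w)
    simpa using h2
  obtain ⟨X, K, s, hs, hlip, hX⟩ :=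
    exists_lipschitz_solution ((α.isSmooth_iff.mp hα.smooth) p) hinj
  have key : ∀ c : ℝ → M, c t = p → (∀ᶠ s in 𝓝 t, HasReebVelocity α c s) →
      ∀ᶠ r in 𝓝 t, HasDerivAt (ψ ∘ c) (X (ψ (c r))) r ∧ ψ (c r) ∈ s := by
    intro c hc hv
    have hcc : Tendsto c (𝓝 t) (𝓝 p) := hc ▸ hv.self_of_nhds.continuousAt
    filter_upwards [hv, hcc.eventually hch, hcc.eventually
      (extChartAt_source_mem_nhds (I := 𝓘(ℝ, E)) p),
      hcc.eventually ((continuousAt_extChartAt (I := 𝓘(ℝ, E)) p).eventually hs)]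
      with r ⟨v, hRv, hrd⟩ hr2 hr3 hr4
    refine ⟨?_, hr4⟩
    have hd := (hrd.comp_curve (f := ψ) (mdifferentiableAt_extChartAt (by
      rw [← extChartAt_source 𝓘(ℝ, E)]; exact hr3))).hasDerivAt
    have e : X (ψ (c r)) = mfderiv 𝓘(ℝ, E) 𝓘(ℝ, E) ψ (c r) v := by
      refine (hX _ hr4 _ ?_).symm
      ext w
      obtain ⟨e, hev⟩ := exists_mfderiv_extChartAt_eq hr3
      have h1 := hr2 v (e.symm w)
      have h2 := hr2 (e.symm w) v
      rw [hRv.2, hRv.1, hev, hev, ContinuousLinearEquiv.apply_symm_apply] at h1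
      rw [hev, ContinuousLinearEquiv.apply_symm_apply] at h2
      rw [hev]
      refine (reebMap_apply _ _ _ _).trans ?_
      rw [← h1.2, ← h1.1, zero_add, one_mul]
    rwa [e]
  have hfin := ODE_solution_unique_of_eventually (v := fun _ ↦ X) (s := fun _ ↦ s) (K := K)
    (Eventually.of_forall fun _ ↦ hlip) (key c₁ rfl h₁) (key c₂ h.symm h₂)
    (by simp [← h, ← hp])
  have hsrc : ∀ᶠ q in 𝓝 (c₂ t), q ∈ ψ.source :=
    h ▸ extChartAt_source_mem_nhds (I := 𝓘(ℝ, E)) p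
  filter_upwards [hfin, h₁.self_of_nhds.continuousAt.eventually (extChartAt_source_mem_nhds (I := 𝓘(ℝ, E)) p),
    h₂.self_of_nhds.continuousAt.eventually hsrc] with r h1 h2 h3
  exact ψ.injOn h2 h3 h1

/-- Connectedness of the interval: the set of times near which the curves agree is open, and it is
relatively closed because `M` is Hausdorff and agreement at one time spreads to a neighbourhood. -/
theorem eqOn_of_hasReebVelocity [FiniteDimensional ℝ E] [T2Space M] {α : OneForm E M}
    (hα : IsContactForm α) {c₁ c₂ : ℝ → M} {a b t : ℝ}
    (h₁ : ∀ s ∈ Ioo a b, HasReebVelocity α c₁ s) (h₂ : ∀ s ∈ Ioo a b, HasReebVelocity α c₂ s)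
    (ht : t ∈ Ioo a b) (h : c₁ t = c₂ t) : EqOn c₁ c₂ (Ioo a b) := by
  have hloc : ∀ s ∈ Ioo a b, c₁ s = c₂ s → c₁ =ᶠ[𝓝 s] c₂ := fun s hs he ↦
    eventuallyEq_of_hasReebVelocity hα
      (by filter_upwards [isOpen_Ioo.mem_nhds hs] with r hr using h₁ r hr)
      (by filter_upwards [isOpen_Ioo.mem_nhds hs] with r hr using h₂ r hr) he
  have hsub := (isPreconnected_Ioo (a := a) (b := b)).subset_of_closure_inter_subset
    (u := {s | c₁ =ᶠ[𝓝 s] c₂}) isOpen_setOfPred_eventually_nhds ⟨t, ht, hloc t ht h⟩ (by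
      rintro s ⟨hs, hsI⟩
      refine hloc s hsI (tendsto_nhds_unique_of_frequently_eq (h₁ s hsI).continuousAt
        (h₂ s hsI).continuousAt ?_)
      exact (mem_closure_iff_frequently.mp hs).mono fun r hr ↦ hr.self_of_nhds)
  exact fun s hs ↦ (hsub hs).self_of_nhds

end ReebUniqueness

/-! ### Lifting curves, vector fields and flows through a covering -/

section Lifting

variable {E : Type*} [NormedAddCommGroup E] [NormedSpace ℝ E]
  {M : Type*} [TopologicalSpace M] [ChartedSpace E M]
  {N : Type*} [TopologicalSpace N] [ChartedSpace E N]
  {π : N → M}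

omit [ChartedSpace E M] [ChartedSpace E N] in
-- An open convex set is contractible and locally path connected, so the lifting criterion applies.
-- Outside `C` the lift gets the irrelevant value `n₀`.
theorem exists_lift_of_convex {X : Type*} [NormedAddCommGroup X] [NormedSpace ℝ X]
    (hπ : IsCoveringMap π) {C : Set X} (hC : Convex ℝ C) (hCo : IsOpen C) {f : X → M}
    (hf : ContinuousOn f C) {x₀ : X} (hx₀ : x₀ ∈ C) {n₀ : N} (hn₀ : π n₀ = f x₀) :
    ∃ g : X → N, ContinuousOn g C ∧ g x₀ = n₀ ∧ ∀ x ∈ C, π (g x) = f x := by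
  have := hCo.locallyPathConnectedSpace
  have := hC.contractibleSpace ⟨x₀, hx₀⟩
  obtain ⟨g, ⟨hg0, hg⟩, -⟩ := hπ.existsUnique_continuousMap_lifts
    (⟨C.domRestrict f, continuousOn_iff_continuous_domRestrict.mp hf⟩ : C(C, M)) ⟨x₀, hx₀⟩ n₀ hn₀
  classical
  refine ⟨fun x ↦ if h : x ∈ C then g ⟨x, h⟩ else n₀, ?_, by simp [hx₀, hg0], fun x hx ↦ ?_⟩
  · rw [continuousOn_iff_continuous_domRestrict]
    convert g.continuous using 1
    funext x
    simp [x.2]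
  · simp only [hx, dif_pos]
    exact congrFun hg ⟨x, hx⟩

theorem IsReebVector.congr {α : OneForm E M} {p q : M} (h : p = q) {v : E}
    (hv : IsReebVector α p v) : IsReebVector α q v := by
  subst h; exact hv

theorem HasReebVelocity.congr {α : OneForm E M} {c c' : ℝ → M} {t : ℝ} (h : c =ᶠ[𝓝 t] c')
    (hc : HasReebVelocity α c t) : HasReebVelocity α c' t := by
  obtain ⟨v, hR, hd⟩ := hc
  exact ⟨v, hR.congr h.self_of_nhds, hd.congr_of_eventuallyEq h.symm⟩

variable [IsManifold 𝓘(ℝ, E) ∞ M] [IsManifold 𝓘(ℝ, E) ∞ N]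

/-- Near `t` the curve `c` is a local inverse of `π` applied to `π ∘ c`, so it is differentiable,
and the inverse of `dπ` takes Reeb vectors to Reeb vectors. -/
theorem HasReebVelocity.of_comp (hπ : IsLocalDiffeomorph 𝓘(ℝ, E) 𝓘(ℝ, E) ∞ π)
    {α' : OneForm E M} (hα' : α'.IsSmooth) {α : OneForm E N} (h : α'.pullback π = α)
    {c : ℝ → N} {t : ℝ} (hc : ContinuousAt c t) (hv : HasReebVelocity α' (π ∘ c) t) :
    HasReebVelocity α c t := by
  obtain ⟨v, hR, hd⟩ := hv
  set σ := (hπ (c t)).localInverse with hσ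
  have e : σ ∘ (π ∘ c) =ᶠ[𝓝 t] c := by
    filter_upwards [hc.eventually (hπ (c t)).localInverse_eventuallyEq_left] with s hs using hs
  refine ⟨(diffEquiv hπ (c t)).symm v, ⟨?_, fun w ↦ ?_⟩, ?_⟩
  · rw [OneForm.pullback_apply h, mfderiv_diffEquiv_symm]
    exact hR.1
  · rw [OneForm.d_pullback hπ hα' h, mfderiv_diffEquiv_symm]
    exact hR.2 _
  · exact (hd.comp_curve (f := σ)
      ((hπ (c t)).localInverse_mdifferentiableAt (by simp))).congr_of_eventuallyEq e.symm

omit [IsManifold 𝓘(ℝ, E) ∞ M] [IsManifold 𝓘(ℝ, E) ∞ N] in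
theorem contMDiffAt_of_comp (hπ : IsLocalDiffeomorph 𝓘(ℝ, E) 𝓘(ℝ, E) ∞ π)
    {E₁ H₁ : Type*} [NormedAddCommGroup E₁] [NormedSpace ℝ E₁] [TopologicalSpace H₁]
    {I₁ : ModelWithCorners ℝ E₁ H₁} {X : Type*} [TopologicalSpace X] [ChartedSpace H₁ X]
    {f : X → N} {x : X} (hf : ContinuousAt f x) (h : ContMDiffAt I₁ 𝓘(ℝ, E) ∞ (π ∘ f) x) :
    ContMDiffAt I₁ 𝓘(ℝ, E) ∞ f x := by
  have e : (hπ (f x)).localInverse ∘ (π ∘ f) =ᶠ[𝓝 x] f := by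
    filter_upwards [hf.eventually (hπ (f x)).localInverse_eventuallyEq_left] with s hs using hs
  exact (((hπ (f x)).localInverse_contMDiffAt).comp x h).congr_of_eventuallyEq e.symm

/-- The tangent map of a local inverse of `π` is continuous and undoes `dπ`; so continuity of a
vector field along `w` can be tested downstairs. -/
theorem continuousWithinAt_tangent_of_comp (hπ : IsLocalDiffeomorph 𝓘(ℝ, E) 𝓘(ℝ, E) ∞ π)
    {Z : Type*} [TopologicalSpace Z] {s : Set Z} {z₀ : Z} {w : Z → N}
    (V : (z : Z) → TangentSpace 𝓘(ℝ, E) (w z))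
    (hw : ContinuousWithinAt w s z₀)
    (hV : ContinuousWithinAt (fun z ↦ (⟨π (w z), mfderiv 𝓘(ℝ, E) 𝓘(ℝ, E) π (w z) (V z)⟩ :
      TangentBundle 𝓘(ℝ, E) M)) s z₀) :
    ContinuousWithinAt (fun z ↦ (⟨w z, V z⟩ : TangentBundle 𝓘(ℝ, E) N)) s z₀ := by
  have : IsManifold 𝓘(ℝ, E) 1 M := .of_le (n := ∞) (by norm_cast)
  have : IsManifold 𝓘(ℝ, E) 1 N := .of_le (n := ∞) (by norm_cast)
  have hloc := hπ (w z₀)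
  set σ := hloc.localInverse with hσ
  have hso : IsOpen σ.source := hloc.localInverse_open_source
  have h1 : ContinuousOn (tangentMapWithin 𝓘(ℝ, E) 𝓘(ℝ, E) σ σ.source)
      (Bundle.TotalSpace.proj ⁻¹' σ.source) :=
    hloc.localInverse_contMDiffOn.continuousOn_tangentMapWithin (by simp) hso.uniqueMDiffOn
  have hm : (⟨π (w z₀), mfderiv 𝓘(ℝ, E) 𝓘(ℝ, E) π (w z₀) (V z₀)⟩ : TangentBundle 𝓘(ℝ, E) M) ∈
      Bundle.TotalSpace.proj ⁻¹' σ.source := hloc.localInverse_mem_source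
  have h2 := ContinuousAt.comp_continuousWithinAt (x := z₀) (s := s)
    (f := fun z ↦ (⟨π (w z), mfderiv 𝓘(ℝ, E) 𝓘(ℝ, E) π (w z) (V z)⟩ : TangentBundle 𝓘(ℝ, E) M))
    (h1.continuousAt ((hso.preimage (FiberBundle.continuous_proj E
    (TangentSpace 𝓘(ℝ, E)))).mem_nhds hm)) hV
  have key : ∀ z, w z ∈ σ.target → (⟨w z, V z⟩ : TangentBundle 𝓘(ℝ, E) N) =
      tangentMapWithin 𝓘(ℝ, E) 𝓘(ℝ, E) σ σ.source
        ⟨π (w z), mfderiv 𝓘(ℝ, E) 𝓘(ℝ, E) π (w z) (V z)⟩ := by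
    intro z hz
    have hz1 : σ (π (w z)) = w z := hloc.localInverse_left_inv hz
    have hzs : π (w z) ∈ σ.source := by
      have := σ.map_target hz
      rwa [← hloc.localInverse_right_inv this, show hloc.localInverse.toPartialEquiv
        (σ.toPartialEquiv.symm (w z)) = w z from σ.right_inv hz] at this
    have e : σ ∘ π =ᶠ[𝓝 (w z)] id := by
      filter_upwards [σ.open_target.mem_nhds hz] with x hx
      exact hloc.localInverse_left_inv hx
    have e2 := e.mfderiv_eq (I := 𝓘(ℝ, E)) (I' := 𝓘(ℝ, E))
    rw [mfderiv_comp _ ((hloc.localInverse_contMDiffOn.contMDiffAt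
      (hso.mem_nhds hzs)).mdifferentiableAt (by simp)) (hπ.mdifferentiable (by simp) _),
      mfderiv_id] at e2
    have e3 : mfderiv 𝓘(ℝ, E) 𝓘(ℝ, E) σ (π (w z)) (mfderiv 𝓘(ℝ, E) 𝓘(ℝ, E) π (w z) (V z))
      = V z := DFunLike.congr_fun e2 (V z)
    have aux : ∀ (q : N) (v : E), q = w z → v = V z →
      (⟨w z, V z⟩ : TangentBundle 𝓘(ℝ, E) N) = ⟨q, v⟩ := by
      rintro _ _ rfl rfl; rfl
    refine aux _ _ hz1 ?_
    change mfderivWithin 𝓘(ℝ, E) 𝓘(ℝ, E) σ σ.source (π (w z)) _ = _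
    rw [mfderivWithin_of_isOpen hso hzs]
    exact e3
  refine h2.congr_of_eventuallyEq ?_ (key z₀ hloc.localInverse_mem_target)
  filter_upwards [hw.eventually (σ.open_target.mem_nhds hloc.localInverse_mem_target)] with z hz
  exact key z hz

omit [IsManifold 𝓘(ℝ, E) ∞ N] in
theorem IsContactForm.eq_flow [FiniteDimensional ℝ E] [T2Space M] {α : OneForm E M}
    (hα : IsContactForm α) {γ : ℝ → M} {T : ℝ} (hγ : IsClosedReebOrbit α γ T)
    {φ : ℝ → M → M} (hφ : IsReebFlowNear α γ T φ) {t : ℝ} (ht : t ∈ Icc 0 T) :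
    φ t (γ 0) = γ t := by
  obtain ⟨ε, hε, V, -, hV0, -, hφ⟩ := hφ
  have h := eqOn_of_hasReebVelocity hα (c₁ := fun s ↦ φ s (γ 0)) (c₂ := γ) (t := 0)
    (hφ _ hV0).2 (fun s _ ↦ hγ.velocity s) ⟨by linarith, by linarith [hγ.pos]⟩ (hφ _ hV0).1
  exact h ⟨by linarith [ht.1], by linarith [ht.2]⟩

/-- The map `(t, p) ↦ φ' t (π p)` is lifted. With `p` restricted to a ball in a chart, the domain
becomes a product of an interval and a ball, which is convex. -/
theorem IsReebFlowNear.exists_lift (hc : IsCoveringMap π)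
    (hπ : IsLocalDiffeomorph 𝓘(ℝ, E) 𝓘(ℝ, E) ∞ π) {α' : OneForm E M} (hα' : α'.IsSmooth)
    {α : OneForm E N} (h : α'.pullback π = α) {γ' : ℝ → M} {T : ℝ} (hT : 0 < T)
    {φ' : ℝ → M → M} (hφ' : IsReebFlowNear α' γ' T φ') {γ : ℝ → N} (hγ : π (γ 0) = γ' 0) :
    ∃ φ : ℝ → N → N, IsReebFlowNear α γ T φ ∧
      ∀ t ∈ Icc 0 T, ∀ᶠ p in 𝓝 (γ 0), π (φ t p) = φ' t (π p) := by
  obtain ⟨ε, hε, V', hV'o, hV'0, hsm, hφ'⟩ := hφ'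
  set χ := chartAt E (γ 0) with hχ
  have hmem : χ.target ∩ χ.symm ⁻¹' (π ⁻¹' V') ∈ 𝓝 (χ (γ 0)) := by
    refine (χ.continuousOn_symm.isOpen_inter_preimage χ.open_target
      (hV'o.preimage hc.continuous)).mem_nhds ⟨mem_chart_target E _, ?_⟩
    simp only [mem_preimage, χ.left_inv (mem_chart_source E (γ 0)), hγ, hV'0]
  obtain ⟨r, hr, hball⟩ := Metric.mem_nhds_iff.mp hmem
  set B := Metric.ball (χ (γ 0)) r with hB
  set I := Ioo (-ε) (T + ε) with hI
  have h0I : (0 : ℝ) ∈ I := ⟨by linarith, by linarith⟩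
  have hBc : χ (γ 0) ∈ B := Metric.mem_ball_self hr
  have hconv : Convex ℝ (I ×ˢ B) := (convex_Ioo _ _).prod (convex_ball _ _)
  have hopen : IsOpen (I ×ˢ B) := isOpen_Ioo.prod Metric.isOpen_ball
  have hfc : ContinuousOn (fun x : ℝ × E ↦ φ' x.1 (π (χ.symm x.2))) (I ×ˢ B) := by
    refine hsm.continuousOn.comp (f := fun x : ℝ × E ↦ (x.1, π (χ.symm x.2)))
      (continuousOn_fst.prodMk (hc.continuous.comp_continuousOn (χ.continuousOn_symm.comp
        continuousOn_snd fun x hx ↦ (hball hx.2).1))) fun x hx ↦ ⟨hx.1, (hball hx.2).2⟩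
  obtain ⟨g, hgc, hg0, hg⟩ := exists_lift_of_convex hc hconv hopen hfc
    (x₀ := (0, χ (γ 0))) ⟨h0I, hBc⟩ (n₀ := γ 0) (by
      simp only [χ.left_inv (mem_chart_source E (γ 0))]
      rw [(hφ' _ (by rw [hγ]; exact hV'0)).1])
  set V := χ.source ∩ χ ⁻¹' B with hV
  have hVo : IsOpen V := χ.isOpen_inter_preimage Metric.isOpen_ball
  have hV0 : γ 0 ∈ V := ⟨mem_chart_source E _, hBc⟩
  have hVV' : ∀ p ∈ V, π p ∈ V' := fun p hp ↦ by
    have := (hball hp.2).2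
    rwa [mem_preimage, χ.left_inv hp.1] at this
  have hlift : ∀ t ∈ I, ∀ p ∈ V, π (g (t, χ p)) = φ' t (π p) := fun t ht p hp ↦ by
    rw [hg (t, χ p) ⟨ht, hp.2⟩]
    simp only [χ.left_inv hp.1]
  have hcont : ContinuousOn (fun x : ℝ × N ↦ g (x.1, χ x.2)) (I ×ˢ V) :=
    hgc.comp (continuousOn_fst.prodMk (χ.continuousOn.comp continuousOn_snd fun x hx ↦ hx.2.1))
      fun x hx ↦ ⟨hx.1, hx.2.2⟩
  have hVpre : IsPreconnected V := by
    have : V = χ.symm '' B := by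
      rw [χ.symm_image_eq_source_inter_preimage fun x hx ↦ (hball hx).1]
    rw [this]
    exact (convex_ball _ _).isPreconnected.image _
      (χ.continuousOn_symm.mono fun x hx ↦ (hball hx).1)
  -- At time `0` the lift and the identity both lie over `π` on the connected set `V` and agree at
  -- `γ 0`; uniqueness of lifts makes them equal.
  have hzero : EqOn (fun p ↦ g (0, χ p)) id V := by
    refine hc.eqOn_of_comp_eqOn hVpre (hcont.comp (f := fun p : N ↦ ((0 : ℝ), p))
      (by fun_prop) fun p hp ↦ ⟨h0I, hp⟩) continuousOn_id (fun p hp ↦ ?_) hV0 hg0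
    simp only [Function.comp_apply, id]
    rw [hlift 0 h0I p hp, (hφ' _ (hVV' p hp)).1]
  refine ⟨fun t p ↦ g (t, χ p), ⟨ε, hε, V, hVo, hV0, ?_, fun p hp ↦ ⟨hzero hp, fun t ht ↦ ?_⟩⟩,
    fun t ht ↦ ?_⟩
  · rintro ⟨t, p⟩ ⟨ht, hp⟩
    refine ContMDiffAt.contMDiffWithinAt (contMDiffAt_of_comp hπ
      (hcont.continuousAt ((isOpen_Ioo.prod hVo).mem_nhds ⟨ht, hp⟩)) ?_)
    have h1 : ContMDiffAt (𝓘(ℝ, ℝ).prod 𝓘(ℝ, E)) 𝓘(ℝ, E) ∞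
        (Function.uncurry φ' ∘ fun x : ℝ × N ↦ (x.1, π x.2)) (t, p) :=
      ContMDiffAt.comp (t, p) (hsm.contMDiffAt ((isOpen_Ioo.prod hV'o).mem_nhds ⟨ht, hVV' p hp⟩))
        (contMDiffAt_fst.prodMk ((hπ.contMDiff p).comp (t, p) contMDiffAt_snd))
    refine h1.congr_of_eventuallyEq ?_
    filter_upwards [(isOpen_Ioo.prod hVo).mem_nhds ⟨ht, hp⟩] with x hx
    exact hlift x.1 hx.1 x.2 hx.2
  · refine HasReebVelocity.of_comp hπ hα' h ?_ (((hφ' _ (hVV' p hp)).2 t ht).congr ?_)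
    · exact ContinuousAt.comp (f := fun s : ℝ ↦ (s, p))
        (hcont.continuousAt ((isOpen_Ioo.prod hVo).mem_nhds ⟨ht, hp⟩)) (by fun_prop)
    · filter_upwards [isOpen_Ioo.mem_nhds ht] with s hs
      exact (hlift s hs p hp).symm
  · filter_upwards [hVo.mem_nhds hV0] with p hp
    exact hlift t ⟨by linarith [ht.1], by linarith [ht.2]⟩ p hp

end Lifting

/-! ### Lifting a contractible orbit together with its linearized flow -/

section LiftOrbit

variable {E : Type*} [NormedAddCommGroup E] [NormedSpace ℝ E]
  {M : Type*} [TopologicalSpace M] [ChartedSpace E M]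
  {N : Type*} [TopologicalSpace N] [ChartedSpace E N]
  {π : N → M}

/-- Tangent spaces at all points are the same type `E`, so this lemma and the next ones move data
along an equality of base points without casts. -/
theorem coordMatrix_congr {m : ℕ} {α : OneForm E M} {p q : M} (h : p = q)
    {b b' w w' : Fin m ⊕ Fin m → E} (hb : b = b') (hw : w = w') :
    coordMatrix α p b w = coordMatrix α q b' w' := by
  subst h hb hw; rfl

theorem mfderiv_congr_point {f : N → M} {p q : N} (h : p = q) {v w : E} (hv : v = w) :
    (mfderiv 𝓘(ℝ, E) 𝓘(ℝ, E) f p v : E) = (mfderiv 𝓘(ℝ, E) 𝓘(ℝ, E) f q w : E) := by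
  subst h hv; rfl

theorem tangentBundle_mk_congr {p q : M} (h : p = q) {v w : E} (hv : v = w) :
    (⟨p, v⟩ : TangentBundle 𝓘(ℝ, E) M) = ⟨q, w⟩ := by
  subst h hv; rfl

theorem IsSymplecticBasis.congr {m : ℕ} {α : OneForm E M} {p q : M} (h : p = q)
    {b b' : Fin m ⊕ Fin m → E} (hb : b = b') (hs : IsSymplecticBasis α p b) :
    IsSymplecticBasis α q b' := by
  subst h hb; exact hs

/-- The radial retraction of `ℂ` onto the closed unit disc. -/
def discRetract (z : ℂ) : ℂ := (max 1 ‖z‖)⁻¹ • z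

theorem continuous_discRetract : Continuous discRetract := by
  refine Continuous.smul ((continuous_const.max continuous_norm).inv₀ fun z ↦ ?_) continuous_id
  positivity

theorem discRetract_mem (z : ℂ) : discRetract z ∈ Metric.closedBall (0 : ℂ) 1 := by
  have h : 0 < max 1 ‖z‖ := by positivity
  rw [mem_closedBall_zero_iff, discRetract, norm_smul, norm_inv, Real.norm_of_nonneg h.le,
    inv_mul_le_one₀ h]
  exact le_max_right _ _

theorem discRetract_of_mem {z : ℂ} (hz : z ∈ Metric.closedBall (0 : ℂ) 1) : discRetract z = z := by
  rw [mem_closedBall_zero_iff] at hz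
  simp [discRetract, hz]

omit [ChartedSpace E M] [ChartedSpace E N] in
-- The radial retraction extends the disc to the open convex set `ℂ`.
theorem exists_lift_disc (hc : IsCoveringMap π) (hs : Function.Surjective π) {u' : ℂ → M}
    (hu' : ContinuousOn u' (Metric.closedBall 0 1)) :
    ∃ u : ℂ → N, Continuous u ∧ ∀ z ∈ Metric.closedBall (0 : ℂ) 1, π (u z) = u' z := by
  have hf : Continuous (u' ∘ discRetract) :=
    hu'.comp_continuous continuous_discRetract discRetract_mem
  obtain ⟨n₀, hn₀⟩ := hs (u' (discRetract 0))
  obtain ⟨u, hu, -, h⟩ := exists_lift_of_convex hc convex_univ isOpen_univ hf.continuousOn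
    (mem_univ (0 : ℂ)) hn₀
  refine ⟨u, continuousOn_univ.mp hu, fun z hz ↦ ?_⟩
  rw [h z trivial, Function.comp_apply, discRetract_of_mem hz]

theorem exp_mem_closedBall (t : ℝ) :
    Complex.exp (2 * Real.pi * Complex.I * (t : ℂ)) ∈ Metric.closedBall (0 : ℂ) 1 := by
  rw [mem_closedBall_zero_iff, show 2 * Real.pi * Complex.I * (t : ℂ)
    = ((2 * Real.pi * t : ℝ) : ℂ) * Complex.I by push_cast; ring, Complex.norm_exp_ofReal_mul_I]

variable [IsManifold 𝓘(ℝ, E) ∞ M] [IsManifold 𝓘(ℝ, E) ∞ N]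

theorem coordMatrix_pullback {m : ℕ} (hπ : IsLocalDiffeomorph 𝓘(ℝ, E) 𝓘(ℝ, E) ∞ π)
    {α' : OneForm E M} (hα' : α'.IsSmooth) {α : OneForm E N} (h : α'.pullback π = α) (x : N)
    (b w : Fin m ⊕ Fin m → TangentSpace 𝓘(ℝ, E) x) :
    coordMatrix α x b w = coordMatrix α' (π x)
      (fun a ↦ mfderiv 𝓘(ℝ, E) 𝓘(ℝ, E) π x (b a)) (fun a ↦ mfderiv 𝓘(ℝ, E) 𝓘(ℝ, E) π x (w a)) := by
  ext r c
  rcases r with i | i <;>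
  simp only [coordMatrix, Matrix.of_apply, Sum.elim_inl, Sum.elim_inr, OneForm.d_pullback hπ hα' h]

theorem isSymplecticBasis_pullback_iff {m : ℕ} (hπ : IsLocalDiffeomorph 𝓘(ℝ, E) 𝓘(ℝ, E) ∞ π)
    {α' : OneForm E M} (hα' : α'.IsSmooth) {α : OneForm E N} (h : α'.pullback π = α) (x : N)
    (b : Fin m ⊕ Fin m → TangentSpace 𝓘(ℝ, E) x) :
    IsSymplecticBasis α x b ↔ IsSymplecticBasis α' (π x)
      (fun a ↦ mfderiv 𝓘(ℝ, E) 𝓘(ℝ, E) π x (b a)) := by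
  constructor
  · rintro ⟨h1, h2, h3, h4⟩
    exact ⟨fun a ↦ by rw [← OneForm.pullback_apply h, h1],
      fun i j ↦ by rw [← OneForm.d_pullback hπ hα' h, h2],
      fun i j ↦ by rw [← OneForm.d_pullback hπ hα' h, h3],
      fun i j ↦ by rw [← OneForm.d_pullback hπ hα' h, h4]⟩
  · rintro ⟨h1, h2, h3, h4⟩
    exact ⟨fun a ↦ by rw [OneForm.pullback_apply h, h1],
      fun i j ↦ by rw [OneForm.d_pullback hπ hα' h, h2],
      fun i j ↦ by rw [OneForm.d_pullback hπ hα' h, h3],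
      fun i j ↦ by rw [OneForm.d_pullback hπ hα' h, h4]⟩

omit [IsManifold 𝓘(ℝ, E) ∞ M] in
theorem IsReebFlowNear.mdifferentiableAt {α : OneForm E M} {γ : ℝ → M} {T : ℝ} {φ : ℝ → M → M}
    (hφ : IsReebFlowNear α γ T φ) {t : ℝ} (ht : t ∈ Icc 0 T) :
    MDifferentiableAt 𝓘(ℝ, E) 𝓘(ℝ, E) (φ t) (γ 0) := by
  obtain ⟨ε, hε, V, hVo, hV0, hsm, -⟩ := hφ
  have h1 := (hsm.contMDiffAt ((isOpen_Ioo.prod hVo).mem_nhds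
    (⟨⟨by linarith [ht.1], by linarith [ht.2]⟩, hV0⟩ : (t, γ 0) ∈ Ioo (-ε) (T + ε) ×ˢ V)))
  have h2 : ContMDiffAt 𝓘(ℝ, E) (𝓘(ℝ, ℝ).prod 𝓘(ℝ, E)) ∞ (fun p : M ↦ (t, p)) (γ 0) :=
    contMDiffAt_const.prodMk contMDiffAt_id
  exact (ContMDiffAt.comp (γ 0) h1 h2).mdifferentiableAt (by simp)

/-- The orbit upstairs is defined as the boundary of the lifted disc, so it closes up after the same
time `T` and is contractible. The entries of the matrix path are values of `dα` on lifted vectors,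
hence equal to those downstairs. -/
theorem IsLinearizedFlow.exists_lift [FiniteDimensional ℝ E] [T2Space N] (hc : IsCoveringMap π)
    (hs : Function.Surjective π) (hπ : IsLocalDiffeomorph 𝓘(ℝ, E) 𝓘(ℝ, E) ∞ π) {α' : OneForm E M}
    (hα' : α'.IsSmooth) {α : OneForm E N} (hα : IsContactForm α) (h : α'.pullback π = α)
    {γ' : ℝ → M} {T : ℝ} (hγ' : IsClosedReebOrbit α' γ' T) {m : ℕ} {Ψ : SpPath m}
    (hΨ : IsLinearizedFlow α' γ' T Ψ) :
    ∃ γ : ℝ → N, IsClosedReebOrbit α γ T ∧ IsContractibleLoop γ T ∧ IsLinearizedFlow α γ T Ψ := by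
  obtain ⟨φ', u', F', hφ', ⟨hu'c, hu'γ⟩, hF', hΨ⟩ := hΨ
  have hT := hγ'.pos
  obtain ⟨u, huc, hu⟩ := exists_lift_disc hc hs hu'c
  set γ : ℝ → N := fun t ↦ u (Complex.exp (2 * Real.pi * Complex.I * ((t / T : ℝ) : ℂ))) with hγdef
  have hγc : Continuous γ := by
    refine huc.comp ?_
    fun_prop
  have hπγ : π ∘ γ = γ' := by
    funext t
    simp only [hγdef, Function.comp_apply]
    rw [hu _ (exp_mem_closedBall _), hu'γ]
    congr 1
    field_simp
  have hγT : ∀ t : ℝ, γ (T * t) = u (Complex.exp (2 * Real.pi * Complex.I * (t : ℂ))) := by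
    intro t
    simp only [hγdef]
    rw [mul_div_cancel_left₀ _ hT.ne']
  have hγ0 : γ 0 = u 1 := by
    have := hγT 0
    simpa using this
  have hγ : IsClosedReebOrbit α γ T := by
    refine ⟨hT, fun t ↦ ?_, fun t ↦ ?_⟩
    · simp only [hγdef]
      rw [add_div, div_self hT.ne']
      congr 1
      rw [Complex.exp_eq_exp_iff_exists_int]
      exact ⟨1, by push_cast; ring⟩
    · exact HasReebVelocity.of_comp hπ hα' h hγc.continuousAt (by rw [hπγ]; exact hγ'.velocity t)
  have hcap : IsCappingDisc γ T u := ⟨huc.continuousOn, fun t ↦ (hγT t).symm⟩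
  obtain ⟨φ, hφ, hπφ⟩ := hφ'.exists_lift hc hπ hα' h hT (congrFun hπγ 0)
  set F : (z : ℂ) → Fin m ⊕ Fin m → TangentSpace 𝓘(ℝ, E) (u z) :=
    fun z a ↦ (diffEquiv hπ (u z)).symm (F' z a) with hF
  have hdF : ∀ z a, (mfderiv 𝓘(ℝ, E) 𝓘(ℝ, E) π (u z) (F z a) : E) = F' z a :=
    fun z a ↦ mfderiv_diffEquiv_symm hπ (u z) (F' z a)
  refine ⟨γ, hγ, ⟨u, hcap⟩, φ, u, F, hφ, hcap, ⟨fun a z hz ↦ ?_, fun z hz ↦ ?_⟩, fun t ↦ ?_⟩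
  · refine continuousWithinAt_tangent_of_comp hπ (fun z ↦ F z a) huc.continuousWithinAt ?_
    refine (hF'.continuousOn a z hz).congr (fun y hy ↦ ?_) ?_
    · exact tangentBundle_mk_congr (hu y hy) (hdF y a)
    · exact tangentBundle_mk_congr (hu z hz) (hdF z a)
  · rw [isSymplecticBasis_pullback_iff hπ hα' h]
    exact (hF'.symplectic z hz).congr (hu z hz).symm (funext fun a ↦ (hdF z a).symm)
  · rw [hΨ t]
    have htI : T * (t : ℝ) ∈ Icc 0 T :=
      ⟨mul_nonneg hT.le t.2.1, mul_le_of_le_one_right hT.le t.2.2⟩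
    have hflow : φ (T * t) (γ 0) = γ (T * t) := hα.eq_flow hγ hφ htI
    refine Eq.trans ?_ (coordMatrix_pullback hπ hα' h (γ (T * t)) _ _).symm
    refine coordMatrix_congr (congrFun hπγ _).symm (funext fun a ↦ ?_) (funext fun a ↦ ?_)
    · exact (hdF _ a).symm.trans (mfderiv_congr_point (hγT t).symm rfl)
    -- Differentiating `π ∘ φ_t = φ'_t ∘ π` at `γ 0` shows that `dπ` carries the linearized flow
    -- upstairs to the one downstairs.
    · have hπφt : π ∘ φ (T * t) =ᶠ[𝓝 (γ 0)] φ' (T * t) ∘ π := hπφ _ htI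
      have e := hπφt.mfderiv_eq (I := 𝓘(ℝ, E)) (I' := 𝓘(ℝ, E))
      have hγ'0 : π (γ 0) = γ' 0 := congrFun hπγ 0
      rw [mfderiv_comp _ (hπ.mdifferentiable (by simp) _) (hφ.mdifferentiableAt htI),
        mfderiv_comp _ (by rw [hγ'0]; exact hφ'.mdifferentiableAt htI)
          (hπ.mdifferentiable (by simp) _)] at e
      have e2 := DFunLike.congr_fun e (F 1 a)
      have e3 : (mfderiv 𝓘(ℝ, E) 𝓘(ℝ, E) π (γ 0) (F 1 a) : E) = F' 1 a :=
        (mfderiv_congr_point hγ0 rfl).trans (hdF 1 a)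
      have e4 : (mfderiv 𝓘(ℝ, E) 𝓘(ℝ, E) (φ' (T * t)) (γ' 0) (F' 1 a) : E) =
        (mfderiv 𝓘(ℝ, E) 𝓘(ℝ, E) (φ' (T * t)) (π (γ 0))
          (mfderiv 𝓘(ℝ, E) 𝓘(ℝ, E) π (γ 0) (F 1 a)) : E) :=
        mfderiv_congr_point hγ'0.symm e3.symm
      exact e4.trans (e2.symm.trans (mfderiv_congr_point hflow rfl))

theorem IsDynamicallyConvex.of_covering [FiniteDimensional ℝ E] [T2Space N]
    (hc : IsCoveringMap π)
    (hs : Function.Surjective π) (hπ : IsLocalDiffeomorph 𝓘(ℝ, E) 𝓘(ℝ, E) ∞ π) {α' : OneForm E M}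
    (hα' : α'.IsSmooth) {α : OneForm E N} (hα : IsContactForm α) (h : α'.pullback π = α) {n : ℕ}
    (hn : ∀ (γ : ℝ → N) (T : ℝ), IsClosedReebOrbit α γ T → IsContractibleLoop γ T →
      ((n + 1 : ℕ) : EReal) ≤ orbitIndex n α γ T)
    (hchern : RationalChernClassVanishes n α') : IsDynamicallyConvex n α' := by
  refine ⟨hchern, fun γ' T hγ' _ ↦ le_iInf₂ fun Ψ hΨ ↦ ?_⟩
  obtain ⟨γ, hγ, hγc, hΨ⟩ := hΨ.exists_lift hc hs hπ hα' hα h hγ'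
  exact (hn γ T hγ hγc).trans (iInf₂_le Ψ hΨ)

end LiftOrbit

/-! ### Continuous arguments and winding estimates -/

section Winding

/-- If `f` grew by `π` or more, it would take the value `f x + π`, where the cosine is negative. The
winding bounds below all come from this. -/
theorem abs_sub_lt_pi_of_cos_pos {X : Type*} [TopologicalSpace X] [PreconnectedSpace X] {f : X → ℝ}
    (hf : Continuous f) (h : ∀ x, 0 < Real.cos (f x)) (x y : X) : |f x - f y| < Real.pi := by
  have key : ∀ x y, f y - f x < Real.pi := by
    intro x y
    by_contra! hlt
    obtain ⟨z, hz⟩ := mem_range_of_exists_le_of_exists_ge hf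
      (⟨x, by linarith [Real.pi_pos]⟩ : ∃ a, f a ≤ f x + Real.pi) ⟨y, by linarith⟩
    have h1 := h z
    rw [hz, Real.cos_add_pi] at h1
    linarith [h x]
  rw [abs_lt]
  exact ⟨by linarith [key x y], key y x⟩

theorem eq_of_sub_lt_pi {a b : ℝ} {n : ℤ} (h : a - b = 2 * Real.pi * n)
    (hab : |a - b| < Real.pi) : a = b := by
  have hn : n = 0 := by
    by_contra hne
    have h1 : (1 : ℝ) ≤ |(n : ℝ)| := by exact_mod_cast Int.one_le_abs hne
    rw [h, abs_mul, abs_of_pos Real.two_pi_pos] at hab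
    nlinarith [Real.pi_pos]
  rw [hn] at h
  simp at h
  linarith

/-- The argument is the imaginary part of a lift of `f` through the covering `exp`. -/
theorem exists_continuous_argument {X : Type*} [NormedAddCommGroup X] [NormedSpace ℝ X]
    {f : X → ℂ} (hf : Continuous f) (h0 : ∀ x, f x ≠ 0) :
    ∃ θ : X → ℝ, Continuous θ ∧ ∀ x, f x = (‖f x‖ : ℂ) * Complex.exp ((θ x : ℂ) * Complex.I) := by
  have hc := Complex.isCoveringMap_exp
  obtain ⟨g, hg, -, hgf⟩ := exists_lift_of_convex hc (X := X) convex_univ isOpen_univ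
    (f := fun x ↦ (⟨f x, h0 x⟩ : {z : ℂ // z ≠ 0})) (hf.subtype_mk _).continuousOn
    (mem_univ (0 : X)) (n₀ := Complex.log (f 0)) (Subtype.ext (Complex.exp_log (h0 0)))
  refine ⟨fun x ↦ (g x).im, Complex.continuous_im.comp (continuousOn_univ.mp hg), fun x ↦ ?_⟩
  have h1 : Complex.exp (g x) = f x := congrArg Subtype.val (hgf x trivial)
  rw [← h1, Complex.norm_exp, Complex.ofReal_exp, ← Complex.exp_add, Complex.re_add_im]

theorem exists_int_of_exp_eq_one {a : ℝ} (h : Complex.exp ((a : ℂ) * Complex.I) = 1) :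
    ∃ n : ℤ, a = 2 * Real.pi * n := by
  rw [Complex.exp_eq_one_iff] at h
  obtain ⟨n, hn⟩ := h
  refine ⟨n, ?_⟩
  have h2 : (a : ℂ) = ((2 * Real.pi * n : ℝ) : ℂ) := by
    apply mul_right_cancel₀ Complex.I_ne_zero
    rw [hn]; push_cast; ring
  exact_mod_cast h2

theorem exists_int_of_argument_eq {z w : ℂ} {a b : ℝ} (hz : z ≠ 0)
    (ha : z = (‖z‖ : ℂ) * Complex.exp ((a : ℂ) * Complex.I))
    (hb : w = (‖w‖ : ℂ) * Complex.exp ((b : ℂ) * Complex.I)) (h : z = w) :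
    ∃ n : ℤ, a - b = 2 * Real.pi * n := by
  apply exists_int_of_exp_eq_one
  subst h
  have hn : (‖z‖ : ℂ) ≠ 0 := by simpa using hz
  have h1 := mul_left_cancel₀ hn (ha.symm.trans hb)
  push_cast
  rw [sub_mul, Complex.exp_sub, h1, div_self (Complex.exp_ne_zero _)]

/-- The real part of `z` times the conjugate of `w` is `‖z‖ ‖w‖ cos (a - b)`. -/
theorem cos_sub_pos_of_argument {z w : ℂ} {a b : ℝ}
    (ha : z = (‖z‖ : ℂ) * Complex.exp ((a : ℂ) * Complex.I))
    (hb : w = (‖w‖ : ℂ) * Complex.exp ((b : ℂ) * Complex.I))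
    (h : 0 < (z * (starRingEnd ℂ) w).re) : 0 < Real.cos (a - b) := by
  have e : (z * (starRingEnd ℂ) w).re = ‖z‖ * ‖w‖ * Real.cos (a - b) := by
    have e1 : z * (starRingEnd ℂ) w =
        ((‖z‖ * ‖w‖ : ℝ) : ℂ) * Complex.exp (((a - b : ℝ) : ℂ) * Complex.I) := by
      conv_lhs => rw [ha, hb]
      simp only [map_mul, Complex.conj_ofReal, ← Complex.exp_conj, Complex.conj_I, mul_neg]
      push_cast
      rw [sub_mul, sub_eq_add_neg, Complex.exp_add]
      ring
    rw [e1, Complex.re_ofReal_mul, Complex.exp_ofReal_mul_I_re]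
  rw [e] at h
  by_contra! hle
  nlinarith [mul_nonneg (norm_nonneg z) (norm_nonneg w)]

end Winding

/-! ### Paths in Sp(2) and the lower bound for the index -/

section SpTwo

theorem complexDet_one (A : Mat 1) :
    complexDet A = (((A (.inl 0) (.inl 0) + A (.inr 0) (.inr 0)) / 2 : ℝ) : ℂ) +
      (((A (.inr 0) (.inl 0) - A (.inl 0) (.inr 0)) / 2 : ℝ) : ℂ) * Complex.I := by
  simp [complexDet]

theorem complexDet_re (A : Mat 1) :
    (complexDet A).re = (A (.inl 0) (.inl 0) + A (.inr 0) (.inr 0)) / 2 := by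
  rw [complexDet_one]; simp

theorem complexDet_im (A : Mat 1) :
    (complexDet A).im = (A (.inr 0) (.inl 0) - A (.inl 0) (.inr 0)) / 2 := by
  rw [complexDet_one]; simp

theorem det_mat_one (A : Mat 1) :
    A.det = A (.inl 0) (.inl 0) * A (.inr 0) (.inr 0) - A (.inl 0) (.inr 0) * A (.inr 0) (.inl 0) := by
  rw [← Matrix.det_submatrix_equiv_self finSumFinEquiv.symm A, Matrix.det_fin_two]
  rfl

theorem det_eq_one_of_mem (A : Matrix.symplecticGroup (Fin 1) ℝ) : (A : Mat 1).det = 1 := by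
  have h := SymplecticGroup.mem_iff.mp A.2
  have h2 := congrFun (congrFun h (.inl 0)) (.inr 0)
  rw [det_mat_one]
  simp [Matrix.mul_apply, Matrix.J, Fintype.sum_sum_type] at h2
  linarith

/-- For a matrix with rows `(a, b)` and `(c, d)`, `4 ‖complexDet A‖² = 4 det A + (a - d)² + (b +
c)²`. -/
theorem one_le_norm_complexDet {A : Mat 1} (h : A.det = 1) : 1 ≤ ‖complexDet A‖ := by
  have h1 : 1 ≤ ‖complexDet A‖ ^ 2 := by
    rw [← Complex.normSq_eq_norm_sq, Complex.normSq_apply, complexDet_re, complexDet_im]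
    rw [det_mat_one] at h
    nlinarith [sq_nonneg (A (.inl 0) (.inl 0) - A (.inr 0) (.inr 0)),
      sq_nonneg (A (.inl 0) (.inr 0) + A (.inr 0) (.inl 0))]
  nlinarith [norm_nonneg (complexDet A)]

/-- When `det A = 1`, `det (A - 1) = 2 - tr A`, and the trace is twice the real part of `complexDet
A`. -/
theorem nondegenerate_iff {A : Mat 1} (h : A.det = 1) :
    Nondegenerate A ↔ (complexDet A).re ≠ 1 := by
  rw [det_mat_one] at h
  rw [Nondegenerate, det_mat_one, complexDet_re]
  simp
  constructor
  · intro h1 h2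
    apply h1
    linarith
  · intro h1 h2
    apply h1
    linarith

theorem re_of_argument {z : ℂ} {a : ℝ} (ha : z = (‖z‖ : ℂ) * Complex.exp ((a : ℂ) * Complex.I)) :
    z.re = ‖z‖ * Real.cos a := by
  conv_lhs => rw [ha]
  simp [Complex.exp_mul_I, ← Complex.ofReal_cos, ← Complex.ofReal_sin]

theorem continuous_complexDet : Continuous (complexDet : Mat 1 → ℂ) := by
  have : (complexDet : Mat 1 → ℂ) = fun A ↦ _ := funext complexDet_one
  rw [this]
  fun_prop

/-- Along a path of nondegenerate matrices the argument does not drop by a full turn below a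
multiple of `2π`. -/
theorem lt_argument_of_nondegenerate {Φ : SpPath 1} (hΦ : ∀ t, Nondegenerate (Φ t : Mat 1))
    {η : C(unitInterval, ℝ)} (hη : IsArgument Φ η) {j : ℤ}
    (h0 : 2 * Real.pi * j + Real.pi < η 0) : 2 * Real.pi * j < η 1 := by
  have hre : ∀ t, (complexDet (Φ t : Mat 1)).re ≠ 1 := fun t ↦
    (nondegenerate_iff (det_eq_one_of_mem _)).mp (hΦ t)
  have hcont : Continuous fun t ↦ (complexDet (Φ t : Mat 1)).re :=
    Complex.continuous_re.comp (continuous_complexDet.comp (continuous_subtype_val.comp Φ.continuous))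
  have hηre := fun t ↦ re_of_argument (hη t)
  -- The real part avoids `1`, so it stays on one side of it. If it is above `1`, then `cos η > 0`
  -- throughout and `η` moves by less than `π`.
  by_cases hlt : ∃ s, 1 < (complexDet (Φ s : Mat 1)).re
  · obtain ⟨s, hs⟩ := hlt
    have hall : ∀ t, 1 < (complexDet (Φ t : Mat 1)).re := by
      intro t
      by_contra! ht
      obtain ⟨r, hr⟩ := mem_range_of_exists_le_of_exists_ge hcont ⟨t, ht⟩ ⟨s, hs.le⟩
      exact hre r hr
    have hcos : ∀ t, 0 < Real.cos (η t) := by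
      intro t
      have h1 := hall t
      rw [hηre t] at h1
      by_contra! hle
      nlinarith [norm_nonneg (complexDet (Φ t : Mat 1))]
    have h2 := abs_lt.mp (abs_sub_lt_pi_of_cos_pos η.continuous hcos 0 1)
    linarith [h2.2]
  · push Not at hlt
    -- If the real part is below `1`, then `η` cannot take the value `2πj`: there `complexDet` would
    -- be real and at least `1`.
    by_contra! hle
    obtain ⟨r, hr⟩ := mem_range_of_exists_le_of_exists_ge η.continuous
      ⟨1, hle⟩ ⟨0, by linarith [Real.pi_pos]⟩
    have h1 := hηre r
    rw [hr, show 2 * Real.pi * j = j * (2 * Real.pi) by ring, Real.cos_int_mul_two_pi, mul_one] at h1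
    have h2 := one_le_norm_complexDet (det_eq_one_of_mem (Φ r))
    exact hre r (le_antisymm (hlt r) (h1 ▸ h2))

/-- Since `‖complexDet Ψ‖ ≥ 1`, nearness within `1` keeps the cosine of the difference of arguments
positive, so `Φ` gains more than `4πk - π`. It starts at some `2πj`, so its extension begins above
`2π(j + 2k - 1) + π` and ends above `2π(j + 2k - 1)`. Thus `nπ > 2π(2k - 1) ≥ 2π`. -/
theorem three_le_of_isConleyZehnderIndex {Ψ Φ : SpPath 1} {ψ : C(unitInterval, ℝ)}
    (hψ : IsArgument Ψ ψ) {k : ℕ} (hk : 1 ≤ k) (hvar : ψ 1 - ψ 0 = 4 * Real.pi * k)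
    (hnear : ∀ t, ‖complexDet (Φ t : Mat 1) - complexDet (Ψ t : Mat 1)‖ < 1) {n : ℤ}
    (hn : IsConleyZehnderIndex Φ n) : 3 ≤ n := by
  obtain ⟨hΦ0, Φ', -, hnd, -, θ, η, hθ, hη, hηθ, hind⟩ := hn
  have hone : complexDet ((1 : Matrix.symplecticGroup (Fin 1) ℝ) : Mat 1) = 1 := by
    rw [complexDet_one]; simp
  have h0 : ∃ j : ℤ, θ 0 = 2 * Real.pi * j := by
    apply exists_int_of_exp_eq_one
    have := hθ 0
    rw [hΦ0, hone] at this
    simpa using this.symm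
  have hcos : ∀ t, 0 < Real.cos (θ t - ψ t) := by
    intro t
    refine cos_sub_pos_of_argument (hθ t) (hψ t) ?_
    have h1 := one_le_norm_complexDet (det_eq_one_of_mem (Ψ t))
    have h2 := hnear t
    generalize complexDet (Φ t : Mat 1) = a at h2 ⊢
    generalize complexDet (Ψ t : Mat 1) = b at h1 h2 ⊢
    have h3 : (a * (starRingEnd ℂ) b).re = ‖b‖ ^ 2 + ((a - b) * (starRingEnd ℂ) b).re := by
      rw [← Complex.normSq_eq_norm_sq, Complex.normSq_apply]
      simp
      ring
    have h4 : |((a - b) * (starRingEnd ℂ) b).re| ≤ ‖a - b‖ * ‖b‖ := by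
      refine (Complex.abs_re_le_norm _).trans ?_
      simp
    have h5 := (abs_le.mp h4).1
    rw [h3]
    nlinarith
  have hdiff := (abs_lt.mp (abs_sub_lt_pi_of_cos_pos (f := fun t ↦ θ t - ψ t)
    (by fun_prop) hcos 0 1)).2
  obtain ⟨j, hj⟩ := h0
  have hfin := lt_argument_of_nondegenerate hnd hη (j := j + 2 * k - 1) (by
    push_cast
    rw [hηθ]
    linarith)
  have h6 : (2 : ℝ) * Real.pi < n * Real.pi := by
    have hk' : (1 : ℝ) ≤ k := by exact_mod_cast hk
    push_cast at hfin
    nlinarith [Real.pi_pos]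
  have h7 : (2 : ℝ) < n := lt_of_mul_lt_mul_right h6 Real.pi_pos.le
  have h8 : (2 : ℤ) < n := by exact_mod_cast h7
  omega

theorem three_le_lowerConleyZehnder {Ψ : SpPath 1} {ψ : C(unitInterval, ℝ)}
    (hψ : IsArgument Ψ ψ) {k : ℕ} (hk : 1 ≤ k) (hvar : ψ 1 - ψ 0 = 4 * Real.pi * k) :
    ((2 + 1 : ℕ) : EReal) ≤ lowerConleyZehnder Ψ := by
  let c : C(Matrix.symplecticGroup (Fin 1) ℝ, ℂ) :=
    ⟨fun A ↦ complexDet (A : Mat 1), continuous_complexDet.comp continuous_subtype_val⟩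
  have hev : ∀ᶠ Φ : SpPath 1 in 𝓝 Ψ, dist (c.comp Φ) (c.comp Ψ) < 1 :=
    (ContinuousMap.continuous_postcomp c).continuousAt.eventually (Metric.ball_mem_nhds (c.comp Ψ) one_pos)
  refine le_liminf_of_le (by isBoundedDefault) ?_
  filter_upwards [nhdsWithin_le_nhds hev] with Φ hΦ
  refine le_iInf₂ fun n hn ↦ ?_
  have h3 := three_le_of_isConleyZehnderIndex hψ hk hvar (fun t ↦ ?_) hn
  · have h4 : ((2 + 1 : ℕ) : ℝ) ≤ (n : ℝ) := by
      push_cast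
      have : ((3 : ℤ) : ℝ) ≤ n := Int.cast_le.mpr h3
      norm_num at this ⊢
      exact this
    exact (EReal.coe_natCast (n := 2 + 1)).symm.le.trans (EReal.coe_le_coe_iff.mpr h4)
  · have := (ContinuousMap.dist_apply_le_dist (f := c.comp Φ) (g := c.comp Ψ) t).trans_lt hΦ
    rwa [dist_eq_norm] at this

/-- The matrix, in the frames with complex coordinates `(a, b)` and `(a', b')`, of the
multiplication by `u`. -/
def rotationMatrix (a b a' b' u : ℂ) : Mat 1 :=
  Matrix.of fun r c ↦ Sum.elim
    (fun _ ↦ Sum.elim (fun _ ↦ (starRingEnd ℂ (u * a') * b).im)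
      (fun _ ↦ (starRingEnd ℂ (u * b') * b).im) c)
    (fun _ ↦ Sum.elim (fun _ ↦ (starRingEnd ℂ a * (u * a')).im)
      (fun _ ↦ (starRingEnd ℂ a * (u * b')).im) c) r

theorem det_rotationMatrix {a b a' b' u : ℂ} (h : (starRingEnd ℂ a * b).im = 1)
    (h' : (starRingEnd ℂ a' * b').im = 1) (hu : ‖u‖ = 1) : (rotationMatrix a b a' b' u).det = 1 := by
  have hu2 : u.re * u.re + u.im * u.im = 1 := by
    rw [← Complex.normSq_apply, Complex.normSq_eq_norm_sq, hu, one_pow]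
  rw [det_mat_one]
  simp [rotationMatrix] at *
  linear_combination (u.re * u.re + u.im * u.im) * (a'.re * b'.im - a'.im * b'.re) * h +
    (u.re * u.re + u.im * u.im) * h' + hu2

theorem complexDet_rotationMatrix_self {a b : ℂ} (h : (starRingEnd ℂ a * b).im = 1) (θ : ℝ) :
    complexDet (rotationMatrix a b a b (Complex.exp (θ * Complex.I))) =
      (Real.cos θ : ℂ) + ((Real.sin θ * ((‖a‖ ^ 2 + ‖b‖ ^ 2) / 2) : ℝ) : ℂ) * Complex.I := by
  rw [← Complex.normSq_eq_norm_sq, ← Complex.normSq_eq_norm_sq, Complex.normSq_apply,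
    Complex.normSq_apply]
  simp at h
  apply Complex.ext
  · rw [complexDet_re]
    simp [rotationMatrix, Complex.exp_ofReal_mul_I_re, Complex.exp_ofReal_mul_I_im, Complex.cos_ofReal_re,
      Complex.sin_ofReal_re]
    linear_combination Real.cos θ * h
  · rw [complexDet_im]
    simp [rotationMatrix, Complex.exp_ofReal_mul_I_re, Complex.exp_ofReal_mul_I_im,
      Complex.sin_ofReal_re]
    ring

theorem continuous_rotationMatrix {X : Type*} [TopologicalSpace X] {a b a' b' u : X → ℂ}
    (ha : Continuous a) (hb : Continuous b) (ha' : Continuous a') (hb' : Continuous b')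
    (hu : Continuous u) : Continuous fun x ↦ complexDet (rotationMatrix (a x) (b x) (a' x) (b' x) (u x)) := by
  refine continuous_complexDet.comp (continuous_matrix fun r c ↦ ?_)
  rcases r with i | i <;> rcases c with j | j <;> simp only [rotationMatrix, Matrix.of_apply, Sum.elim_inl, Sum.elim_inr]
  all_goals
    refine Complex.continuous_im.comp (Continuous.mul ?_ ?_)
    all_goals fun_prop

theorem three_le_of_rotation {a b : ℂ → ℂ} (ha : ContinuousOn a (Metric.closedBall 0 1))
    (hb : ContinuousOn b (Metric.closedBall 0 1))
    (hab : ∀ z ∈ Metric.closedBall (0 : ℂ) 1, (starRingEnd ℂ (a z) * b z).im = 1) {k : ℕ}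
    (hk : 1 ≤ k) {Ψ : SpPath 1}
    (hΨ : ∀ t : unitInterval, (Ψ t : Mat 1) =
      rotationMatrix (a (Complex.exp (2 * Real.pi * Complex.I * ((t : ℝ) : ℂ))))
        (b (Complex.exp (2 * Real.pi * Complex.I * ((t : ℝ) : ℂ)))) (a 1) (b 1)
        (Complex.exp (((4 * Real.pi * k * t : ℝ) : ℂ) * Complex.I))) :
    ((2 + 1 : ℕ) : EReal) ≤ lowerConleyZehnder Ψ := by
  have hac : Continuous fun z ↦ a (discRetract z) :=
    ha.comp_continuous continuous_discRetract discRetract_mem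
  have hbc : Continuous fun z ↦ b (discRetract z) :=
    hb.comp_continuous continuous_discRetract discRetract_mem
  -- The three parameters are decoupled: target frame at the first point, rotation angle, source
  -- frame at the last point. The parameter space is a vector space and `C` has no zero, so one
  -- continuous argument `θ` serves for all of it.
  let C : ℂ × ℝ × ℂ → ℂ := fun x ↦ complexDet (rotationMatrix (a (discRetract x.1))
    (b (discRetract x.1)) (a (discRetract x.2.2)) (b (discRetract x.2.2))
    (Complex.exp ((x.2.1 : ℂ) * Complex.I)))
  have hC : Continuous C :=
    continuous_rotationMatrix (hac.comp (by fun_prop)) (hbc.comp (by fun_prop))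
      (hac.comp (f := fun x : ℂ × ℝ × ℂ ↦ x.2.2) (by fun_prop))
      (hbc.comp (f := fun x : ℂ × ℝ × ℂ ↦ x.2.2) (by fun_prop)) (by fun_prop)
  have hC0 : ∀ x, C x ≠ 0 := by
    intro x hx
    have h1 := one_le_norm_complexDet (det_rotationMatrix (hab _ (discRetract_mem x.1))
      (hab _ (discRetract_mem x.2.2)) (Complex.norm_exp_ofReal_mul_I x.2.1))
    change 1 ≤ ‖C x‖ at h1
    rw [hx, norm_zero] at h1
    linarith
  obtain ⟨θ, hθ, hθC⟩ := exists_continuous_argument hC hC0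
  have hper : ∀ x : ℂ × ℝ × ℂ, C (x.1, x.2.1 + 2 * Real.pi, x.2.2) = C x := by
    intro x
    simp only [C]
    congr 2
    push_cast
    rw [add_mul, Complex.exp_add, Complex.exp_two_pi_mul_I, mul_one]
  -- The gain of `θ` over one full turn is continuous with values in `2πℤ`, hence constant.
  let D : ℂ × ℝ × ℂ → ℝ := fun x ↦ θ (x.1, x.2.1 + 2 * Real.pi, x.2.2) - θ x
  have hDint : ∀ x, ∃ n : ℤ, D x = 2 * Real.pi * n := fun x ↦
    exists_int_of_argument_eq (hC0 _) (hθC _) (hθC x) (hper x)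
  have hD : Continuous D := by fun_prop
  have hDcos : ∀ x, 0 < Real.cos (D x) := by
    intro x
    obtain ⟨n, hn⟩ := hDint x
    rw [hn, mul_comm, Real.cos_int_mul_two_pi]
    exact one_pos
  have hDconst : ∀ x y, D x = D y := by
    intro x y
    obtain ⟨n, hn⟩ := hDint x
    obtain ⟨m, hm⟩ := hDint y
    exact eq_of_sub_lt_pi (n := n - m) (by rw [hn, hm]; push_cast; ring)
      (abs_sub_lt_pi_of_cos_pos hD hDcos x y)
  -- With equal source and target frames, `C = cos s + i κ sin s` with `κ > 0`. Against `e^{is}`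
  -- this has real part `cos² s + κ sin² s > 0`, so `θ - s` varies by less than `π` and the gain is
  -- exactly `2π`.
  have hD0 : D 0 = 2 * Real.pi := by
    have hcos : ∀ s : ℝ, 0 < Real.cos (θ (0, s, 0) - s) := by
      intro s
      refine cos_sub_pos_of_argument (w := Complex.exp ((s : ℂ) * Complex.I)) (hθC (0, s, 0))
        (by rw [Complex.norm_exp_ofReal_mul_I]; simp) ?_
      have h1 := hab _ (discRetract_mem 0)
      simp only [C]
      rw [complexDet_rotationMatrix_self h1]
      have h2 : a (discRetract 0) ≠ 0 := by
        intro h0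
        simp [h0] at h1
      have h3 : 0 < (‖a (discRetract 0)‖ ^ 2 + ‖b (discRetract 0)‖ ^ 2) / 2 := by positivity
      generalize (‖a (discRetract 0)‖ ^ 2 + ‖b (discRetract 0)‖ ^ 2) / 2 = κ at h3 ⊢
      rw [Complex.exp_mul_I, ← Complex.ofReal_cos, ← Complex.ofReal_sin]
      simp [Complex.cos_ofReal_re, Complex.sin_ofReal_re]
      have h4 := Real.sin_sq_add_cos_sq s
      rcases eq_or_ne (Real.sin s) 0 with h5 | h5
      · rw [h5] at h4 ⊢
        nlinarith
      · nlinarith [mul_pos h3 (mul_self_pos.mpr h5), mul_self_nonneg (Real.cos s)]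
    have h1 := abs_sub_lt_pi_of_cos_pos (f := fun s : ℝ ↦ θ (0, s, 0) - s) (by fun_prop) hcos
      (0 + 2 * Real.pi) 0
    obtain ⟨n, hn⟩ := hDint 0
    have h2 : D 0 = θ (0, 0 + 2 * Real.pi, 0) - θ (0, 0, 0) := rfl
    refine eq_of_sub_lt_pi (n := n - 1) (by rw [hn]; push_cast; ring) ?_
    rw [h2]
    convert h1 using 2
    ring
  have hiter : ∀ N : ℕ, θ (1, 2 * Real.pi * N, 1) - θ (1, 0, 1) = 2 * Real.pi * N := by
    intro N
    induction N with
    | zero => simp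
    | succ N ih =>
      have h1 : D (1, 2 * Real.pi * N, 1) = 2 * Real.pi := (hDconst _ 0).trans hD0
      simp only [D] at h1
      push_cast
      rw [mul_add, mul_one]
      linarith
  -- The boundary point returns to `1`, so the ends of the path differ only in the angle, by `2k`
  -- full turns.
  let ψ : C(unitInterval, ℝ) := ⟨fun t ↦ θ (Complex.exp (2 * Real.pi * Complex.I * ((t : ℝ) : ℂ)),
    4 * Real.pi * k * t, 1), by fun_prop⟩
  refine three_le_lowerConleyZehnder (ψ := ψ) (fun t ↦ ?_) hk ?_
  · have h1 := hθC (Complex.exp (2 * Real.pi * Complex.I * ((t : ℝ) : ℂ)), 4 * Real.pi * k * t, 1)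
    have h2 : complexDet (Ψ t : Mat 1) =
        C (Complex.exp (2 * Real.pi * Complex.I * ((t : ℝ) : ℂ)), 4 * Real.pi * k * t, 1) := by
      simp only [C]
      rw [hΨ t, discRetract_of_mem (exp_mem_closedBall _),
        discRetract_of_mem (z := 1) (by simp)]
    rw [h2]
    exact h1
  · have h1 := hiter (2 * k)
    have h2 : ψ 1 = θ (1, 2 * Real.pi * (2 * k : ℕ), 1) := by
      simp only [ψ, ContinuousMap.coe_mk, Set.Icc.coe_one]
      congr 2
      · simp [Complex.exp_two_pi_mul_I]
      · push_cast
        congr 1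
        ring
    have h3 : ψ 0 = θ (1, 0, 1) := by simp [ψ]
    rw [h2, h3, h1]
    push_cast
    ring

end SpTwo

/-! ### The standard contact form on the sphere and its Reeb flow -/

section Sphere

open Complex

/-- The model space of `S³`. -/
abbrev E3 : Type := EuclideanSpace ℝ (Fin 3)

/-- The derivative of the inclusion of `S³` into `ℂ²`. -/
def tangentIncl (z : S3) : TangentSpace 𝓘(ℝ, E3) z →L[ℝ] C2 :=
  mfderiv 𝓘(ℝ, E3) 𝓘(ℝ, C2) ((↑) : S3 → C2) z

theorem real_inner_eq_re (x y : C2) : inner ℝ x y = (inner ℂ x y).re := by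
  simp [PiLp.inner_apply, Complex.inner]

theorem I_mul_ofReal_sq_im (r : ℝ) : (Complex.I * (r : ℂ) ^ 2).im = r ^ 2 := by
  simp [← Complex.ofReal_pow]

theorem norm_coe_sphere (z : S3) : ‖(z : C2)‖ = 1 := mem_sphere_zero_iff_norm.mp z.2

theorem inner_self_sphere (z : S3) : inner ℂ (z : C2) (z : C2) = 1 := by
  rw [inner_self_eq_norm_sq_to_K, norm_coe_sphere]; simp

theorem tangentIncl_injective (z : S3) : Function.Injective (tangentIncl z) := by
  convert! injective_mvfderiv_subtypeVal_sphere (E := C2) (n := 3) z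

theorem range_tangentIncl (z : S3) : (tangentIncl z).range = (ℝ ∙ (z : C2))ᗮ := by
  convert! range_mvfderiv_subtypeVal (E := C2) (n := 3) z

theorem inner_tangentIncl_re (z : S3) (v : TangentSpace 𝓘(ℝ, E3) z) :
    (inner ℂ (z : C2) (tangentIncl z v)).re = 0 := by
  have h : tangentIncl z v ∈ (ℝ ∙ (z : C2))ᗮ := by
    rw [← range_tangentIncl]; exact ⟨v, rfl⟩
  rw [← real_inner_eq_re]
  exact Submodule.mem_orthogonal_singleton_iff_inner_right.mp h

theorem exists_tangentIncl_eq (z : S3) {x : C2} (hx : (inner ℂ (z : C2) x).re = 0) :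
    ∃ v : TangentSpace 𝓘(ℝ, E3) z, tangentIncl z v = x := by
  have h : x ∈ (tangentIncl z).range := by
    rw [range_tangentIncl]
    refine Submodule.mem_orthogonal_singleton_iff_inner_right.mpr ?_
    rwa [real_inner_eq_re]
  exact h

/-- The `1`-form `½ Im ⟪z, dz⟫` on `ℂ²`. -/
def liouvilleForm : C2 →L[ℝ] C2 →L[ℝ] ℝ :=
  LinearMap.toContinuousLinearMap
    { toFun := fun x ↦ (1 / 2 : ℝ) • Complex.imCLM.comp ((innerSL ℂ x).restrictScalars ℝ)
      map_add' := fun x y ↦ by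
        ext v
        change 1 / 2 * (inner ℂ (x + y) v).im =
          1 / 2 * (inner ℂ x v).im + 1 / 2 * (inner ℂ y v).im
        rw [inner_add_left, Complex.add_im, mul_add]
      map_smul' := fun r x ↦ by
        ext v
        change 1 / 2 * (inner ℂ (r • x) v).im = r * (1 / 2 * (inner ℂ x v).im)
        rw [inner_smul_left_eq_smul, Complex.smul_im, smul_eq_mul]
        ring }

theorem liouvilleForm_apply (x v : C2) : liouvilleForm x v = 1 / 2 * (inner ℂ x v).im := rfl

theorem stdForm_eq_pull (z : S3) :
    stdForm z = OneForm.pull (M := S3) E3 ((↑) : S3 → C2)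
      (fun x ↦ liouvilleForm x : OneForm C2 C2) z := rfl

theorem stdForm_apply (z : S3) (v : TangentSpace 𝓘(ℝ, E3) z) :
    stdForm z v = 1 / 2 * (inner ℂ (z : C2) (tangentIncl z v)).im := rfl

theorem inner_im_comm (x y : C2) : (inner ℂ x y).im = -(inner ℂ y x).im := by
  rw [← inner_conj_symm x y, Complex.conj_im]

theorem contDiffAt_liouvilleForm (x : C2) :
    ContDiffAt ℝ ∞ (OneForm.inChart (M := C2) (fun x ↦ liouvilleForm x : OneForm C2 C2) x)
      (extChartAt 𝓘(ℝ, C2) x x) := by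
  have h := OneForm.inChart_self (fun x ↦ liouvilleForm x : C2 → C2 →L[ℝ] ℝ) x
  exact (liouvilleForm.contDiff.contDiffAt (n := ∞)).congr_of_eventuallyEq (Eventually.of_forall fun y ↦ congrFun h y)

theorem stdForm_d (z : S3) (v w : TangentSpace 𝓘(ℝ, E3) z) :
    OneForm.d (M := S3) stdForm z v w = (inner ℂ (tangentIncl z v) (tangentIncl z w)).im := by
  have h := OneForm.d_of_pull (E := E3) (β := stdForm)
    (contMDiff_coe_sphere (E := C2) (n := 3) z)
    (Eventually.of_forall stdForm_eq_pull) (contDiffAt_liouvilleForm z) v w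
  refine h.trans ?_
  refine (OneForm.d_self (fun x ↦ liouvilleForm x) (z : C2) (tangentIncl z v)
    (tangentIncl z w)).trans ?_
  rw [show fderiv ℝ (fun x ↦ liouvilleForm x) (z : C2) = liouvilleForm from
    liouvilleForm.fderiv]
  rw [liouvilleForm_apply, liouvilleForm_apply, inner_im_comm (tangentIncl z w)]
  ring

theorem stdForm_isSmooth : OneForm.IsSmooth (M := S3) stdForm := by
  rw [OneForm.isSmooth_iff]
  intro p
  exact OneForm.inChart_contDiffAt_of_pull (contMDiff_coe_sphere (E := C2) (n := 3) p)
    (Eventually.of_forall stdForm_eq_pull) (contDiffAt_liouvilleForm p)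

theorem inner_sphere_eq_zero {z : S3} {v : TangentSpace 𝓘(ℝ, E3) z} (h : stdForm z v = 0) :
    inner ℂ (z : C2) (tangentIncl z v) = 0 := by
  apply Complex.ext
  · exact inner_tangentIncl_re z v
  · rw [stdForm_apply] at h
    simpa using h

theorem isContactForm_stdForm : IsContactForm (M := S3) stdForm where
  smooth := stdForm_isSmooth
  ne_zero z h := by
    obtain ⟨v, hv⟩ := exists_tangentIncl_eq z (x := Complex.I • (z : C2))
      (by rw [inner_smul_right, inner_self_sphere]; simp)
    have h1 : stdForm z v = 0 := by rw [h]; rfl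
    rw [stdForm_apply, hv, inner_smul_right, inner_self_sphere] at h1
    norm_num at h1
  nondegenerate z v hv h := by
    have h0 := inner_sphere_eq_zero hv
    -- The test vector is `i v`, again in the contact plane, and `dα(v, i v) = ‖v‖²`.
    obtain ⟨w, hw⟩ := exists_tangentIncl_eq z (x := Complex.I • tangentIncl z v)
      (by rw [inner_smul_right, h0]; simp)
    have h1 := h w (by rw [stdForm_apply, hw, inner_smul_right, h0]; simp)
    rw [stdForm_d, hw, inner_smul_right, inner_self_eq_norm_sq_to_K] at h1
    have h2 : ‖tangentIncl z v‖ ^ 2 = 0 := by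
      rw [← h1]
      exact (I_mul_ofReal_sq_im _).symm
    apply tangentIncl_injective z
    rw [map_zero]
    exact norm_eq_zero.mp (pow_eq_zero_iff two_ne_zero |>.mp h2)

/-- The factor `2` comes from `α(i z) = 1/2`. The difference `y` from `2 i z` is Hermitian
orthogonal to `z`, and pairing the Reeb vector with `i y` under `dα` gives `‖y‖² = 0`. -/
theorem IsReebVector.tangentIncl_eq {z : S3} {v : TangentSpace 𝓘(ℝ, E3) z}
    (h : IsReebVector (M := S3) stdForm z v) :
    tangentIncl z v = (2 * Complex.I) • (z : C2) := by
  obtain ⟨h1, h2⟩ := h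
  have h3 : inner ℂ (z : C2) (tangentIncl z v) = 2 * Complex.I := by
    apply Complex.ext
    · rw [inner_tangentIncl_re]; simp
    · rw [stdForm_apply] at h1
      simp
      linarith
  set y := tangentIncl z v - (2 * Complex.I) • (z : C2) with hy
  have h4 : inner ℂ (z : C2) y = 0 := by
    rw [hy, inner_sub_right, inner_smul_right, inner_self_sphere, h3]; ring
  obtain ⟨w, hw⟩ := exists_tangentIncl_eq z (x := Complex.I • y)
    (by rw [inner_smul_right, h4]; simp)
  have h5 := h2 w
  have h6 : tangentIncl z v = y + (2 * Complex.I) • (z : C2) := by rw [hy]; abel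
  rw [stdForm_d, hw, h6, inner_smul_right, inner_add_left, inner_smul_left, h4,
    inner_self_eq_norm_sq_to_K] at h5
  have h7 : ‖y‖ ^ 2 = 0 := by
    rw [← h5]
    simp only [mul_zero, add_zero]
    exact (I_mul_ofReal_sq_im _).symm
  rw [h6, norm_eq_zero.mp (pow_eq_zero_iff two_ne_zero |>.mp h7), zero_add]

theorem mdifferentiableAt_coe_sphere (z : S3) :
    MDifferentiableAt 𝓘(ℝ, E3) 𝓘(ℝ, C2) ((↑) : S3 → C2) z :=
  (contMDiff_coe_sphere (E := C2) (n := 3) (m := 1) z).mdifferentiableAt (by simp)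

theorem HasReebVelocity.hasDerivAt_coe {c : ℝ → S3} {t : ℝ}
    (h : HasReebVelocity (M := S3) stdForm c t) :
    HasDerivAt (fun s ↦ (c s : C2)) ((2 * Complex.I) • (c t : C2)) t := by
  obtain ⟨v, hv, hc⟩ := h
  have h1 := hc.comp_curve (mdifferentiableAt_coe_sphere (c t))
  have h2 := HasMFDerivAt.hasDerivAt h1
  rw [← hv.tangentIncl_eq]
  exact h2

/-- The curve `e^{-2is} c(s)` has zero derivative. -/
theorem coe_eq_exp_smul {c : ℝ → S3} {a b : ℝ} (h0 : 0 ∈ Ioo a b)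
    (h : ∀ t ∈ Ioo a b, HasReebVelocity (M := S3) stdForm c t) {t : ℝ} (ht : t ∈ Ioo a b) :
    (c t : C2) = Complex.exp (2 * Complex.I * t) • (c 0 : C2) := by
  have hd : ∀ s ∈ Ioo a b, HasDerivAt (fun s : ℝ ↦ Complex.exp (-(2 * Complex.I * s)) • (c s : C2))
      0 s := by
    intro s hs
    have h1 : HasDerivAt (fun s : ℝ ↦ Complex.exp (-(2 * Complex.I * s)))
        (Complex.exp (-(2 * Complex.I * s)) * -(2 * Complex.I)) s := by
      have h2 : HasDerivAt (fun s : ℝ ↦ -(2 * Complex.I * (s : ℂ))) (-(2 * Complex.I)) s := by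
        exact ((Complex.ofRealCLM.hasDerivAt (x := s)).const_mul
          (2 * Complex.I)).neg.congr_deriv (by simp)
      exact h2.cexp
    have h3 := h1.smul (h s hs).hasDerivAt_coe
    refine h3.congr_deriv ?_
    rw [smul_smul, ← add_smul, ← mul_add, add_neg_cancel, mul_zero, zero_smul]
  have hconst := isOpen_Ioo.is_const_of_deriv_eq_zero (𝕜 := ℝ) isPreconnected_Ioo
    (fun s hs ↦ (hd s hs).differentiableAt.differentiableWithinAt)
    (fun s hs ↦ (hd s hs).deriv) ht h0
  simp only [Complex.ofReal_zero, mul_zero, neg_zero, Complex.exp_zero, one_smul] at hconst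
  rw [← hconst, smul_smul, ← Complex.exp_add]
  simp

theorem IsClosedReebOrbit.coe_eq_exp_smul {γ : ℝ → S3} {T : ℝ}
    (h : IsClosedReebOrbit (M := S3) stdForm γ T) (t : ℝ) :
    (γ t : C2) = Complex.exp (2 * Complex.I * t) • (γ 0 : C2) := by
  have h1 : t ∈ Ioo (-(|t| + 1)) (|t| + 1) := abs_lt.mp (by linarith)
  exact ContactGeometry.coe_eq_exp_smul ⟨by linarith [abs_nonneg t], by linarith [abs_nonneg t]⟩
    (fun s _ ↦ h.velocity s) h1

theorem sphere_ne_zero (z : S3) : (z : C2) ≠ 0 := by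
  intro h
  have := norm_coe_sphere z
  simp [h] at this

theorem IsClosedReebOrbit.exists_period_eq {γ : ℝ → S3} {T : ℝ}
    (h : IsClosedReebOrbit (M := S3) stdForm γ T) : ∃ k : ℕ, 1 ≤ k ∧ T = k * Real.pi := by
  have h1 : (γ T : C2) = γ 0 := by
    have := h.periodic 0
    rw [zero_add] at this
    rw [this]
  rw [h.coe_eq_exp_smul T] at h1
  have h2 : Complex.exp (2 * Complex.I * T) = 1 := by
    have h3 : (Complex.exp (2 * Complex.I * T) - 1) • (γ 0 : C2) = 0 := by
      rw [sub_smul, h1, one_smul, sub_self]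
    exact sub_eq_zero.mp ((smul_eq_zero.mp h3).resolve_right (sphere_ne_zero _))
  obtain ⟨n, hn⟩ := Complex.exp_eq_one_iff.mp h2
  have h4 : (T : ℂ) = n * Real.pi := by
    have h5 : (2 * Complex.I) * (T : ℂ) = (2 * Complex.I) * (n * Real.pi) := by rw [hn]; ring
    exact mul_left_cancel₀ (by simp) h5
  have h5 : T = n * Real.pi := by exact_mod_cast h4
  have h6 : 0 < n := by
    have h7 := h.pos
    rw [h5] at h7
    exact_mod_cast pos_of_mul_pos_left h7 Real.pi_pos.le
  lift n to ℕ using h6.le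
  exact ⟨n, by exact_mod_cast h6, by exact_mod_cast h5⟩

theorem IsReebFlowNear.tangentIncl_mfderiv {γ : ℝ → S3} {T : ℝ} {φ : ℝ → S3 → S3}
    (hφ : IsReebFlowNear (M := S3) stdForm γ T φ) {t : ℝ} (ht : t ∈ Icc 0 T)
    (v : TangentSpace 𝓘(ℝ, E3) (γ 0)) :
    tangentIncl (φ t (γ 0)) (mfderiv 𝓘(ℝ, E3) 𝓘(ℝ, E3) (φ t) (γ 0) v) =
      Complex.exp (2 * Complex.I * t) • tangentIncl (γ 0) v := by
  have hd := hφ.mdifferentiableAt ht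
  obtain ⟨ε, hε, V, hV, hV0, -, hflow⟩ := hφ
  have h1 : (fun p : S3 ↦ (φ t p : C2)) =ᶠ[𝓝 (γ 0)]
      fun p : S3 ↦ Complex.exp (2 * Complex.I * t) • (p : C2) := by
    filter_upwards [hV.mem_nhds hV0] with p hp
    have h2 := coe_eq_exp_smul (c := fun s ↦ φ s p) (a := -ε) (b := T + ε) (t := t)
      ⟨by linarith, by linarith [ht.1, ht.2]⟩ (hflow p hp).2
      ⟨by linarith [ht.1], by linarith [ht.2]⟩
    simp only [(hflow p hp).1] at h2
    exact h2
  have h3 := h1.mfderiv_eq (I := 𝓘(ℝ, E3)) (I' := 𝓘(ℝ, C2))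
  have h4 : mfderiv 𝓘(ℝ, E3) 𝓘(ℝ, C2) (fun p : S3 ↦ (φ t p : C2)) (γ 0) =
      (mfderiv 𝓘(ℝ, E3) 𝓘(ℝ, C2) ((↑) : S3 → C2) (φ t (γ 0))).comp
        (mfderiv 𝓘(ℝ, E3) 𝓘(ℝ, E3) (φ t) (γ 0)) :=
    mfderiv_comp (γ 0) (mdifferentiableAt_coe_sphere (φ t (γ 0))) hd
  have h5 : HasMFDerivAt 𝓘(ℝ, E3) 𝓘(ℝ, C2)
      (fun p : S3 ↦ Complex.exp (2 * Complex.I * t) • (p : C2)) (γ 0)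
      ((ContinuousLinearMap.lsmul ℝ ℂ (E := C2) (Complex.exp (2 * Complex.I * t))).comp
        (tangentIncl (γ 0))) := by
    have h6 := (ContinuousLinearMap.lsmul ℝ ℂ (E := C2)
      (Complex.exp (2 * Complex.I * t))).hasFDerivAt (x := (γ 0 : C2))
    exact h6.hasMFDerivAt.comp (γ 0) (mdifferentiableAt_coe_sphere (γ 0)).hasMFDerivAt
  rw [h4, h5.mfderiv] at h3
  exact DFunLike.congr_fun h3 v

end Sphere

/-! ### The Hopf frame and continuous vector fields on the sphere -/

section Frame

open Complex

/-- A unit vector Hermitian orthogonal to `z ∈ S³`. -/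
def hopfFrame (z : C2) : C2 := !₂[-(starRingEnd ℂ) (z 1), (starRingEnd ℂ) (z 0)]

theorem inner_C2 (x y : C2) :
    inner ℂ x y = (starRingEnd ℂ) (x 0) * y 0 + (starRingEnd ℂ) (x 1) * y 1 := by
  simp [PiLp.inner_apply, Fin.sum_univ_two, mul_comm]

theorem hopfFrame_zero (z : C2) : hopfFrame z 0 = -(starRingEnd ℂ) (z 1) := rfl

theorem hopfFrame_one (z : C2) : hopfFrame z 1 = (starRingEnd ℂ) (z 0) := rfl

theorem inner_hopfFrame (z : C2) : inner ℂ z (hopfFrame z) = 0 := by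
  rw [inner_C2, hopfFrame_zero, hopfFrame_one]; ring

theorem inner_hopfFrame_self (z : S3) : inner ℂ (hopfFrame z) (hopfFrame z) = 1 := by
  have h := inner_self_sphere z
  rw [inner_C2] at h
  rw [inner_C2, hopfFrame_zero, hopfFrame_one, ← h]
  simp
  ring

/-- Conjugate linearity is the source of the second rotation: along the flow `e^{2it}` the frame
turns backwards, so in it the linearized flow is `e^{4it}`. -/
theorem hopfFrame_smul (u : ℂ) (z : C2) :
    hopfFrame (u • z) = (starRingEnd ℂ) u • hopfFrame z := by
  ext i
  fin_cases i <;> simp [hopfFrame]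

theorem eq_smul_hopfFrame (z : S3) {x : C2} (h : inner ℂ (z : C2) x = 0) :
    x = inner ℂ (hopfFrame z) x • hopfFrame z := by
  have h1 := inner_self_sphere z
  rw [inner_C2] at h1 h
  ext i
  fin_cases i
  · change x 0 = inner ℂ (hopfFrame z) x * hopfFrame z 0
    rw [inner_C2, hopfFrame_zero, hopfFrame_one]
    simp only [map_neg, Complex.conj_conj]
    linear_combination (-x 0) * h1 + (z : C2) 0 * h
  · change x 1 = inner ℂ (hopfFrame z) x * hopfFrame z 1
    rw [inner_C2, hopfFrame_zero, hopfFrame_one]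
    simp only [map_neg, Complex.conj_conj]
    linear_combination (-x 1) * h1 + (z : C2) 1 * h

theorem continuous_hopfFrame : Continuous hopfFrame := by
  refine (PiLp.continuous_toLp 2 _).comp (continuous_pi fun i ↦ ?_)
  fin_cases i
  · exact (Complex.continuous_conj.comp (by fun_prop)).neg
  · exact Complex.continuous_conj.comp (by fun_prop)

theorem continuousOn_tangentIncl {X : Type*} [TopologicalSpace X] {s : Set X} {u : X → S3}
    {V : (x : X) → TangentSpace 𝓘(ℝ, E3) (u x)}
    (h : ContinuousOn (fun x ↦ (⟨u x, V x⟩ : TangentBundle 𝓘(ℝ, E3) S3)) s) :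
    ContinuousOn (fun x ↦ tangentIncl (u x) (V x)) s := by
  have : IsManifold 𝓘(ℝ, E3) 1 S3 := .of_le (n := ∞) (by norm_cast)
  have h1 : Continuous (tangentMap 𝓘(ℝ, E3) 𝓘(ℝ, C2) ((↑) : S3 → C2)) :=
    (contMDiff_coe_sphere (E := C2) (n := 3) (m := 1)).continuous_tangentMap le_rfl
  have h2 : Continuous (fun p : TangentBundle 𝓘(ℝ, C2) C2 ↦ (p.2 : C2)) :=
    continuous_snd.comp (tangentBundleModelSpaceHomeomorph 𝓘(ℝ, C2)).continuous
  exact (h2.comp h1).comp_continuousOn h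

theorem eq_of_tangentIncl_eq {p q : S3} (h : p = q) {v w : E3}
    (hv : tangentIncl p v = tangentIncl q w) : v = w := by
  subst h
  exact tangentIncl_injective p hv

/-- The field is the velocity at `t = 0` of the great circles `cos t z + sin t L z`. So it is the
tangent map of a `C¹` map `S³ × ℝ → S³` applied to the continuous section `(0, ∂_t)`. -/
theorem continuous_section_of_tangentIncl (L : C2 →L[ℝ] C2) (hn : ∀ z : S3, ‖L z‖ = 1)
    (h : ∀ z : S3, (inner ℂ (z : C2) (L z)).re = 0) (V : (z : S3) → TangentSpace 𝓘(ℝ, E3) z)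
    (hV : ∀ z, tangentIncl z (V z) = L z) :
    Continuous (fun z ↦ (⟨z, V z⟩ : TangentBundle 𝓘(ℝ, E3) S3)) := by
  have : IsManifold 𝓘(ℝ, E3) 1 S3 := .of_le (n := ∞) (by norm_cast)
  let f : S3 × ℝ → C2 := fun p ↦ Real.cos p.2 • (p.1 : C2) + Real.sin p.2 • L p.1
  have hf : ContMDiff (𝓘(ℝ, E3).prod 𝓘(ℝ, ℝ)) 𝓘(ℝ, C2) 1 f := by
    have h1 : ContMDiff (𝓘(ℝ, E3).prod 𝓘(ℝ, ℝ)) 𝓘(ℝ, C2) 1 (fun p : S3 × ℝ ↦ (p.1 : C2)) :=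
      (contMDiff_coe_sphere (E := C2) (n := 3) (m := 1)).comp contMDiff_fst
    have h2 : ContMDiff (𝓘(ℝ, E3).prod 𝓘(ℝ, ℝ)) 𝓘(ℝ, C2) 1 (fun p : S3 × ℝ ↦ L (p.1 : C2)) :=
      L.contDiff.contMDiff.comp h1
    have h3 : ContMDiff (𝓘(ℝ, E3).prod 𝓘(ℝ, ℝ)) 𝓘(ℝ, ℝ) 1 (fun p : S3 × ℝ ↦ Real.cos p.2) :=
      Real.contDiff_cos.contMDiff.comp contMDiff_snd
    have h4 : ContMDiff (𝓘(ℝ, E3).prod 𝓘(ℝ, ℝ)) 𝓘(ℝ, ℝ) 1 (fun p : S3 × ℝ ↦ Real.sin p.2) :=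
      Real.contDiff_sin.contMDiff.comp contMDiff_snd
    exact (h3.smul h1).add (h4.smul h2)
  have hmem : ∀ p, f p ∈ Metric.sphere (0 : C2) 1 := by
    intro p
    rw [mem_sphere_zero_iff_norm, ← sq_eq_sq₀ (norm_nonneg _) zero_le_one,
      norm_add_sq_real, norm_smul, norm_smul, norm_coe_sphere, hn, real_inner_smul_left,
      real_inner_smul_right, real_inner_eq_re, h]
    simp
  let c : S3 × ℝ → S3 := Set.codRestrict f _ hmem
  have hc : ContMDiff (𝓘(ℝ, E3).prod 𝓘(ℝ, ℝ)) 𝓘(ℝ, E3) 1 c :=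
    hf.codRestrict_sphere (n := 3) hmem
  have hT := hc.continuous_tangentMap le_rfl
  have hS : Continuous (fun z : S3 ↦ (equivTangentBundleProd 𝓘(ℝ, E3) S3 𝓘(ℝ, ℝ) ℝ).symm
      (⟨z, 0⟩, ⟨(0 : ℝ), (1 : ℝ)⟩)) := by
    have h1 : Continuous ((equivTangentBundleProd 𝓘(ℝ, E3) S3 𝓘(ℝ, ℝ) ℝ).symm) :=
      (contMDiff_equivTangentBundleProd_symm (n := 0)).continuous
    have h2 : Continuous (Bundle.zeroSection E3 (TangentSpace 𝓘(ℝ, E3) (M := S3))) :=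
      (Bundle.contMDiff_zeroSection ℝ (TangentSpace 𝓘(ℝ, E3) (M := S3)) (n := 0) (IB := 𝓘(ℝ, E3))).continuous
    exact h1.comp (h2.prodMk continuous_const)
  refine (hT.comp hS).congr fun z ↦ ?_
  have hz : c (z, 0) = z := by
    apply Subtype.ext
    change f (z, 0) = z
    simp [f]
  refine tangentBundle_mk_congr hz ?_
  refine eq_of_tangentIncl_eq hz ?_
  rw [hV]
  have hd1 : MDifferentiableAt (𝓘(ℝ, E3).prod 𝓘(ℝ, ℝ)) 𝓘(ℝ, E3) c (z, 0) :=
    hc.mdifferentiableAt (by simp)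
  have hd2 : MDifferentiableAt (𝓘(ℝ, E3).prod 𝓘(ℝ, ℝ)) 𝓘(ℝ, C2) f (z, 0) :=
    hf.mdifferentiableAt (by simp)
  have hd3 : HasMFDerivAt 𝓘(ℝ, ℝ) (𝓘(ℝ, E3).prod 𝓘(ℝ, ℝ)) (fun t : ℝ ↦ (z, t)) 0
      (ContinuousLinearMap.inr ℝ E3 ℝ) := by
    have := mfderiv_prod_right (I := 𝓘(ℝ, E3)) (I' := 𝓘(ℝ, ℝ)) (x₀ := z) (y₀ := (0 : ℝ))
    exact this ▸ (mdifferentiableAt_const.prodMk mdifferentiableAt_id).hasMFDerivAt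
  have e1 : mfderiv (𝓘(ℝ, E3).prod 𝓘(ℝ, ℝ)) 𝓘(ℝ, C2) f (z, 0) =
      (tangentIncl (c (z, 0))).comp (mfderiv (𝓘(ℝ, E3).prod 𝓘(ℝ, ℝ)) 𝓘(ℝ, E3) c (z, 0)) :=
    mfderiv_comp (z, (0 : ℝ)) (mdifferentiableAt_coe_sphere (c (z, 0))) hd1
  have e2 := (hd2.hasMFDerivAt.comp (0 : ℝ) hd3).mfderiv
  have e3 : HasDerivAt (f ∘ fun t : ℝ ↦ (z, t)) (L z) 0 := by
    have h1 := ((Real.hasDerivAt_cos 0).smul_const (z : C2)).add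
      ((Real.hasDerivAt_sin 0).smul_const (L z))
    refine h1.congr_deriv ?_
    simp
  rw [mfderiv_eq_fderiv] at e2
  have e4 := DFunLike.congr_fun e2 (1 : ℝ)
  have e5 : fderiv ℝ (f ∘ fun t : ℝ ↦ (z, t)) 0 1 = L z := by
    rw [e3.hasFDerivAt.fderiv]; simp
  have e6 := e5.symm.trans e4
  refine Eq.trans ?_ e6.symm
  exact (DFunLike.congr_fun e1 ((0 : E3), (1 : ℝ))).symm

end Frame

/-! ### The index bound on the sphere -/

section SphereIndex

theorem stdForm_d_congr {p p₁ p₂ : S3} (h₁ : p = p₁) (h₂ : p = p₂) (v w : E3) :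
    OneForm.d (M := S3) stdForm p v w = (inner ℂ (tangentIncl p₁ v) (tangentIncl p₂ w)).im := by
  subst h₁ h₂
  exact stdForm_d p v w

theorem inner_smul_hopfFrame (z : S3) (a b : ℂ) :
    inner ℂ (a • hopfFrame z) (b • hopfFrame z) = (starRingEnd ℂ) a * b := by
  rw [inner_smul_left, inner_smul_right, inner_hopfFrame_self, mul_one]

/-- The complex coordinate of a tangent vector of `S³` with respect to `hopfFrame`. -/
def hopfCoord (z : S3) (v : TangentSpace 𝓘(ℝ, E3) z) : ℂ :=
  inner ℂ (hopfFrame z) (tangentIncl z v)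

theorem tangentIncl_eq_hopfCoord_smul {z : S3} {v : TangentSpace 𝓘(ℝ, E3) z}
    (h : stdForm z v = 0) : tangentIncl z v = hopfCoord z v • hopfFrame z :=
  eq_smul_hopfFrame z (inner_sphere_eq_zero h)

theorem three_le_orbitIndex {γ : ℝ → S3} {T : ℝ}
    (hγ : IsClosedReebOrbit (M := S3) stdForm γ T) :
    ((2 + 1 : ℕ) : EReal) ≤ orbitIndex (M := S3) 2 stdForm γ T := by
  refine le_iInf₂ fun Ψ hΨ ↦ ?_
  obtain ⟨φ, u, F, hφ, hu, hF, hΨ⟩ := hΨ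
  obtain ⟨k, hk, hT⟩ := hγ.exists_period_eq
  have hcont : ∀ c, ContinuousOn (fun z ↦ hopfCoord (u z) (F z c)) (Metric.closedBall 0 1) := by
    intro c
    refine ContinuousOn.inner ?_ (continuousOn_tangentIncl (hF.continuousOn c))
    exact (continuous_hopfFrame.comp continuous_subtype_val).comp_continuousOn hu.1
  have hcoord : ∀ z ∈ Metric.closedBall (0 : ℂ) 1, ∀ c,
      tangentIncl (u z) (F z c) = hopfCoord (u z) (F z c) • hopfFrame (u z) :=
    fun z hz c ↦ tangentIncl_eq_hopfCoord_smul ((hF.symplectic z hz).mem_ker c)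
  refine three_le_of_rotation (hcont (.inl 0)) (hcont (.inr 0)) ?_ hk (Ψ := Ψ) ?_
  · intro z hz
    have h := (hF.symplectic z hz).inl_inr 0 0
    rw [stdForm_d, hcoord z hz, hcoord z hz, inner_smul_hopfFrame] at h
    simpa using h
  intro t
  rw [hΨ t]
  have hball := exp_mem_closedBall (t : ℝ)
  have hball1 : (1 : ℂ) ∈ Metric.closedBall (0 : ℂ) 1 := by simp
  have hTt : T * t ∈ Icc 0 T :=
    ⟨mul_nonneg hγ.pos.le t.2.1, mul_le_of_le_one_right hγ.pos.le t.2.2⟩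
  have hut := hu.2 t
  have hu1 : u 1 = γ 0 := by simpa using hu.2 0
  have hflow := isContactForm_stdForm.eq_flow hγ hφ hTt
  set e : ℂ := Complex.exp (2 * Real.pi * Complex.I * ((t : ℝ) : ℂ)) with he
  set U : ℂ := Complex.exp (2 * Complex.I * ((T * t : ℝ) : ℂ)) with hU
  -- With `T = kπ` both sides are `e^{4iTt}`. One factor `U` is the linearized flow, the other the
  -- rotation of the Hopf frame along the orbit.
  have hUU : Complex.exp (((4 * Real.pi * k * t : ℝ) : ℂ) * Complex.I) = U * U := by
    rw [hU, ← Complex.exp_add, hT]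
    congr 1
    push_cast
    ring
  have h1 : ∀ c, tangentIncl (φ (T * t) (γ 0))
      (mfderiv 𝓘(ℝ, E3) 𝓘(ℝ, E3) (φ (T * t)) (γ 0) (F 1 c)) =
        (U * hopfCoord (u 1) (F 1 c)) • hopfFrame (γ 0) := by
    intro c
    refine (hφ.tangentIncl_mfderiv hTt (F 1 c)).trans ?_
    rw [mul_smul, ← hu1]
    refine congrArg (U • ·) ?_
    exact hcoord 1 hball1 c
  -- Moving the frame back to the Hopf vector at `γ 0` makes both arguments of `dα` multiples of one
  -- unit vector.
  have h2 : ∀ c, tangentIncl (u e) (F e c) =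
      (hopfCoord (u e) (F e c) * (starRingEnd ℂ) U) • hopfFrame (γ 0) := by
    intro c
    refine (hcoord e hball c).trans ?_
    rw [mul_smul, ← hopfFrame_smul, hut, hγ.coe_eq_exp_smul (T * t)]
  have h3 : ∀ c d, OneForm.d (M := S3) stdForm (γ (T * t))
      (mfderiv 𝓘(ℝ, E3) 𝓘(ℝ, E3) (φ (T * t)) (γ 0) (F 1 c)) (F e d) =
      ((starRingEnd ℂ) (U * U * hopfCoord (u 1) (F 1 c)) * hopfCoord (u e) (F e d)).im := by
    intro c d
    refine (stdForm_d_congr hflow.symm hut.symm _ _).trans ?_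
    rw [h1, h2, inner_smul_hopfFrame]
    congr 1
    simp only [map_mul]
    ring
  have h4 : ∀ c d, OneForm.d (M := S3) stdForm (γ (T * t)) (F e d)
      (mfderiv 𝓘(ℝ, E3) 𝓘(ℝ, E3) (φ (T * t)) (γ 0) (F 1 c)) =
      ((starRingEnd ℂ) (hopfCoord (u e) (F e d)) * (U * U * hopfCoord (u 1) (F 1 c))).im := by
    intro c d
    refine (stdForm_d_congr hut.symm hflow.symm _ _).trans ?_
    rw [h1, h2, inner_smul_hopfFrame]
    congr 1
    simp only [map_mul, Complex.conj_conj]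
    ring
  rw [hUU]
  ext r c
  rcases r with r | r <;> rcases c with c | c <;> fin_cases r <;> fin_cases c
  · exact h3 (.inl 0) (.inr 0)
  · exact h3 (.inr 0) (.inr 0)
  · exact h4 (.inl 0) (.inl 0)
  · exact h4 (.inr 0) (.inl 0)

end SphereIndex

/-! ### The lens group preserves the contact form -/

section LensAction

variable {p q : ℕ}

theorem LensGroup.conj_mul_val [NeZero p] (g : LensGroup p q) :
    (starRingEnd ℂ) g.val * g.val = 1 := by
  rw [Complex.conj_mul', g.norm_val]; simp

theorem LensGroup.inner_rotate [NeZero p] (g : LensGroup p q) (x y : C2) :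
    inner ℂ (g.rotate x) (g.rotate y) = inner ℂ x y := by
  have h := g.conj_mul_val
  have h' : (starRingEnd ℂ) g.val ^ q * g.val ^ q = 1 := by rw [← mul_pow, h, one_pow]
  rw [inner_C2, inner_C2]
  simp only [LensGroup.rotate, PiLp.toLp_apply, Matrix.cons_val_zero, Matrix.cons_val_one, map_mul,
    map_pow]
  linear_combination (starRingEnd ℂ) (x 0) * y 0 * h + (starRingEnd ℂ) (x 1) * y 1 * h'

theorem LensGroup.rotate_smul (g : LensGroup p q) (c : ℂ) (x : C2) :
    g.rotate (c • x) = c • g.rotate x := by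
  ext i
  fin_cases i <;> simp [LensGroup.rotate] <;> ring

/-- The Hopf frame is not invariant: a unitary map multiplies it by its determinant, here that of
`diag(ζ, ζ^q)`. -/
theorem LensGroup.rotate_hopfFrame [NeZero p] (g : LensGroup p q) (x : C2) :
    g.rotate (hopfFrame x) = g.val ^ (q + 1) • hopfFrame (g.rotate x) := by
  have h := g.conj_mul_val
  have h' : (starRingEnd ℂ) g.val ^ q * g.val ^ q = 1 := by rw [← mul_pow, h, one_pow]
  ext i
  fin_cases i
  · simp only [LensGroup.rotate, hopfFrame, PiLp.smul_apply, PiLp.toLp_apply, Fin.zero_eta,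
      Matrix.cons_val_zero, Matrix.cons_val_one, map_mul, map_pow, smul_eq_mul]
    linear_combination (g.val * (starRingEnd ℂ) (x 1)) * h'
  · simp only [LensGroup.rotate, hopfFrame, PiLp.smul_apply, PiLp.toLp_apply, Fin.mk_one,
      Matrix.cons_val_zero, Matrix.cons_val_one, map_mul, smul_eq_mul]
    linear_combination (-g.val ^ q * (starRingEnd ℂ) (x 0)) * h

/-- `LensGroup.rotate` as a linear map. -/
def LensGroup.rotateCLM (g : LensGroup p q) : C2 →L[ℝ] C2 :=
  LinearMap.toContinuousLinearMap
    { toFun := g.rotate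
      map_add' := fun x y ↦ by
        ext i
        fin_cases i <;> simp [LensGroup.rotate, mul_add]
      map_smul' := fun r x ↦ by
        ext i
        fin_cases i <;> simp [LensGroup.rotate] <;> ring }

theorem LensGroup.mdifferentiableAt_smul [NeZero p] (g : LensGroup p q) (z : S3) :
    MDifferentiableAt 𝓘(ℝ, E3) 𝓘(ℝ, E3) (fun x : S3 ↦ g • x) z :=
  (IsSmoothAction.contMDiff_smul (E := E3) g).mdifferentiable (by simp) z

theorem tangentIncl_mfderiv_smul [NeZero p] (g : LensGroup p q) (z : S3)
    (v : TangentSpace 𝓘(ℝ, E3) z) :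
    tangentIncl (g • z) (mfderiv 𝓘(ℝ, E3) 𝓘(ℝ, E3) (fun x : S3 ↦ g • x) z v) =
      g.rotate (tangentIncl z v) := by
  have h1 : mfderiv 𝓘(ℝ, E3) 𝓘(ℝ, C2) (fun x : S3 ↦ ((g • x : S3) : C2)) z =
      (tangentIncl (g • z)).comp (mfderiv 𝓘(ℝ, E3) 𝓘(ℝ, E3) (fun x : S3 ↦ g • x) z) :=
    mfderiv_comp z (mdifferentiableAt_coe_sphere (g • z)) (g.mdifferentiableAt_smul z)
  have h2 : HasMFDerivAt 𝓘(ℝ, E3) 𝓘(ℝ, C2) (fun x : S3 ↦ g.rotateCLM (x : C2)) z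
      (g.rotateCLM.comp (tangentIncl z)) :=
    (g.rotateCLM.hasFDerivAt (x := (z : C2))).hasMFDerivAt.comp z
      (mdifferentiableAt_coe_sphere z).hasMFDerivAt
  exact DFunLike.congr_fun (h1.symm.trans h2.mfderiv) v

theorem stdForm_pullback_smul [NeZero p] (g : LensGroup p q) :
    OneForm.pullback (fun x : S3 ↦ g • x) stdForm = stdForm := by
  funext z
  ext v
  change 1 / 2 * (inner ℂ ((g • z : S3) : C2) (tangentIncl (g • z)
    (mfderiv 𝓘(ℝ, E3) 𝓘(ℝ, E3) (fun x : S3 ↦ g • x) z v))).im = _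
  rw [tangentIncl_mfderiv_smul, stdForm_apply]
  exact congrArg (fun w : ℂ ↦ 1 / 2 * w.im) (g.inner_rotate z (tangentIncl z v))

end LensAction

/-! ### A global unitary frame on the sphere -/

section SphereFrame

/-- The complex coordinates of the symplectic basis `(e, I e)`. -/
def frameCoeff (c : Fin 1 ⊕ Fin 1) : ℂ := Sum.elim (fun _ ↦ 1) (fun _ ↦ Complex.I) c

theorem exists_sphereFrame (z : S3) (c : Fin 1 ⊕ Fin 1) :
    ∃ v : TangentSpace 𝓘(ℝ, E3) z, tangentIncl z v = frameCoeff c • hopfFrame z :=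
  exists_tangentIncl_eq z (by rw [inner_smul_right, inner_hopfFrame]; simp)

/-- A global symplectic frame of the standard contact structure on `S³`. -/
def sphereFrame (z : S3) (c : Fin 1 ⊕ Fin 1) : TangentSpace 𝓘(ℝ, E3) z :=
  (exists_sphereFrame z c).choose

theorem tangentIncl_sphereFrame (z : S3) (c : Fin 1 ⊕ Fin 1) :
    tangentIncl z (sphereFrame z c) = frameCoeff c • hopfFrame z :=
  (exists_sphereFrame z c).choose_spec

theorem isSymplecticBasis_sphereFrame (z : S3) :
    IsSymplecticBasis (M := S3) stdForm z (sphereFrame z) where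
  mem_ker c := by
    rw [stdForm_apply, tangentIncl_sphereFrame, inner_smul_right, inner_hopfFrame]; simp
  inl_inl i j := by
    rw [stdForm_d, tangentIncl_sphereFrame, tangentIncl_sphereFrame, inner_smul_hopfFrame]
    simp [frameCoeff]
  inr_inr i j := by
    rw [stdForm_d, tangentIncl_sphereFrame, tangentIncl_sphereFrame, inner_smul_hopfFrame]
    simp [frameCoeff]
  inl_inr i j := by
    rw [stdForm_d, tangentIncl_sphereFrame, tangentIncl_sphereFrame, inner_smul_hopfFrame,
      if_pos (Subsingleton.elim i j)]
    simp [frameCoeff]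

/-- `hopfFrame` as a real linear map. -/
def hopfFrameCLM : C2 →L[ℝ] C2 :=
  LinearMap.toContinuousLinearMap
    { toFun := hopfFrame
      map_add' := fun x y ↦ by
        ext i
        fin_cases i
        · simp [hopfFrame]; ring
        · simp [hopfFrame]
      map_smul' := fun r x ↦ by
        ext i
        fin_cases i <;> simp [hopfFrame] }

theorem continuous_sphereFrame (c : Fin 1 ⊕ Fin 1) :
    Continuous (fun z ↦ (⟨z, sphereFrame z c⟩ : TangentBundle 𝓘(ℝ, E3) S3)) := by
  refine continuous_section_of_tangentIncl
    ((ContinuousLinearMap.lsmul ℝ ℂ (E := C2) (frameCoeff c)).comp hopfFrameCLM)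
    (fun z ↦ ?_) (fun z ↦ ?_) (fun z ↦ sphereFrame z c) (fun z ↦ tangentIncl_sphereFrame z c)
  · change ‖frameCoeff c • hopfFrame z‖ = 1
    have h1 : ‖hopfFrame z‖ = 1 := by
      have h := inner_hopfFrame_self z
      rw [inner_self_eq_norm_sq_to_K] at h
      have h' : (‖hopfFrame z‖ : ℂ) ^ 2 = 1 := h
      have h2 : ‖hopfFrame z‖ ^ 2 = 1 := by exact_mod_cast h'
      exact (pow_eq_one_iff_of_nonneg (norm_nonneg _) two_ne_zero).mp h2
    rw [norm_smul, h1, mul_one]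
    rcases c with c | c <;> simp [frameCoeff]
  · change (inner ℂ (z : C2) (frameCoeff c • hopfFrame z)).re = 0
    rw [inner_smul_right, inner_hopfFrame]; simp

/-- The real matrix of the multiplication by a complex number. -/
def mulMatrix (u : ℂ) : Mat 1 :=
  Matrix.of fun r c ↦ Sum.elim (fun _ ↦ (u * frameCoeff c).re) (fun _ ↦ (u * frameCoeff c).im) r

theorem complexDet_mulMatrix (u : ℂ) : complexDet (mulMatrix u) = u := by
  apply Complex.ext <;> simp [complexDet, mulMatrix, frameCoeff]

theorem mulMatrix_transpose_mul_self {u : ℂ} (h : ‖u‖ = 1) :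
    (mulMatrix u).transpose * mulMatrix u = 1 := by
  have h1 : u.re * u.re + u.im * u.im = 1 := by
    rw [← Complex.normSq_apply, Complex.normSq_eq_norm_sq, h, one_pow]
  ext r c
  rcases r with r | r <;> rcases c with c | c <;> fin_cases r <;> fin_cases c <;>
    simp [Matrix.mul_apply, mulMatrix, frameCoeff] <;> linarith

theorem coordMatrix_sphereFrame (z : S3) (u : ℂ) (w : Fin 1 ⊕ Fin 1 → TangentSpace 𝓘(ℝ, E3) z)
    (hw : ∀ c, tangentIncl z (w c) = (u * frameCoeff c) • hopfFrame z) :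
    coordMatrix (M := S3) stdForm z (sphereFrame z) w = mulMatrix u := by
  ext r c
  rcases r with r | r
  · simp only [coordMatrix, mulMatrix, Matrix.of_apply, Sum.elim_inl]
    rw [stdForm_d, hw, tangentIncl_sphereFrame, inner_smul_hopfFrame]
    simp [frameCoeff]
  · simp only [coordMatrix, mulMatrix, Matrix.of_apply, Sum.elim_inr]
    rw [stdForm_d, hw, tangentIncl_sphereFrame, inner_smul_hopfFrame]
    simp [frameCoeff]

end SphereFrame

/-! ### The rational Chern class of lens spaces -/

section LensChern

variable (p q : ℕ) [NeZero p] [Fact (Nat.Coprime p q)]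

/-- The projection of `S³` onto the lens space. -/
def lensProj : S3 → LensSpace p q := Quotient.mk (MulAction.orbitRel (LensGroup p q) S3)

theorem isLocalHomeomorph_lensProj : IsLocalHomeomorph (lensProj p q) :=
  (isCoveringMap_quotientMk (G := LensGroup p q) (M := S3)).isLocalHomeomorph

theorem isLocalDiffeomorph_lensProj :
    IsLocalDiffeomorph 𝓘(ℝ, E3) 𝓘(ℝ, E3) ∞ (lensProj p q) :=
  isLocalDiffeomorph_quotientMk (E := E3) (G := LensGroup p q) (M := S3)

/-- A local section of the projection onto the lens space, near `i`. -/
def lensSection (i : LensSpace p q) : OpenPartialHomeomorph (LensSpace p q) S3 :=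
  (isLocalHomeomorph_lensProj p q).localInverseAt (Quotient.out i)

variable {p q}

omit [Fact (Nat.Coprime p q)] in
theorem lensProj_smul (g : LensGroup p q) (z : S3) : lensProj p q (g • z) = lensProj p q z :=
  Quotient.sound ⟨g, rfl⟩

theorem mem_lensSection_source (i : LensSpace p q) : i ∈ (lensSection p q i).source := by
  have h := (isLocalHomeomorph_lensProj p q).apply_self_mem_localInverseAt_source
    (x := Quotient.out i)
  have e : lensProj p q (Quotient.out i) = i := Quotient.out_eq i
  rwa [e] at h

theorem lensProj_lensSection {i x : LensSpace p q} (hx : x ∈ (lensSection p q i).source) :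
    lensProj p q (lensSection p q i x) = x :=
  (isLocalHomeomorph_lensProj p q).apply_localInverseAt_of_mem hx

theorem lensSection_lensProj {i : LensSpace p q} {z : S3} (hz : z ∈ (lensSection p q i).target) :
    lensSection p q i (lensProj p q z) = z := by
  have h := (lensSection p q i).right_inv hz
  rwa [lensSection, IsLocalHomeomorph.localInverseAt_symm] at h

theorem exists_smul_lensSection_eq {i j x : LensSpace p q} (hi : x ∈ (lensSection p q i).source)
    (hj : x ∈ (lensSection p q j).source) :
    ∃ g : LensGroup p q, g • lensSection p q j x = lensSection p q i x :=
  Quotient.exact ((lensProj_lensSection hi).trans (lensProj_lensSection hj).symm)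

/-- The group element relating two local sections is locally constant, and therefore so are the
transition functions. -/
theorem eventually_smul_lensSection_eq {i j x : LensSpace p q}
    (hi : x ∈ (lensSection p q i).source) (hj : x ∈ (lensSection p q j).source)
    {g : LensGroup p q} (hg : g • lensSection p q j x = lensSection p q i x) :
    ∀ᶠ y in 𝓝 x, g • lensSection p q j y = lensSection p q i y := by
  have hc : ContinuousAt (fun y ↦ g • lensSection p q j y) x :=
    (continuous_const_smul g).continuousAt.comp ((lensSection p q j).continuousAt hj)
  have ht : (lensSection p q i).target ∈ 𝓝 (g • lensSection p q j x) := by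
    rw [hg]
    exact (lensSection p q i).open_target.mem_nhds ((lensSection p q i).map_source hi)
  filter_upwards [hc ht, (lensSection p q j).open_source.mem_nhds hj] with y hy hyj
  have h := lensSection_lensProj hy
  rw [lensProj_smul, lensProj_lensSection hyj] at h
  exact h.symm

/-- The frame of the contact structure of the lens space given by a local section. -/
def lensFrame (i x : LensSpace p q) (c : Fin 1 ⊕ Fin 1) : TangentSpace 𝓘(ℝ, E3) x :=
  (mfderiv 𝓘(ℝ, E3) 𝓘(ℝ, E3) (lensProj p q) (lensSection p q i x)
    (sphereFrame (lensSection p q i x) c) : E3)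

theorem continuousOn_lensFrame (i : LensSpace p q) (c : Fin 1 ⊕ Fin 1) :
    ContinuousOn (fun x ↦ (⟨x, lensFrame i x c⟩ : TangentBundle 𝓘(ℝ, E3) (LensSpace p q)))
      (lensSection p q i).source := by
  have : IsManifold 𝓘(ℝ, E3) 1 S3 := .of_le (n := ∞) (by norm_cast)
  have : IsManifold 𝓘(ℝ, E3) 1 (LensSpace p q) := .of_le (n := ∞) (by norm_cast)
  have h1 : Continuous (tangentMap 𝓘(ℝ, E3) 𝓘(ℝ, E3) (lensProj p q)) :=
    ((isLocalDiffeomorph_lensProj p q).contMDiff.of_le (by norm_cast)).continuous_tangentMap le_rfl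
  have h2 := (h1.comp (continuous_sphereFrame c)).comp_continuousOn
    (lensSection p q i).continuousOn
  refine h2.congr fun x hx ↦ ?_
  exact tangentBundle_mk_congr (lensProj_lensSection hx).symm rfl

theorem mfderiv_lensProj_smul (g : LensGroup p q) (z : S3) (v : TangentSpace 𝓘(ℝ, E3) z) :
    (mfderiv 𝓘(ℝ, E3) 𝓘(ℝ, E3) (lensProj p q) z v : E3) =
      (mfderiv 𝓘(ℝ, E3) 𝓘(ℝ, E3) (lensProj p q) (g • z)
        (mfderiv 𝓘(ℝ, E3) 𝓘(ℝ, E3) (fun y : S3 ↦ g • y) z v) : E3) := by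
  have h1 : lensProj p q ∘ (fun y : S3 ↦ g • y) = lensProj p q := funext (lensProj_smul g)
  have h3 : HasMFDerivAt 𝓘(ℝ, E3) 𝓘(ℝ, E3) (lensProj p q ∘ (fun y : S3 ↦ g • y)) z
    ((mfderiv 𝓘(ℝ, E3) 𝓘(ℝ, E3) (lensProj p q) (g • z)).comp
      (mfderiv 𝓘(ℝ, E3) 𝓘(ℝ, E3) (fun y : S3 ↦ g • y) z)) :=
    ((isLocalDiffeomorph_lensProj p q).mdifferentiable (by simp) (g • z)).hasMFDerivAt.comp z
      (g.mdifferentiableAt_smul z).hasMFDerivAt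
  rw [h1] at h3
  exact DFunLike.congr_fun h3.mfderiv v

variable {α' : OneForm E3 (LensSpace p q)}

/-- The two sections differ by `g`, so their frames differ by `dg`, which acts on the Hopf frame as
multiplication by `ζ^{q+1}`. -/
theorem coordMatrix_lensFrame (hα' : α'.IsSmooth) (h : α'.pullback (lensProj p q) = stdForm)
    {i j x : LensSpace p q} (hi : x ∈ (lensSection p q i).source)
    {g : LensGroup p q} (hg : g • lensSection p q j x = lensSection p q i x) :
    coordMatrix α' x (lensFrame i x) (lensFrame j x) = mulMatrix (g.val ^ (q + 1)) := by
  set y := lensSection p q j x with hy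
  let w : Fin 1 ⊕ Fin 1 → TangentSpace 𝓘(ℝ, E3) (g • y) := fun c ↦
    mfderiv 𝓘(ℝ, E3) 𝓘(ℝ, E3) (fun z : S3 ↦ g • z) y (sphereFrame y c)
  have h1 : coordMatrix (M := S3) stdForm (g • y) (sphereFrame (g • y)) w =
      mulMatrix (g.val ^ (q + 1)) := by
    refine coordMatrix_sphereFrame (g • y) _ w fun c ↦ ?_
    rw [tangentIncl_mfderiv_smul, tangentIncl_sphereFrame, g.rotate_smul, g.rotate_hopfFrame,
      smul_smul, mul_comm]
    rfl
  rw [coordMatrix_pullback (isLocalDiffeomorph_lensProj p q) hα' h] at h1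
  refine Eq.trans ?_ h1
  have hx : x = lensProj p q (g • y) := by rw [hg, lensProj_lensSection hi]
  refine coordMatrix_congr hx ?_ ?_
  · funext c
    unfold lensFrame
    rw [← hg]
  · funext c
    exact mfderiv_lensProj_smul g y (sphereFrame y c)

variable (α') in
/-- The unitary frames of the contact structure of a lens space given by the local sections. -/
def lensFrameCover (hα' : α'.IsSmooth) (h : α'.pullback (lensProj p q) = stdForm) :
    UnitaryFrameCover 1 α' where
  U i := (lensSection p q i).source
  isOpen i := (lensSection p q i).open_source
  mem := mem_lensSection_source
  frame := lensFrame
  continuousOn := continuousOn_lensFrame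
  symplectic i x hx :=
    IsSymplecticBasis.congr (lensProj_lensSection hx) rfl
      ((isSymplecticBasis_pullback_iff (isLocalDiffeomorph_lensProj p q) hα' h
        (lensSection p q i x) (sphereFrame (lensSection p q i x))).mp
          (isSymplecticBasis_sphereFrame _))
  unitary i j x hx := by
    obtain ⟨g, hg⟩ := exists_smul_lensSection_eq hx.1 hx.2
    rw [coordMatrix_lensFrame hα' h hx.1 hg]
    exact mulMatrix_transpose_mul_self (by rw [norm_pow, g.norm_val, one_pow])

theorem lensFrameCover_transition (hα' : α'.IsSmooth)
    (h : α'.pullback (lensProj p q) = stdForm)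
    {i j x : LensSpace p q} (hi : x ∈ (lensSection p q i).source)
    {g : LensGroup p q} (hg : g • lensSection p q j x = lensSection p q i x) :
    (lensFrameCover α' hα' h).transition i j x = g.val ^ (q + 1) :=
  (congrArg complexDet (coordMatrix_lensFrame hα' h hi hg)).trans (complexDet_mulMatrix _)

theorem arg_div_two_pi_mem_range {ζ : ℂ} {n : ℕ} (hn : n ≠ 0) (h : ζ ^ n = 1) :
    ζ.arg / (2 * Real.pi) ∈ (Rat.castHom ℝ).toAddMonoidHom.range := by
  have hnorm := Complex.norm_eq_one_of_pow_eq_one h hn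
  have h1 : Complex.exp (ζ.arg * Complex.I) = ζ := by
    have := Complex.norm_mul_exp_arg_mul_I ζ
    rwa [hnorm, Complex.ofReal_one, one_mul] at this
  have h2 : Complex.exp (n * (ζ.arg * Complex.I)) = 1 := by rw [Complex.exp_nat_mul, h1, h]
  obtain ⟨k, hk⟩ := Complex.exp_eq_one_iff.mp h2
  have h3 : ((n * ζ.arg : ℝ) : ℂ) * Complex.I = ((k * (2 * Real.pi) : ℝ) : ℂ) * Complex.I := by
    push_cast
    linear_combination hk
  have h4 : n * ζ.arg = k * (2 * Real.pi) := by
    exact_mod_cast mul_right_cancel₀ Complex.I_ne_zero h3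
  refine ⟨(k / n : ℚ), ?_⟩
  have hn' : (n : ℝ) ≠ 0 := Nat.cast_ne_zero.mpr hn
  change (((k / n : ℚ)) : ℝ) = _
  push_cast
  rw [div_eq_div_iff hn' (by positivity), ← h4]
  ring

theorem rationalChernClassVanishes_lens (hα' : α'.IsSmooth)
    (h : α'.pullback (lensProj p q) = stdForm) : RationalChernClassVanishes 2 α' := by
  let c := lensFrameCover α' hα' h
  let φ : LensSpace p q → LensSpace p q → LensSpace p q → ℝ :=
    fun i j x ↦ (c.transition i j x).arg / (2 * Real.pi)
  have hroot : ∀ i j, ∀ x ∈ c.U i ∩ c.U j, c.transition i j x ^ p = 1 := by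
    intro i j x hx
    obtain ⟨g, hg⟩ := exists_smul_lensSection_eq hx.1 hx.2
    rw [lensFrameCover_transition hα' h hx.1 hg, ← pow_mul, mul_comm, pow_mul, g.val_pow, one_pow]
  have hloc : ∀ i j, ∀ x ∈ c.U i ∩ c.U j, ∀ᶠ y in 𝓝 x, φ i j y = φ i j x := by
    intro i j x hx
    obtain ⟨g, hg⟩ := exists_smul_lensSection_eq hx.1 hx.2
    filter_upwards [eventually_smul_lensSection_eq hx.1 hx.2 hg, (c.isOpen i).mem_nhds hx.1]
      with y hy hyi
    simp only [φ, c]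
    rw [lensFrameCover_transition hα' h hx.1 hg, lensFrameCover_transition hα' h hyi hy]
  -- The logarithms `φ` are locally constant and rational, so they are themselves the cochain `b`
  -- whose coboundary is the Chern cocycle.
  refine ⟨c, φ, φ, fun i j x hx ↦ ?_, fun i j x hx ↦ ?_, fun i j x hx ↦ ⟨?_, hloc i j x hx⟩,
    fun i j k x hx ↦ rfl⟩
  · exact ((continuousAt_const (y := φ i j x)).congr
      ((hloc i j x hx).mono fun y hy ↦ hy.symm)).continuousWithinAt
  · have hnorm := Complex.norm_eq_one_of_pow_eq_one (hroot i j x hx) (NeZero.ne p)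
    have h1 := Complex.norm_mul_exp_arg_mul_I (c.transition i j x)
    rw [hnorm, Complex.ofReal_one, one_mul] at h1
    refine Eq.trans ?_ h1
    congr 1
    simp only [φ]
    push_cast
    field_simp
  · exact arg_div_two_pi_mem_range (NeZero.ne p) (hroot i j x hx)

theorem exists_isDynamicallyConvex_lens (p q : ℕ) [NeZero p] [Fact (Nat.Coprime p q)] :
    ∃ α' : OneForm E3 (LensSpace p q), IsContactForm α' ∧
      α'.pullback (Quotient.mk (MulAction.orbitRel (LensGroup p q) S3)) = stdForm ∧
      IsDynamicallyConvex 2 α' := by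
  obtain ⟨α', hα', h⟩ := exists_isContactForm_quotient (G := LensGroup p q) isContactForm_stdForm
    stdForm_pullback_smul
  exact ⟨α', hα', h, IsDynamicallyConvex.of_covering isCoveringMap_quotientMk
    Quotient.mk_surjective isLocalDiffeomorph_quotientMk hα'.smooth isContactForm_stdForm h
    (fun γ T hγ _ ↦ three_le_orbitIndex hγ) (rationalChernClassVanishes_lens hα'.smooth h)⟩

end LensChern

end ContactGeometry

end

theorem mainTheorem11 :
    (∀ (n : ℕ) (E : Type*) [NormedAddCommGroup E] [NormedSpace ℝ E] [FiniteDimensional ℝ E]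
      (M : Type*) [TopologicalSpace M] [T2Space M] [SecondCountableTopology M]
      [LocallyCompactSpace M] [ChartedSpace E M] [IsManifold 𝓘(ℝ, E) ∞ M]
      (G : Type*) [Group G] [MulAction G M] [ContinuousConstSMul G M] [IsSmoothAction E M G]
      [IsCancelSMul G M] [ProperlyDiscontinuousSMul G M] (α : OneForm E M),
      Module.finrank ℝ E + 1 = 2 * n →
      IsContactForm α →
      IsDynamicallyConvex n α →
      IntegralChernClassVanishes n α →
      (∀ g : G, α.pullback (fun p : M ↦ g • p) = α) →
      ∃ α' : OneForm E (MulAction.orbitRel.Quotient G M),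
        IsContactForm α' ∧
        α'.pullback (Quotient.mk (MulAction.orbitRel G M)) = α ∧
        (∀ β : OneForm E (MulAction.orbitRel.Quotient G M),
          β.pullback (Quotient.mk (MulAction.orbitRel G M)) = α → β = α') ∧
        (RationalChernClassVanishes n α' → IsDynamicallyConvex n α')) ∧
    (∀ (p q : ℕ) [NeZero p] [Fact (Nat.Coprime p q)],
      ∃ α' : OneForm (EuclideanSpace ℝ (Fin 3)) (LensSpace p q),
        IsContactForm α' ∧
        α'.pullback (Quotient.mk (MulAction.orbitRel (LensGroup p q) S3)) = stdForm ∧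
        IsDynamicallyConvex 2 α') := by
  refine ⟨?_, fun p q _ _ ↦ exists_isDynamicallyConvex_lens p q⟩
  intro n E _ _ _ M _ _ _ _ _ _ G _ _ _ _ _ _ α _ hα hconv _ hinv
  obtain ⟨α', hα', h⟩ := exists_isContactForm_quotient hα hinv
  have hπ := isLocalDiffeomorph_quotientMk (E := E) (G := G) (M := M)
  exact ⟨α', hα', h, fun β hβ ↦ OneForm.eq_of_pullback_eq hπ Quotient.mk_surjective (hβ.trans h.symm),
    IsDynamicallyConvex.of_covering isCoveringMap_quotientMk Quotient.mk_surjective hπ hα'.smooth hα h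
      hconv.index⟩
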